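/- An affine interval exchange transformation (AIET) with $d$ intervals is a bijection $T:[0,1)\to[0,1)$ for which $[0,1)$ is a disjoint union of $d$ non-empty right-open intervals such that, on each of them, $T$ has the form $x\mapsto \lambda x+\delta$ with $\lambda>0$ (the images are then again right-open intervals partitioning $[0,1)$). The orbit of $x$ is $\mathcal O(x)=\mathcal O^+(x)\cup\mathcal O^-(x)$, where $\mathcal O^{\pm}(x)=\{T^{\pm n}(x):n\ge 0\}$; it is periodic if it is finite. The limit sets $\omega(x)$ and $\alpha(x)$ are the sets of accumulation points in $[0,1)$ of $\mathcal O^+(x)$ and $\mathcal O^-(x)$, respectively. A non-periodic orbit $\mathcal O(x)$ is non-trivially recurrent if $\mathcal O(x)\subseteq\omega(x)\cap\alpha(x)$. A quasiminimal of $T$ is the closure in $[0,1)$ of a non-trivially recurrent orbit. Let $T$ be an AIET with $d$ intervals. Then the number $q$ of quasiminimals of $T$ is finite, and the number of periodic orbits of $T$ is either infinite or at most $d-2q$. -/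

import Mathlib

namespace GIET

/-- The half-open unit interval `[0,1)`, with its subspace topology. -/
abbrev I01 : Type := Set.Ico (0 : ℝ) 1

/-- `T : [0,1) → [0,1)` is an affine interval exchange transformation of `d` intervals: a bijection
of `[0,1)` such that `[0,1)` is the disjoint union of `d` non-empty right-open (top) intervals
`[a i, b i)`, on each of which `T` is affine with positive slope. As `T` is a bijection, the images
of the top intervals are automatically `d` right-open (bottom) intervals that partition `[0,1)`. The
endpoints need not be actual discontinuities of `T`. -/
def IsAIET (d : ℕ) (T : Equiv.Perm I01) : Prop :=
  ∃ a b slope shift : Fin d → ℝ,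
    (∀ i, a i < b i) ∧
    (∀ i j, i ≠ j → Disjoint (Set.Ico (a i) (b i)) (Set.Ico (a j) (b j))) ∧
    (⋃ i, Set.Ico (a i) (b i)) = Set.Ico (0 : ℝ) 1 ∧
    (∀ i, 0 < slope i) ∧
    ∀ i, ∀ x : I01, (x : ℝ) ∈ Set.Ico (a i) (b i) → (T x : ℝ) = slope i * (x : ℝ) + shift i

/-- The forward orbit `{x, T x, T² x, …}`. -/
def forwardOrbit (T : Equiv.Perm I01) (x : I01) : Set I01 :=
  Set.range fun n : ℕ => (T ^ n) x

/-- The backward orbit `{x, T⁻¹ x, T⁻² x, …}`. -/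
def backwardOrbit (T : Equiv.Perm I01) (x : I01) : Set I01 :=
  forwardOrbit T⁻¹ x

/-- The full orbit of `x`. -/
def fullOrbit (T : Equiv.Perm I01) (x : I01) : Set I01 :=
  forwardOrbit T x ∪ backwardOrbit T x

/-- The `ω`-limit set: the accumulation points in `[0,1)` of the forward orbit. -/
def omegaLim (T : Equiv.Perm I01) (x : I01) : Set I01 :=
  {y | AccPt y (Filter.principal (forwardOrbit T x))}

/-- The `α`-limit set: the accumulation points in `[0,1)` of the backward orbit. -/
def alphaLim (T : Equiv.Perm I01) (x : I01) : Set I01 :=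
  {y | AccPt y (Filter.principal (backwardOrbit T x))}

/-- The set of periodic (that is, finite) orbits of `T`. -/
def periodicOrbits (T : Equiv.Perm I01) : Set (Set I01) :=
  {O | ∃ x, O = fullOrbit T x ∧ O.Finite}

/-- The orbit of `x` is non-trivially recurrent: it is not periodic, and it is contained in both its
`ω`-limit set and its `α`-limit set. -/
def IsNontriviallyRecurrent (T : Equiv.Perm I01) (x : I01) : Prop :=
  (fullOrbit T x).Infinite ∧ fullOrbit T x ⊆ omegaLim T x ∧ fullOrbit T x ⊆ alphaLim T x

/-- The set of quasiminimals of `T`: the closures in `[0,1)` of non-trivially recurrent orbits. -/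
def quasiminimals (T : Equiv.Perm I01) : Set (Set I01) :=
  {Ω | ∃ x, IsNontriviallyRecurrent T x ∧ Ω = closure (fullOrbit T x)}

end GIET

/-! ### Split orders and exchanges of clopen intervals -/

section

open Set Filter Topology

namespace GIET

/-! Replace every point `x` by its one-sided germs x⁻ ⋖ x⁺. On the ordered space of germs the
discontinuities disappear: `T` becomes a homeomorphism exchanging `d` clopen intervals `[l i, r i]`.
The discontinuities survive only as the `2 d` endpoint germs. Each of these has a forward and a
backward half-orbit, so there are `4 d` "ends", and the theorem follows by counting where the ends
accumulate.

Upper bound. An end accumulates at no more than one class of recurrent germs, where a class is a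
limit set (`limitSet_eq_of_visits`). The reason is that return times to a clopen interval are
bounded (`bounded_return`): the first return time is constant between finitely many cuts. An orbit
accumulating at both `x` and `x'` therefore cannot shadow `x` for long without coming near `x'`.
Hence `cnt`, the number of ends visiting a germ, sums to at most `4 d` over representatives of
distinct classes (`sum_cnt_le`).

Lower bound, non-periodic recurrent germs: at least eight ends (`eight_le_cnt`). Consider the left
endpoints whose backward orbits visit `x` and contain no earlier left endpoint. If there are two of
them, both for `T` and for its inverse, each of the four kinds of ends contributes two. If there is
just one, the jump below it is the only source of cuts near `x`. Some interval near `x` then has a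
first return with a single cut. This return must swap its two pieces, because an increasing return
contradicts recurrence. It follows that the two germs of the jump return to the interval in their
original order after having been in reversed order, and this forces further endpoints to enter
(`eight_le_of_gap`). If there is none, the jump at `x` itself leads to a contradiction. Affinity
plays no role here.

Lower bound, periodic orbits, when there are finitely many: at least four ends. The multiplier is
not one, since otherwise a one-sided neighbourhood would consist of periodic points. After inverting
if necessary the orbit attracts, and then it captures a right endpoint and a left endpoint on its
right side (`exists_attracted`). Two more ends come either from the left germs of the orbit, or from
a left endpoint lying on the orbit.

Altogether `8 q + 4 p ≤ 4 d`. -/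

/-- A linear order with a sign function such that any two distinct points are separated by a jump
`v ⋖ u`, with `v` of sign `false` and `u` of sign `true`. The model is the split interval, in which
every point `x` of an interval is replaced by its two one-sided germs `x⁻ ⋖ x⁺`. -/
structure IsSplitOrder (X : Type*) [LinearOrder X] (sg : X → Bool) : Prop where
  sep : ∀ ⦃x y : X⦄, x < y → ∃ v u, x ≤ v ∧ v ⋖ u ∧ u ≤ y ∧ sg v = false ∧ sg u = true
  exists_pred : ∀ ⦃u : X⦄, sg u = true → (∀ x, u ≤ x) ∨ ∃ v, v ⋖ u
  exists_succ : ∀ ⦃v : X⦄, sg v = false → (∀ x, x ≤ v) ∨ ∃ u, v ⋖ u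

/-- A bijection of a split order that exchanges `d` clopen intervals `[l i, r i]`, increasing on each
of them. -/
structure Exchange (X : Type*) [LinearOrder X] (sg : X → Bool) (d : ℕ) where
  T : Equiv.Perm X
  l : Fin d → X
  r : Fin d → X
  le : ∀ i, l i ≤ r i
  cover : ∀ x, ∃ i, l i ≤ x ∧ x ≤ r i
  uniq : ∀ ⦃i j x⦄, l i ≤ x → x ≤ r i → l j ≤ x → x ≤ r j → i = j
  mono : ∀ ⦃i x y⦄, l i ≤ x → x < y → y ≤ r i → T x < T y
  img : ∀ ⦃i x⦄, T (l i) ≤ T x → T x ≤ T (r i) → l i ≤ x ∧ x ≤ r i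
  sg_l : ∀ i, sg (l i) = true
  sg_r : ∀ i, sg (r i) = false
  sg_T : ∀ x, sg (T x) = sg x
  split : IsSplitOrder X sg

variable {X : Type*} [LinearOrder X] {sg : X → Bool} {d : ℕ}

/-- The jump that `sep` places between two adjacent germs can only be the given one. -/
theorem IsSplitOrder.sg_of_covBy (h : IsSplitOrder X sg) {v u : X} (hc : v ⋖ u) :
    sg v = false ∧ sg u = true := by
  obtain ⟨v', u', h1, h2, h3, h4, h5⟩ := h.sep hc.lt
  have e1 : v' = v := by
    rcases h1.eq_or_lt with h | h
    · exact h.symm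
    · exact absurd (h2.lt.trans_le h3) (hc.2 h)
  have e2 : u' = u := by
    rcases h3.eq_or_lt with h | h
    · exact h
    · exact absurd h (hc.2 (h1.trans_lt h2.lt))
  exact ⟨e1 ▸ h4, e2 ▸ h5⟩

theorem IsSplitOrder.pred_of_lt (h : IsSplitOrder X sg) {x u : X} (hu : sg u = true) (hx : x < u) :
    ∃ v, v ⋖ u ∧ x ≤ v := by
  rcases h.exists_pred hu with h' | ⟨v, hv⟩
  · exact absurd hx (not_lt.2 (h' x))
  · exact ⟨v, hv, hv.le_of_lt hx⟩

theorem IsSplitOrder.succ_of_lt (h : IsSplitOrder X sg) {x v : X} (hv : sg v = false) (hx : v < x) :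
    ∃ u, v ⋖ u ∧ u ≤ x := by
  rcases h.exists_succ hv with h' | ⟨u, hu⟩
  · exact absurd hx (not_lt.2 (h' x))
  · exact ⟨u, hu, hu.ge_of_gt hx⟩

theorem IsSplitOrder.dual (h : IsSplitOrder X sg) :
    IsSplitOrder Xᵒᵈ (fun x => !sg (OrderDual.ofDual x)) where
  sep := fun x y hxy => by
    obtain ⟨v, u, h1, h2, h3, h4, h5⟩ := h.sep (x := OrderDual.ofDual y) (y := OrderDual.ofDual x) hxy
    exact ⟨OrderDual.toDual u, OrderDual.toDual v, h3, h2.toDual, h1, by simp [h5], by simp [h4]⟩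
  exists_pred := fun u hu => by
    rcases h.exists_succ (v := OrderDual.ofDual u) (by simpa using hu) with h' | ⟨v, hv⟩
    · exact Or.inl fun x => h' (OrderDual.ofDual x)
    · exact Or.inr ⟨OrderDual.toDual v, hv.toDual⟩
  exists_succ := fun u hu => by
    rcases h.exists_pred (u := OrderDual.ofDual u) (by simpa using hu) with h' | ⟨v, hv⟩
    · exact Or.inl fun x => h' (OrderDual.ofDual x)
    · exact Or.inr ⟨OrderDual.toDual v, hv.toDual⟩

namespace Exchange

variable (S : Exchange X sg d)

theorem monoLE {i : Fin d} {x y : X} (h1 : S.l i ≤ x) (h2 : x ≤ y) (h3 : y ≤ S.r i) :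
    S.T x ≤ S.T y := by
  rcases h2.eq_or_lt with h | h
  · rw [h]
  · exact (S.mono h1 h h3).le

/-- The inverse exchange. -/
def inv : Exchange X sg d where
  T := S.T⁻¹
  l := fun i => S.T (S.l i)
  r := fun i => S.T (S.r i)
  le := fun i => S.monoLE le_rfl (S.le i) le_rfl
  cover := fun x => by
    obtain ⟨i, h1, h2⟩ := S.cover (S.T⁻¹ x)
    refine ⟨i, ?_, ?_⟩
    · simpa using S.monoLE le_rfl h1 h2
    · simpa using S.monoLE h1 h2 le_rfl
  uniq := fun i j x h1 h2 h3 h4 => by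
    have e : S.T (S.T⁻¹ x) = x := by simp
    rw [← e] at h1 h2 h3 h4
    exact S.uniq (S.img h1 h2).1 (S.img h1 h2).2 (S.img h3 h4).1 (S.img h3 h4).2
  mono := fun i x y h1 h2 h3 => by
    have e : S.T (S.T⁻¹ x) = x := by simp
    have e' : S.T (S.T⁻¹ y) = y := by simp
    rw [← e] at h1 h2
    rw [← e'] at h2 h3
    obtain ⟨p1, p2⟩ := S.img h1 (h2.le.trans h3)
    obtain ⟨q1, q2⟩ := S.img (h1.trans h2.le) h3
    by_contra hc
    exact absurd h2 (not_lt.2 (S.monoLE q1 (not_lt.1 hc) p2))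
  img := fun i x h1 h2 => by
    have e : S.T (S.T⁻¹ x) = x := by simp
    have e' : ∀ y, S.T⁻¹ (S.T y) = y := fun y => by simp
    rw [e'] at h1 h2
    constructor
    · rw [← e]; exact S.monoLE le_rfl h1 h2
    · rw [← e]; exact S.monoLE h1 h2 le_rfl
  sg_l := fun i => by rw [S.sg_T, S.sg_l]
  sg_r := fun i => by rw [S.sg_T, S.sg_r]
  sg_T := fun x => by rw [← S.sg_T (S.T⁻¹ x)]; simp
  split := S.split

/-- The exchange obtained by reversing the order. -/
def dual : Exchange Xᵒᵈ (fun x => !sg (OrderDual.ofDual x)) d where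
  T := (OrderDual.ofDual.trans S.T).trans OrderDual.toDual
  l := fun i => OrderDual.toDual (S.r i)
  r := fun i => OrderDual.toDual (S.l i)
  le := fun i => S.le i
  cover := fun x => by
    obtain ⟨i, h1, h2⟩ := S.cover (OrderDual.ofDual x)
    exact ⟨i, h2, h1⟩
  uniq := fun i j x h1 h2 h3 h4 =>
    S.uniq (x := OrderDual.ofDual x) h2 h1 h4 h3
  mono := fun i x y h1 h2 h3 =>
    S.mono (x := OrderDual.ofDual y) (y := OrderDual.ofDual x) h3 h2 h1
  img := fun i x h1 h2 => (S.img (x := OrderDual.ofDual x) h2 h1).symm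
  sg_l := fun i => by simp [S.sg_r]
  sg_r := fun i => by simp [S.sg_l]
  sg_T := fun x => by simp [S.sg_T]
  split := S.split.dual

@[simp] theorem inv_T : S.inv.T = S.T⁻¹ := rfl
@[simp] theorem inv_l (i : Fin d) : S.inv.l i = S.T (S.l i) := rfl
@[simp] theorem inv_r (i : Fin d) : S.inv.r i = S.T (S.r i) := rfl

theorem sg_pow (n : ℕ) (x : X) : sg ((S.T ^ n) x) = sg x := by
  induction n with
  | zero => rfl
  | succ n ih => rw [pow_succ', Equiv.Perm.mul_apply, S.sg_T, ih]

/-- Two points without a left endpoint between them lie in the same piece. -/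
theorem same_piece {p q : X} (h : ∀ j, ¬(p < S.l j ∧ S.l j ≤ q)) :
    ∃ i, S.l i ≤ p ∧ q ≤ S.r i := by
  obtain ⟨j, h1, h2⟩ := S.cover q
  exact ⟨j, not_lt.1 fun hh => h j ⟨hh, h1⟩, h2⟩

/-- A jump can break only if its upper germ is a left endpoint. Otherwise both germs lie in one
piece, on which `T` is increasing and whose image is convex by `img`. -/
theorem covBy_T {x y : X} (h : x ⋖ y) (hy : ∀ j, y ≠ S.l j) : S.T x ⋖ S.T y := by
  obtain ⟨i, h1, h2⟩ := S.same_piece (fun j hj => by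
    rcases (h.ge_of_gt hj.1).eq_or_lt with e | e
    · exact hy j e
    · exact absurd hj.2 (not_le.2 e))
  refine ⟨S.mono h1 h.lt h2, fun z hz hz' => ?_⟩
  obtain ⟨z, rfl⟩ := S.T.surjective z
  obtain ⟨g1, g2⟩ := S.img (i := i)
    ((S.monoLE le_rfl h1 (h.le.trans h2)).trans hz.le)
    (hz'.le.trans (S.monoLE (h1.trans h.le) h2 le_rfl))
  refine h.2 (c := z) ?_ ?_
  · by_contra hc
    exact absurd hz (not_lt.2 (S.monoLE g1 (not_lt.1 hc) (h.le.trans h2)))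
  · by_contra hc
    exact absurd hz' (not_lt.2 (S.monoLE (h1.trans h.le) (not_lt.1 hc) g2))

theorem r_of_covBy_l {x : X} {j : Fin d} (h : x ⋖ S.l j) : ∃ i, x = S.r i := by
  obtain ⟨i, h1, h2⟩ := S.cover x
  refine ⟨i, ?_⟩
  rcases h2.eq_or_lt with e | e
  · exact e
  · exfalso
    have := h.ge_of_gt e
    have e' := S.uniq (h1.trans h.le) this le_rfl (S.le j)
    subst e'
    exact absurd h.lt (not_lt.2 h1)

theorem l_of_r_covBy {x : X} {j : Fin d} (h : S.r j ⋖ x) : ∃ i, x = S.l i := by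
  obtain ⟨i, h1, h2⟩ := S.cover x
  refine ⟨i, ?_⟩
  rcases h1.eq_or_lt with e | e
  · exact e.symm
  · exfalso
    have := h.le_of_lt e
    have e' := S.uniq this (h.le.trans h2) (S.le j) le_rfl
    subst e'
    exact absurd h.lt (not_lt.2 h2)

theorem l_of_isMin {x : X} (h : ∀ y, x ≤ y) : ∃ i, x = S.l i := by
  obtain ⟨i, h1, -⟩ := S.cover x
  exact ⟨i, le_antisymm (h _) h1⟩

theorem r_of_isMax {x : X} (h : ∀ y, y ≤ x) : ∃ i, x = S.r i := by
  obtain ⟨i, -, h2⟩ := S.cover x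
  exact ⟨i, le_antisymm h2 (h _)⟩

/-! ### Uncut stretches, cuts, and bounded return times -/

/-- `[c, z]` is not cut by a left endpoint during the first `n` steps. -/
def Uncut (n : ℕ) (c z : X) : Prop :=
  ∀ i < n, ∀ x, c < x → x ≤ z → ∀ j, (S.T ^ i) x ≠ S.l j

variable {S}

theorem Uncut.le {n m : ℕ} {c z : X} (h : S.Uncut n c z) (hm : m ≤ n) : S.Uncut m c z :=
  fun i hi => h i (hi.trans_le hm)

theorem Uncut.right {n : ℕ} {c z z' : X} (h : S.Uncut n c z) (hm : z' ≤ z) : S.Uncut n c z' :=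
  fun i hi x h1 h2 => h i hi x h1 (h2.trans hm)

/-- Monotonicity and convexity of the image have to be proved together: convexity turns a left
endpoint inside the image of `[c, z]` into a point of `[c, z]` that `Uncut` forbids. -/
theorem Uncut.run {n : ℕ} {c z : X} (h : S.Uncut n c z) :
    (∀ x y, c ≤ x → x < y → y ≤ z → (S.T ^ n) x < (S.T ^ n) y) ∧
    (∀ q, c ≤ z → (S.T ^ n) c ≤ (S.T ^ n) q → (S.T ^ n) q ≤ (S.T ^ n) z → c ≤ q ∧ q ≤ z) := by
  induction n with
  | zero => exact ⟨fun x y _ h _ => h, fun q _ h1 h2 => ⟨h1, h2⟩⟩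
  | succ n ih =>
    obtain ⟨ih1, ih2⟩ := ih (h.le n.le_succ)
    by_cases hcz : c ≤ z
    swap
    · exact ⟨fun x y h1 h2 h3 => absurd ((h1.trans h2.le).trans h3) hcz, fun q h => absurd h hcz⟩
    have mle : ∀ x y, c ≤ x → x ≤ y → y ≤ z → (S.T ^ n) x ≤ (S.T ^ n) y := fun x y h1 h2 h3 => by
      rcases h2.eq_or_lt with e | e
      · rw [e]
      · exact (ih1 x y h1 e h3).le
    obtain ⟨i, p1, p2⟩ := S.same_piece (p := (S.T ^ n) c) (q := (S.T ^ n) z)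
      (fun j hj => by
        obtain ⟨q, hq⟩ := (S.T ^ n).surjective (S.l j)
        rw [← hq] at hj
        obtain ⟨q1, q2⟩ := ih2 q hcz hj.1.le hj.2
        refine h n n.lt_succ_self q (q1.lt_of_ne ?_) q2 j hq
        rintro rfl
        exact lt_irrefl _ hj.1)
    simp only [pow_succ', Equiv.Perm.mul_apply]
    refine ⟨fun x y h1 h2 h3 => S.mono (p1.trans (mle _ _ le_rfl h1 (h2.le.trans h3)))
      (ih1 x y h1 h2 h3) ((mle _ _ (h1.trans h2.le) h3 le_rfl).trans p2), fun q hq h1 h2 => ?_⟩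
    obtain ⟨g1, g2⟩ := S.img (i := i)
      ((S.monoLE le_rfl p1 ((mle c z le_rfl hcz le_rfl).trans p2)).trans h1)
      (h2.trans (S.monoLE (p1.trans (mle c z le_rfl hcz le_rfl)) p2 le_rfl))
    refine ih2 q hcz ?_ ?_
    · by_contra hc
      exact absurd h1 (not_le.2 (S.mono g1 (not_le.1 hc) ((mle c z le_rfl hcz le_rfl).trans p2)))
    · by_contra hc
      exact absurd h2 (not_le.2 (S.mono (p1.trans (mle c z le_rfl hcz le_rfl)) (not_le.1 hc) g2))

theorem Uncut.lt {n : ℕ} {c z x y : X} (h : S.Uncut n c z) (h1 : c ≤ x) (h2 : x < y) (h3 : y ≤ z) :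
    (S.T ^ n) x < (S.T ^ n) y := h.run.1 x y h1 h2 h3

theorem Uncut.monoLE {n : ℕ} {c z x y : X} (h : S.Uncut n c z) (h1 : c ≤ x) (h2 : x ≤ y)
    (h3 : y ≤ z) : (S.T ^ n) x ≤ (S.T ^ n) y := by
  rcases h2.eq_or_lt with e | e
  · rw [e]
  · exact (h.lt h1 e h3).le

theorem Uncut.exists_eq {n : ℕ} {c z q : X} (h : S.Uncut n c z) (hcz : c ≤ z)
    (h1 : (S.T ^ n) c ≤ q) (h2 : q ≤ (S.T ^ n) z) : ∃ p, c ≤ p ∧ p ≤ z ∧ (S.T ^ n) p = q := by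
  obtain ⟨p, rfl⟩ := (S.T ^ n).surjective q
  obtain ⟨a, b⟩ := h.run.2 p hcz h1 h2
  exact ⟨p, a, b, rfl⟩

variable (S)

/-- The points of `(u, v]` at which the first return to `[u, v]` may be discontinuous. -/
def IsCut (u v x : X) : Prop :=
  u < x ∧ x ≤ v ∧ ∃ i : ℕ,
    ((∃ j, (S.T ^ i) x = S.l j) ∧ ∀ i', 0 < i' → i' ≤ i → (S.T ^ i') x ∉ Icc u v) ∨
    (0 < i ∧ ((S.T ^ i) x = u ∨ v ⋖ (S.T ^ i) x) ∧ ∀ i', 0 < i' → i' < i → (S.T ^ i') x ∉ Icc u v)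

theorem pow_sub_apply {i j : ℕ} (h : i ≤ j) (x : X) :
    (S.T ^ i) ((S.T ^ (j - i)) x) = (S.T ^ j) x := by
  rw [← Equiv.Perm.mul_apply, ← pow_add, Nat.add_sub_cancel' h]

/-- Each marker (a left endpoint, `u`, or the successor of `v`) accounts for at most one cut. Of two
points reaching the same marker, the one that takes longer passes through the other, hence through
`[u, v]`, too early. -/
theorem finite_isCut (u v : X) : {x | S.IsCut u v x}.Finite := by
  have key : ∀ m : X, {x | u < x ∧ x ≤ v ∧ ∃ i : ℕ, (S.T ^ i) x = m ∧
      ∀ i', 0 < i' → i' ≤ i → (S.T ^ i') x ∉ Icc u v}.Subsingleton := by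
    have aux : ∀ (m x x' : X) (i i' : ℕ), i ≤ i' → u < x → x ≤ v → (S.T ^ i) x = m →
        (S.T ^ i') x' = m → (∀ k, 0 < k → k ≤ i' → (S.T ^ k) x' ∉ Icc u v) → x = x' := by
      intro m x x' i i' hii h1 h2 e e' h
      have : (S.T ^ (i' - i)) x' = x := by
        apply (S.T ^ i).injective
        rw [S.pow_sub_apply hii, e, e']
      rcases hii.eq_or_lt with e0 | e0
      · subst e0; simpa using this.symm
      · exact absurd (this ▸ ⟨h1.le, h2⟩) (h (i' - i) (by omega) (by omega))
    rintro m x ⟨h1, h2, i, h3, h4⟩ x' ⟨h1', h2', i', h3', h4'⟩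
    rcases le_total i i' with h | h
    · exact aux m x x' i i' h h1 h2 h3 h3' h4'
    · exact (aux m x' x i' i h h1' h2' h3' h3 h4).symm
  have key2 : ∀ P : X → Prop, {x | P x}.Subsingleton → {x | u < x ∧ x ≤ v ∧ ∃ i : ℕ, 0 < i ∧
      P ((S.T ^ i) x) ∧ ∀ i', 0 < i' → i' < i → (S.T ^ i') x ∉ Icc u v}.Subsingleton := by
    intro P hP
    have aux : ∀ (x x' : X) (i i' : ℕ), i ≤ i' → 0 < i → u < x → x ≤ v → P ((S.T ^ i) x) →
        P ((S.T ^ i') x') → (∀ k, 0 < k → k < i' → (S.T ^ k) x' ∉ Icc u v) → x = x' := by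
      intro x x' i i' hii h0 h1 h2 e e' h
      have : (S.T ^ (i' - i)) x' = x := by
        apply (S.T ^ i).injective
        rw [S.pow_sub_apply hii]
        exact hP e' e
      rcases hii.eq_or_lt with e0 | e0
      · subst e0; simpa using this.symm
      · exact absurd (this ▸ ⟨h1.le, h2⟩) (h (i' - i) (by omega) (by omega))
    rintro x ⟨h1, h2, i, h0, h3, h4⟩ x' ⟨h1', h2', i', h0', h3', h4'⟩
    rcases le_total i i' with h | h
    · exact aux x x' i i' h h0 h1 h2 h3 h3' h4'
    · exact (aux x' x i' i h h0' h1' h2' h3' h3 h4).symm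
  refine (((Set.finite_iUnion fun j => (key (S.l j)).finite).union
    (key2 (fun x => x = u) (fun a ha b hb => ha.trans hb.symm)).finite).union
    (key2 (fun x => v ⋖ x) (fun a ha b hb => CovBy.unique_right ha hb)).finite).subset ?_
  rintro x ⟨h1, h2, i, ⟨⟨j, h3⟩, h4⟩ | ⟨h0, h3 | h3, h4⟩⟩
  · exact Or.inl (Or.inl (mem_iUnion.2 ⟨j, h1, h2, i, h3, h4⟩))
  · exact Or.inl (Or.inr ⟨h1, h2, i, h0, h3, h4⟩)
  · exact Or.inr ⟨h1, h2, i, h0, h3, h4⟩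

/-- Between consecutive cuts the orbits travel together until they return. -/
theorem run_of_not_isCut {u v c z : X} (hv : sg v = false) (huc : u ≤ c) (hzv : z ≤ v)
    (hcz : c ≤ z) (hcut : ∀ x, c < x → x ≤ z → ¬ S.IsCut u v x) (n : ℕ)
    (h : ∀ i, 0 < i → i < n → (S.T ^ i) z ∉ Icc u v ∨ (S.T ^ i) c ∉ Icc u v) :
    S.Uncut n c z ∧ ∀ i, 0 < i → i < n → ∀ x, c ≤ x → x ≤ z → (S.T ^ i) x ∉ Icc u v := by
  induction n with
  | zero => exact ⟨fun i hi => absurd hi (by omega), fun i _ hi => absurd hi (by omega)⟩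
  | succ n ih =>
    obtain ⟨ih1, ih2⟩ := ih fun i h1 h2 => h i h1 (by omega)
    -- If a point of the stretch returned while one end did not, the image would stick out of `[u,
    -- v]` and contain `u` or the successor of `v`; the corresponding point would be a cut.
    have out : 0 < n → ∀ x, c ≤ x → x ≤ z → (S.T ^ n) x ∉ Icc u v := by
      intro hn x hcx hxz hx
      rcases h n hn n.lt_succ_self with hh | hh
      · have h1 : v < (S.T ^ n) z := by
          by_contra hc
          exact hh ⟨hx.1.trans (ih1.monoLE hcx hxz le_rfl), not_lt.1 hc⟩
        obtain ⟨w, hw, hw'⟩ := S.split.succ_of_lt hv h1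
        obtain ⟨q, q1, q2, rfl⟩ := ih1.exists_eq hcz
          (((ih1.monoLE le_rfl hcx hxz).trans hx.2).trans hw.le) hw'
        have hq : x < q := by
          by_contra hc
          exact absurd hw.lt (not_lt.2 ((ih1.monoLE q1 (not_lt.1 hc) hxz).trans hx.2))
        exact hcut q (hcx.trans_lt hq) q2 ⟨huc.trans_lt (hcx.trans_lt hq), q2.trans hzv, n,
          Or.inr ⟨hn, Or.inr hw, fun i' a b => ih2 i' a b q q1 q2⟩⟩
      · have h1 : (S.T ^ n) c < u := by
          by_contra hc
          exact hh ⟨not_lt.1 hc, (ih1.monoLE le_rfl hcx hxz).trans hx.2⟩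
        obtain ⟨q, q1, q2, hq⟩ := ih1.exists_eq hcz h1.le
          (hx.1.trans (ih1.monoLE hcx hxz le_rfl))
        have hq' : c < q := by
          refine q1.lt_of_ne ?_
          rintro rfl
          exact absurd hq h1.ne
        exact hcut q hq' q2 ⟨huc.trans_lt hq', q2.trans hzv, n,
          Or.inr ⟨hn, Or.inl hq, fun i' a b => ih2 i' a b q q1 q2⟩⟩
    have out' : ∀ i, 0 < i → i < n + 1 → ∀ x, c ≤ x → x ≤ z → (S.T ^ i) x ∉ Icc u v := by
      intro i h0 h1
      rcases (Nat.lt_succ_iff.1 h1).eq_or_lt with e | e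
      · subst e; exact out h0
      · exact ih2 i h0 e
    refine ⟨fun i hi x h1 h2 j hj => ?_, out'⟩
    exact hcut x h1 h2 ⟨huc.trans_lt h1, h2.trans hzv, i, Or.inl ⟨⟨j, hj⟩, fun i' a b =>
      out' i' a (by omega) x h1.le h2⟩⟩

/-- `n` is the first return time of `z` to `J`. -/
def FirstReturn (J : Set X) (z : X) (n : ℕ) : Prop :=
  0 < n ∧ (S.T ^ n) z ∈ J ∧ ∀ i, 0 < i → i < n → (S.T ^ i) z ∉ J

theorem exists_firstReturn {J : Set X} {z : X} {n : ℕ} (hn : 0 < n) (h : (S.T ^ n) z ∈ J) :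
    ∃ m ≤ n, S.FirstReturn J z m := by
  classical
  have hex : ∃ n, 0 < n ∧ (S.T ^ n) z ∈ J := ⟨n, hn, h⟩
  refine ⟨Nat.find hex, Nat.find_le ⟨hn, h⟩, (Nat.find_spec hex).1, (Nat.find_spec hex).2, ?_⟩
  intro i h0 hi hJ
  exact Nat.find_min hex hi ⟨h0, hJ⟩

theorem FirstReturn.unique {S : Exchange X sg d} {J : Set X} {z : X} {n m : ℕ}
    (h : S.FirstReturn J z n) (h' : S.FirstReturn J z m) : n = m := by
  rcases lt_trichotomy n m with hl | hl | hl
  · exact absurd h.2.1 (h'.2.2 n h.1 hl)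
  · exact hl
  · exact absurd h'.2.1 (h.2.2 m h'.1 hl)

/-- If only one end returned at time `n`, then `run_of_not_isCut` applied up to time `n + 1` would
forbid that return as well. -/
theorem firstReturn_iff {u v c z : X} (hv : sg v = false) (huc : u ≤ c) (hzv : z ≤ v)
    (hcz : c ≤ z) (hcut : ∀ x, c < x → x ≤ z → ¬ S.IsCut u v x) (n : ℕ) :
    S.FirstReturn (Icc u v) c n ↔ S.FirstReturn (Icc u v) z n := by
  constructor
  · rintro ⟨h0, h1, h2⟩
    have hlt := (S.run_of_not_isCut hv huc hzv hcz hcut n fun i a b => Or.inr (h2 i a b)).2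
    refine ⟨h0, ?_, fun i a b => hlt i a b z hcz le_rfl⟩
    by_contra hc
    refine (S.run_of_not_isCut hv huc hzv hcz hcut (n + 1) fun i a b => ?_).2 n h0 n.lt_succ_self
      c le_rfl hcz h1
    rcases (Nat.lt_succ_iff.1 b).eq_or_lt with e | e
    · subst e; exact Or.inl hc
    · exact Or.inr (h2 i a e)
  · rintro ⟨h0, h1, h2⟩
    have hlt := (S.run_of_not_isCut hv huc hzv hcz hcut n fun i a b => Or.inl (h2 i a b)).2
    refine ⟨h0, ?_, fun i a b => hlt i a b c le_rfl hcz⟩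
    by_contra hc
    refine (S.run_of_not_isCut hv huc hzv hcz hcut (n + 1) fun i a b => ?_).2 n h0 n.lt_succ_self
      z hcz le_rfl h1
    rcases (Nat.lt_succ_iff.1 b).eq_or_lt with e | e
    · subst e; exact Or.inr hc
    · exact Or.inl (h2 i a e)

/-- The first return times to a clopen interval are bounded. -/
theorem bounded_return (u v : X) (hv : sg v = false) :
    ∃ M, ∀ z ∈ Icc u v, ∀ n, 0 < n → (S.T ^ n) z ∈ Icc u v →
      ∃ m, 0 < m ∧ m ≤ M ∧ (S.T ^ m) z ∈ Icc u v := by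
  classical
  have hfin := (S.finite_isCut u v).insert u
  let ρ : X → ℕ := fun c => if h : ∃ n, S.FirstReturn (Icc u v) c n then h.choose else 0
  obtain ⟨M, hM⟩ := (hfin.image ρ).bddAbove
  refine ⟨M, fun z hz n hn hzn => ?_⟩
  obtain ⟨m, -, hm⟩ := S.exists_firstReturn hn hzn
  -- The nearest cut at or below `z`, or `u` if there is none. No cut separates `c` from `z`, so
  -- they share their first return time, and only finitely many `c` occur.
  obtain ⟨c, ⟨hc1, hc2⟩, hcmax⟩ := Set.exists_max_image
    (insert u {x | S.IsCut u v x} ∩ Iic z) id (hfin.inter_of_left _) ⟨u, mem_insert _ _, hz.1⟩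
  have huc : u ≤ c := hcmax u ⟨mem_insert _ _, hz.1⟩
  have hcut : ∀ x, c < x → x ≤ z → ¬ S.IsCut u v x := fun x h1 h2 h3 =>
    absurd (hcmax x ⟨mem_insert_of_mem _ h3, h2⟩) (not_le.2 h1)
  have hcm := (S.firstReturn_iff hv huc hz.2 hc2 hcut m).2 hm
  refine ⟨m, hm.1, ?_, hm.2.1⟩
  have hex : ∃ n, S.FirstReturn (Icc u v) c n := ⟨m, hcm⟩
  have : ρ c = m := by
    simp only [ρ, dif_pos hex]
    exact hex.choose_spec.unique hcm
  rw [← this]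
  exact hM ⟨c, hc1, rfl⟩

end Exchange

end GIET

/-! ### Accumulation of orbits, recurrence and limit sets -/

namespace GIET

/-- The orbit `f ^ n g`, `n → ∞`, accumulates (in time) at `x`. -/
def Visits {X : Type*} [TopologicalSpace X] (f : Equiv.Perm X) (x g : X) : Prop :=
  MapClusterPt x atTop fun n : ℕ => (f ^ n) g

section Visits

variable {X : Type*} [TopologicalSpace X] {f : Equiv.Perm X} {x g : X}

theorem Visits.exists_mem (h : Visits f x g) {s : Set X} (hs : s ∈ 𝓝 x) (N : ℕ) :
    ∃ n, N ≤ n ∧ (f ^ n) g ∈ s := by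
  have := mapClusterPt_iff_frequently.1 h s hs
  obtain ⟨n, h1, h2⟩ := frequently_atTop.1 this N
  exact ⟨n, h1, h2⟩

theorem visits_of_exists (h : ∀ s ∈ 𝓝 x, ∀ N : ℕ, ∃ n, N ≤ n ∧ (f ^ n) g ∈ s) : Visits f x g := by
  refine mapClusterPt_iff_frequently.2 fun s hs => frequently_atTop.2 fun N => ?_
  obtain ⟨n, h1, h2⟩ := h s hs N
  exact ⟨n, h1, h2⟩

theorem visits_apply_iff : Visits f x (f g) ↔ Visits f x g := by
  constructor
  · intro h
    refine visits_of_exists fun s hs N => ?_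
    obtain ⟨n, h1, h2⟩ := h.exists_mem hs N
    refine ⟨n + 1, by omega, ?_⟩
    rwa [pow_succ, Equiv.Perm.mul_apply]
  · intro h
    refine visits_of_exists fun s hs N => ?_
    obtain ⟨n, h1, h2⟩ := h.exists_mem hs (N + 1)
    obtain ⟨m, rfl⟩ : ∃ m, n = m + 1 := ⟨n - 1, by omega⟩
    refine ⟨m, by omega, ?_⟩
    rwa [pow_succ, Equiv.Perm.mul_apply] at h2

theorem visits_inv_apply_iff : Visits f⁻¹ x (f g) ↔ Visits f⁻¹ x g := by
  rw [← visits_apply_iff (f := f⁻¹) (g := f g)]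
  simp

theorem visits_pow_iff (n : ℕ) : Visits f x ((f ^ n) g) ↔ Visits f x g := by
  induction n with
  | zero => rfl
  | succ n ih => rw [pow_succ', Equiv.Perm.mul_apply, visits_apply_iff, ih]

theorem visits_of_periodic {n : ℕ} (hn : 0 < n) (h : (f ^ n) x = x) : Visits f x x := by
  refine visits_of_exists fun s hs N => ⟨n * N, Nat.le_mul_of_pos_left _ hn, ?_⟩
  have : ∀ N, (f ^ (n * N)) x = x := fun N => by
    induction N with
    | zero => rfl
    | succ N ih => rw [Nat.mul_succ, pow_add, Equiv.Perm.mul_apply, h, ih]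
  rw [this]
  exact mem_of_mem_nhds hs

end Visits

variable {X : Type*} [LinearOrder X] {sg : X → Bool} {d : ℕ}

theorem IsSplitOrder.isOpen_Icc (h : IsSplitOrder X sg) [TopologicalSpace X] [OrderTopology X]
    {u v : X} (hu : sg u = true) (hv : sg v = false) : IsOpen (Icc u v) := by
  have h1 : IsOpen (Ici u) := by
    rcases h.exists_pred hu with h' | ⟨w, hw⟩
    · convert isOpen_univ
      ext x
      simp [h']
    · convert isOpen_Ioi (a := w)
      ext x
      exact ⟨fun hx => hw.lt.trans_le hx, fun hx => hw.ge_of_gt hx⟩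
  have h2 : IsOpen (Iic v) := by
    rcases h.exists_succ hv with h' | ⟨w, hw⟩
    · convert isOpen_univ
      ext x
      simp [h']
    · convert isOpen_Iio (a := w)
      ext x
      exact ⟨fun hx => lt_of_le_of_lt hx hw.lt, fun hx => hw.le_of_lt hx⟩
  exact h1.inter h2

namespace Exchange

variable (S : Exchange X sg d)

theorem inv_pow_apply_pow (n : ℕ) (x : X) : ((S.T⁻¹) ^ n) ((S.T ^ n) x) = x := by
  rw [← Equiv.Perm.mul_apply]; simp

theorem pow_apply_inv_pow (n : ℕ) (x : X) : (S.T ^ n) (((S.T⁻¹) ^ n) x) = x := by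
  rw [← Equiv.Perm.mul_apply]; simp

theorem visits_T_right [TopologicalSpace X] {S : Exchange X sg d} {f : Equiv.Perm X}
    (hf : f = S.T ∨ f = S.T⁻¹) {x g : X} :
    Visits f x (S.T g) ↔ Visits f x g := by
  rcases hf with rfl | rfl
  · exact visits_apply_iff
  · exact visits_inv_apply_iff

theorem visits_pow_right [TopologicalSpace X] {S : Exchange X sg d} {f : Equiv.Perm X}
    (hf : f = S.T ∨ f = S.T⁻¹) {x g : X} (n : ℕ) :
    Visits f x ((S.T ^ n) g) ↔ Visits f x g := by
  induction n with
  | zero => rfl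
  | succ n ih => rw [pow_succ', Equiv.Perm.mul_apply, visits_T_right hf, ih]

section Topology

variable [TopologicalSpace X] [OrderTopology X]

theorem Icc_mem_nhds (S : Exchange X sg d) {u v x : X} (hu : sg u = true)
    (hv : sg v = false) (h1 : u ≤ x) (h2 : x ≤ v) : Icc u v ∈ 𝓝 x :=
  (S.split.isOpen_Icc hu hv).mem_nhds ⟨h1, h2⟩

/-- Clopen intervals from a right germ to a left germ form a neighbourhood basis. At an extreme
point `x` there is nothing to separate, but then `x` is an endpoint of a piece and has the required
sign. -/
theorem exists_Icc_subset (S : Exchange X sg d) {x : X} {s : Set X} (hs : s ∈ 𝓝 x) :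
    ∃ u v, sg u = true ∧ sg v = false ∧ u ≤ x ∧ x ≤ v ∧ Icc u v ⊆ s := by
  have h1 : ∃ u, sg u = true ∧ u ≤ x ∧ Icc u x ⊆ s := by
    by_cases h : ∃ l, l < x
    · obtain ⟨l, hl, hs'⟩ := exists_Ioc_subset_of_mem_nhds hs h
      obtain ⟨v, u, h1, h2, h3, h4, h5⟩ := S.split.sep hl
      exact ⟨u, h5, h3, fun y hy => hs' ⟨h1.trans_lt (h2.lt.trans_le hy.1), hy.2⟩⟩
    · push Not at h
      obtain ⟨i, hi⟩ := S.l_of_isMin h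
      refine ⟨x, hi ▸ S.sg_l i, le_rfl, ?_⟩
      rw [Icc_self]
      exact singleton_subset_iff.2 (mem_of_mem_nhds hs)
  have h2 : ∃ v, sg v = false ∧ x ≤ v ∧ Icc x v ⊆ s := by
    by_cases h : ∃ l, x < l
    · obtain ⟨l, hl, hs'⟩ := exists_Ico_subset_of_mem_nhds hs h
      obtain ⟨v, u, h1, h2, h3, h4, h5⟩ := S.split.sep hl
      exact ⟨v, h4, h1, fun y hy => hs' ⟨hy.1, hy.2.trans_lt (h2.lt.trans_le h3)⟩⟩
    · push Not at h
      obtain ⟨i, hi⟩ := S.r_of_isMax h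
      refine ⟨x, hi ▸ S.sg_r i, le_rfl, ?_⟩
      rw [Icc_self]
      exact singleton_subset_iff.2 (mem_of_mem_nhds hs)
  obtain ⟨u, a1, a2, a3⟩ := h1
  obtain ⟨v, b1, b2, b3⟩ := h2
  refine ⟨u, v, a1, b1, a2, b2, fun y hy => ?_⟩
  rcases le_total y x with h | h
  · exact a3 ⟨hy.1, h⟩
  · exact b3 ⟨h, hy.2⟩

/-- Truncating a basic clopen interval by the image of the piece of `x` leaves the signs of its
bounds correct, so its preimage in the piece is again a clopen interval. -/
theorem continuous_T : Continuous S.T := by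
  refine continuous_iff_continuousAt.2 fun x => ?_
  intro s hs
  obtain ⟨u, v, hu, hv, h1, h2, h3⟩ := S.exists_Icc_subset hs
  obtain ⟨i, i1, i2⟩ := S.cover x
  have ha := S.monoLE le_rfl i1 i2
  have hb := S.monoLE i1 i2 le_rfl
  have e1 : ∃ u', sg u' = true ∧ S.T u' = max u (S.T (S.l i)) := by
    refine ⟨S.T⁻¹ (max u (S.T (S.l i))), ?_, by simp⟩
    rw [← S.sg_T]
    rcases max_choice u (S.T (S.l i)) with h | h <;> rw [h]
    · simpa using hu
    · simp [S.sg_T, S.sg_l]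
  have e2 : ∃ v', sg v' = false ∧ S.T v' = min v (S.T (S.r i)) := by
    refine ⟨S.T⁻¹ (min v (S.T (S.r i))), ?_, by simp⟩
    rw [← S.sg_T]
    rcases min_choice v (S.T (S.r i)) with h | h <;> rw [h]
    · simpa using hv
    · simp [S.sg_T, S.sg_r]
  obtain ⟨u', hu', eu⟩ := e1
  obtain ⟨v', hv', ev⟩ := e2
  have ux : S.T u' ≤ S.T x := eu ▸ max_le h1 ha
  have vx : S.T x ≤ S.T v' := ev ▸ le_min h2 hb
  obtain ⟨p1, p2⟩ := S.img (i := i) (x := u') (eu ▸ le_max_right _ _) (ux.trans hb)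
  obtain ⟨q1, q2⟩ := S.img (i := i) (x := v') (ha.trans vx) (ev ▸ min_le_right _ _)
  have ux' : u' ≤ x := by
    by_contra hc
    exact absurd ux (not_le.2 (S.mono i1 (not_le.1 hc) p2))
  have vx' : x ≤ v' := by
    by_contra hc
    exact absurd vx (not_le.2 (S.mono q1 (not_le.1 hc) i2))
  refine mem_map.2 <| mem_of_superset (S.Icc_mem_nhds hu' hv' ux' vx') fun y hy => h3 ⟨?_, ?_⟩
  · exact (le_max_left _ _).trans (eu ▸ S.monoLE p1 hy.1 (hy.2.trans q2))
  · exact (S.monoLE (p1.trans hy.1) hy.2 q2).trans (ev ▸ min_le_left _ _)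

theorem continuous_pow (n : ℕ) : Continuous ((S.T ^ n : Equiv.Perm X) : X → X) := by
  induction n with
  | zero => exact continuous_id
  | succ n ih => rw [pow_succ', Equiv.Perm.coe_mul]; exact S.continuous_T.comp ih

theorem continuous_inv : Continuous (S.T⁻¹ : Equiv.Perm X) := S.inv.continuous_T

variable {S}

theorem visits_T_left {f : Equiv.Perm X} (hf : f = S.T ∨ f = S.T⁻¹) {x g : X} :
    Visits f (S.T x) g ↔ Visits f x g := by
  have comm : ∀ (h : Equiv.Perm X) (n : ℕ) (y : X), h = S.T ∨ h = S.T⁻¹ →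
      (f ^ n) (h y) = h ((f ^ n) y) := by
    intro h n y hh
    have : Commute (f ^ n) h := by
      apply Commute.pow_left
      rcases hf with rfl | rfl <;> rcases hh with rfl | rfl
      · exact Commute.refl _
      · exact (Commute.refl _).inv_right
      · exact (Commute.refl _).inv_left
      · exact Commute.refl _
    rw [← Equiv.Perm.mul_apply, this.eq, Equiv.Perm.mul_apply]
  constructor
  · intro h
    have h2 := MapClusterPt.continuousAt_comp S.continuous_inv.continuousAt h
    have e : (S.T⁻¹ : Equiv.Perm X) (S.T x) = x := by simp
    rw [e] at h2
    have h3 : Visits f x (S.T⁻¹ g) := by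
      unfold Visits
      convert h2 using 1
      ext n
      exact comm S.T⁻¹ n g (Or.inr rfl)
    rw [← visits_T_right hf] at h3
    simpa using h3
  · intro h
    have h2 := MapClusterPt.continuousAt_comp S.continuous_T.continuousAt h
    have h3 : Visits f (S.T x) (S.T g) := by
      unfold Visits
      convert h2 using 1
      ext n
      exact comm S.T n g (Or.inl rfl)
    rwa [visits_T_right hf] at h3

theorem visits_pow_left {f : Equiv.Perm X} (hf : f = S.T ∨ f = S.T⁻¹) {x g : X} (n : ℕ) :
    Visits f ((S.T ^ n) x) g ↔ Visits f x g := by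
  induction n with
  | zero => rfl
  | succ n ih => rw [pow_succ', Equiv.Perm.mul_apply, visits_T_left hf, ih]

variable (S)

theorem isClopen_Icc (S : Exchange X sg d) {u v : X} (hu : sg u = true) (hv : sg v = false) :
    IsClopen (Icc u v) := ⟨isClosed_Icc, S.split.isOpen_Icc hu hv⟩

/-- If an orbit accumulates both at `x` and at `x'`, then the orbit of `x` accumulates at `x'`. -/
theorem exists_mem_of_visits {x x' g : X} (hx : Visits S.T x g) (hx' : Visits S.T x' g)
    {s : Set X} (hs : s ∈ 𝓝 x') : ∃ n : ℕ, (S.T ^ n) x ∈ s := by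
  obtain ⟨u, v, hu, hv, h1, h2, h3⟩ := S.exists_Icc_subset hs
  obtain ⟨M, hM⟩ := S.bounded_return u v hv
  by_contra hc
  push Not at hc
  -- Points near `x` avoid `[u, v]` at the times `0, …, M`. The orbit of `g` passes near `x` between
  -- two visits to `[u, v]`, so one of its returns takes longer than the bound `M`.
  have hU : (⋂ n ∈ Finset.range (M + 1), (S.T ^ n) ⁻¹' (Icc u v)ᶜ) ∈ 𝓝 x := by
    refine (biInter_finset_mem _).2 fun n _ => ?_
    exact (S.continuous_pow n).continuousAt.preimage_mem_nhds
      ((S.isClopen_Icc hu hv).compl.isOpen.mem_nhds fun h => hc n (h3 h))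
  obtain ⟨n0, -, hn0⟩ := hx'.exists_mem (S.Icc_mem_nhds hu hv h1 h2) 0
  obtain ⟨n1, h01, hn1⟩ := hx.exists_mem hU (n0 + 1)
  obtain ⟨n2, h12, hn2⟩ := hx'.exists_mem (S.Icc_mem_nhds hu hv h1 h2) (n1 + 1)
  -- the last visit before `n1`
  classical
  let P : ℕ → Prop := fun n => (S.T ^ n) g ∈ Icc u v
  have hPn0 : P n0 := hn0
  let a := Nat.findGreatest P n1
  have ha : P a := Nat.findGreatest_spec (P := P) (show n0 ≤ n1 by omega) hPn0
  have hale : a ≤ n1 := Nat.findGreatest_le _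
  have key : ∀ m, 0 < m → (S.T ^ m) ((S.T ^ a) g) ∈ Icc u v → M < m := by
    intro m hm hmem
    rw [← Equiv.Perm.mul_apply, ← pow_add] at hmem
    have h4 : n1 < m + a := by
      by_contra hcon
      exact Nat.findGreatest_is_greatest (P := P) (show a < m + a by omega) (by omega) hmem
    by_contra hmM
    have := mem_iInter₂.1 hn1 (m + a - n1) (Finset.mem_range.2 (by omega))
    apply this
    rwa [← Equiv.Perm.mul_apply, ← pow_add, Nat.sub_add_cancel h4.le]
  have : (S.T ^ (n2 - a)) ((S.T ^ a) g) ∈ Icc u v := by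
    rwa [← Equiv.Perm.mul_apply, ← pow_add, Nat.sub_add_cancel (by omega)]
  obtain ⟨m, hm, hmM, hmem⟩ := hM _ ha (n2 - a) (by omega) this
  exact absurd (key m hm hmem) (by omega)

/-- Forward recurrence implies backward recurrence. -/
theorem visits_inv_self {x : X} (hx : Visits S.T x x) : Visits S.T⁻¹ x x := by
  have one : ∀ s ∈ 𝓝 x, ∃ n : ℕ, 0 < n ∧ ((S.T⁻¹) ^ n) x ∈ s := by
    intro s hs
    obtain ⟨u, v, hu, hv, h1, h2, h3⟩ := S.exists_Icc_subset hs
    obtain ⟨M, hM⟩ := S.inv.bounded_return u v hv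
    by_contra hc
    push Not at hc
    -- If `x` never comes back to `[u, v]` in backward time, points near `x` stay away for `M`
    -- backward steps. Yet an iterate `T ^ n x` near `x` reaches `x` after `n` backward steps,
    -- against the bound `M`.
    have hU : (⋂ n ∈ Finset.Icc 1 M, ((S.T⁻¹) ^ n : Equiv.Perm X) ⁻¹' (Icc u v)ᶜ) ∈ 𝓝 x := by
      refine (biInter_finset_mem _).2 fun n hn => ?_
      exact (S.inv.continuous_pow n).continuousAt.preimage_mem_nhds
        ((S.isClopen_Icc hu hv).compl.isOpen.mem_nhds fun h =>
          hc n (Finset.mem_Icc.1 hn).1 (h3 h))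
    obtain ⟨n, hn, hmem⟩ := hx.exists_mem (inter_mem hU (S.Icc_mem_nhds hu hv h1 h2)) 1
    obtain ⟨m, hm, hmM, hm'⟩ := hM _ hmem.2 n (by omega) (by
      rw [S.inv_T, S.inv_pow_apply_pow]; exact ⟨h1, h2⟩)
    exact mem_iInter₂.1 hmem.1 m (Finset.mem_Icc.2 ⟨hm, hmM⟩) hm'
  by_cases hper : ∃ n : ℕ, 0 < n ∧ ((S.T⁻¹) ^ n) x = x
  · obtain ⟨n, hn, h⟩ := hper
    exact visits_of_periodic hn h
  · push Not at hper
    refine visits_of_exists fun s hs N => ?_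
    -- Removing the first `N` backward iterates from the neighbourhood forces the return to be late.
    have hU : (s ∩ ⋂ n ∈ Finset.Icc 1 N, {((S.T⁻¹) ^ n) x}ᶜ) ∈ 𝓝 x := by
      refine inter_mem hs ((biInter_finset_mem _).2 fun n hn => ?_)
      exact isOpen_compl_singleton.mem_nhds fun h => hper n (Finset.mem_Icc.1 hn).1 h.symm
    obtain ⟨n, hn, hmem⟩ := one _ hU
    refine ⟨n, ?_, hmem.1⟩
    by_contra hc
    exact mem_iInter₂.1 hmem.2 n (Finset.mem_Icc.2 ⟨hn, by omega⟩) rfl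

/-- The `ω`-limit set. -/
def limitSet (x : X) : Set X := {y | Visits S.T y x}

theorem limitSet_subset {x x' : X} (h : x' ∈ S.limitSet x) : S.limitSet x' ⊆ S.limitSet x := by
  intro z hz
  refine visits_of_exists fun s hs N => ?_
  obtain ⟨t, ht, hto, hzt⟩ := mem_nhds_iff.1 hs
  obtain ⟨n, -, hn⟩ := Visits.exists_mem hz (hto.mem_nhds hzt) 0
  have : Visits S.T ((S.T ^ n) x') x := (visits_pow_left (Or.inl rfl) n).2 h
  obtain ⟨m, hm, hmem⟩ := this.exists_mem (hto.mem_nhds hn) N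
  exact ⟨m, hm, ht hmem⟩

/-- Recurrent points visited by one orbit have the same limit set. -/
theorem mem_limitSet_of_visits {f : Equiv.Perm X} (hf : f = S.T ∨ f = S.T⁻¹) {x x' g : X}
    (hrec : Visits S.T x x) (hx : Visits f x g) (hx' : Visits f x' g) : x' ∈ S.limitSet x := by
  have key : ∀ s ∈ 𝓝 x', ∃ y, Visits S.T y x ∧ y ∈ s := by
    intro s hs
    rcases hf with rfl | rfl
    · obtain ⟨n, hn⟩ := S.exists_mem_of_visits hx hx' hs
      exact ⟨_, (visits_pow_left (Or.inl rfl) n).2 hrec, hn⟩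
    · obtain ⟨n, hn⟩ := S.inv.exists_mem_of_visits hx hx' hs
      refine ⟨_, ?_, hn⟩
      rw [← visits_pow_left (S := S) (Or.inl rfl) n, S.inv_T, S.pow_apply_inv_pow]
      exact hrec
  refine visits_of_exists fun s hs N => ?_
  obtain ⟨t, ht, hto, hzt⟩ := mem_nhds_iff.1 hs
  obtain ⟨y, hy, hyt⟩ := key t (hto.mem_nhds hzt)
  obtain ⟨m, hm, hmem⟩ := hy.exists_mem (hto.mem_nhds hyt) N
  exact ⟨m, hm, ht hmem⟩

/-- The source of the upper bound: an end of an orbit determines at most one class of recurrent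
germs. -/
theorem limitSet_eq_of_visits {f : Equiv.Perm X} (hf : f = S.T ∨ f = S.T⁻¹) {x x' g : X}
    (hrec : Visits S.T x x) (hrec' : Visits S.T x' x') (hx : Visits f x g) (hx' : Visits f x' g) :
    S.limitSet x = S.limitSet x' :=
  (S.limitSet_subset (S.mem_limitSet_of_visits hf hrec' hx' hx)).antisymm
    (S.limitSet_subset (S.mem_limitSet_of_visits hf hrec hx hx'))

/-- A point visited by a periodic orbit belongs to it. -/
theorem mem_orbit_of_visits_periodic {f : Equiv.Perm X} {x g : X} {n : ℕ} (hn : 0 < n)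
    (hg : (f ^ n) g = g) (h : Visits f x g) : ∃ m, (f ^ m) g = x := by
  by_contra hc
  push Not at hc
  have hU : (⋂ m ∈ Finset.range n, {(f ^ m) g}ᶜ) ∈ 𝓝 x := by
    refine (biInter_finset_mem _).2 fun m hm => ?_
    exact isOpen_compl_singleton.mem_nhds fun h => hc m h.symm
  obtain ⟨m, -, hm⟩ := h.exists_mem hU 0
  have hp : ∀ N, (f ^ (n * N)) g = g := fun N => by
    induction N with
    | zero => rfl
    | succ N ih => rw [Nat.mul_succ, pow_add, Equiv.Perm.mul_apply, hg, ih]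
  refine mem_iInter₂.1 hm (m % n) (Finset.mem_range.2 (Nat.mod_lt _ hn)) ?_
  have e : (f ^ (m % n + n * (m / n))) g = (f ^ (m % n)) g := by
    rw [pow_add, Equiv.Perm.mul_apply, hp]
  rwa [Nat.mod_add_div] at e

end Topology

end Exchange

end GIET

/-! ### The first return near a non-periodic recurrent germ -/

namespace GIET

namespace Exchange

variable {X : Type*} [LinearOrder X] {sg : X → Bool} {d : ℕ} (S : Exchange X sg d)
variable [TopologicalSpace X] [OrderTopology X]

/-- The first return to an interval around a recurrent point is not increasing. -/
theorem not_mono_return {u v w : X} (hu : sg u = true) (hv : sg v = false) (hw : w ∈ Icc u v)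
    (hrec : Visits S.T w w) (hper : ∀ n, 0 < n → (S.T ^ n) w ≠ w)
    (hmono : ∀ z z' n n', z ∈ Icc u v → z' ∈ Icc u v → z < z' → S.FirstReturn (Icc u v) z n →
      S.FirstReturn (Icc u v) z' n' → (S.T ^ n) z < (S.T ^ n') z') : False := by
  obtain ⟨n, hn, hmem⟩ := hrec.exists_mem (S.Icc_mem_nhds hu hv hw.1 hw.2) 1
  obtain ⟨n0, -, h0⟩ := S.exists_firstReturn hn hmem
  have hadd : ∀ {i n : ℕ} (z : X), n ≤ i → (S.T ^ (i - n)) ((S.T ^ n) z) = (S.T ^ i) z := by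
    intro i n z h
    rw [← Equiv.Perm.mul_apply, ← pow_add, Nat.sub_add_cancel h]
  rcases lt_or_gt_of_ne (hper n0 h0.1) with hlt | hlt
  -- If the first return moves `w` down, monotonicity makes every later return move down too, so the
  -- orbit never climbs back above the first return. The other case is the mirror image.
  · have key : ∀ i z n, z ∈ Icc u v → S.FirstReturn (Icc u v) z n → (S.T ^ n) z < z →
        (S.T ^ i) z ∈ Icc u v → 0 < i → (S.T ^ i) z ≤ (S.T ^ n) z := by
      intro i
      induction i using Nat.strong_induction_on with
      | _ i ih =>
        intro z n hz hn hlt hi hi0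
        have hni : n ≤ i := by
          by_contra hc
          exact hn.2.2 i hi0 (by omega) hi
        rcases hni.eq_or_lt with e | e
        · rw [e]
        · rw [← hadd z hni] at hi ⊢
          obtain ⟨n1, -, h1⟩ := S.exists_firstReturn (show 0 < i - n by omega) hi
          have h2 := hmono _ _ _ _ hn.2.1 hz hlt h1 hn
          exact (ih (i - n) (by have := hn.1; omega) _ n1 hn.2.1 h1 h2 hi (by omega)).trans h2.le
    obtain ⟨v', u', s1, s2, s3, s4, s5⟩ := S.split.sep hlt
    obtain ⟨i, hi, hm⟩ := hrec.exists_mem (S.Icc_mem_nhds s5 hv s3 hw.2) 1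
    have h3 := key i w n0 hw h0 hlt ⟨(h0.2.1.1.trans s1).trans (s2.le.trans hm.1), hm.2⟩ hi
    exact absurd (s2.lt.trans_le hm.1) (not_lt.2 (h3.trans s1))
  · have key : ∀ i z n, z ∈ Icc u v → S.FirstReturn (Icc u v) z n → z < (S.T ^ n) z →
        (S.T ^ i) z ∈ Icc u v → 0 < i → (S.T ^ n) z ≤ (S.T ^ i) z := by
      intro i
      induction i using Nat.strong_induction_on with
      | _ i ih =>
        intro z n hz hn hlt hi hi0
        have hni : n ≤ i := by
          by_contra hc
          exact hn.2.2 i hi0 (by omega) hi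
        rcases hni.eq_or_lt with e | e
        · rw [e]
        · rw [← hadd z hni] at hi ⊢
          obtain ⟨n1, -, h1⟩ := S.exists_firstReturn (show 0 < i - n by omega) hi
          have h2 := hmono _ _ _ _ hz hn.2.1 hlt hn h1
          exact h2.le.trans (ih (i - n) (by have := hn.1; omega) _ n1 hn.2.1 h1 h2 hi (by omega))
    obtain ⟨v', u', s1, s2, s3, s4, s5⟩ := S.split.sep hlt
    obtain ⟨i, hi, hm⟩ := hrec.exists_mem (S.Icc_mem_nhds hu s4 hw.1 s1) 1
    have h3 := key i w n0 hw h0 hlt ⟨hm.1, hm.2.trans (s2.le.trans (s3.trans h0.2.1.2))⟩ hi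
    exact absurd (hm.2.trans_lt s2.lt) (not_lt.2 (s3.trans h3))

/-- If the first return to an interval around a recurrent point has a single cut, then it swaps the
two pieces. -/
theorem exists_flip {u v ym y w : X} (hu : sg u = true) (hv : sg v = false) (hcov : ym ⋖ y)
    (huy : u < y) (hyv : y ≤ v) (hcut : ∀ x, S.IsCut u v x → x = y) (hw : w ∈ Icc u v)
    (hrec : Visits S.T w w) (hper : ∀ n, 0 < n → (S.T ^ n) w ≠ w) :
    ∃ r₁ r₂, (∀ x, u ≤ x → x ≤ ym → S.FirstReturn (Icc u v) x r₁) ∧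
      (∀ x, y ≤ x → x ≤ v → S.FirstReturn (Icc u v) x r₂) ∧
      S.Uncut r₁ u ym ∧ S.Uncut r₂ y v ∧ (S.T ^ r₂) v < (S.T ^ r₁) u := by
  have huym : u ≤ ym := hcov.le_of_lt huy
  have hymv : ym ≤ v := hcov.le.trans hyv
  have cutA : ∀ x, u < x → x ≤ ym → ¬ S.IsCut u v x := fun x _ h hx =>
    absurd hcov.lt (not_lt.2 (hcut x hx ▸ h))
  have cutB : ∀ x, y < x → x ≤ v → ¬ S.IsCut u v x := fun x h _ hx =>
    absurd h (hcut x hx ▸ lt_irrefl _)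
  have retA : ∀ {x n}, u ≤ x → x ≤ ym → S.FirstReturn (Icc u v) x n →
      ∀ x', u ≤ x' → x' ≤ ym → S.FirstReturn (Icc u v) x' n := by
    intro x n h1 h2 h x' h1' h2'
    have h3 := (S.firstReturn_iff hv le_rfl (h2.trans hymv) h1
      (fun z a b => cutA z a (b.trans h2)) n).2 h
    exact (S.firstReturn_iff hv le_rfl (h2'.trans hymv) h1'
      (fun z a b => cutA z a (b.trans h2')) n).1 h3
  have retB : ∀ {x n}, y ≤ x → x ≤ v → S.FirstReturn (Icc u v) x n →
      ∀ x', y ≤ x' → x' ≤ v → S.FirstReturn (Icc u v) x' n := by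
    intro x n h1 h2 h x' h1' h2'
    have h3 := (S.firstReturn_iff hv huy.le h2 h1 (fun z a b => cutB z a (b.trans h2)) n).2 h
    exact (S.firstReturn_iff hv huy.le h2' h1' (fun z a b => cutB z a (b.trans h2')) n).1 h3
  have uncA : ∀ {n}, S.FirstReturn (Icc u v) u n → S.Uncut n u ym := fun {n} h =>
    (S.run_of_not_isCut hv le_rfl hymv huym cutA n fun i a b => Or.inr (h.2.2 i a b)).1
  have uncB : ∀ {n}, S.FirstReturn (Icc u v) y n → S.Uncut n y v := fun {n} h =>
    (S.run_of_not_isCut hv huy.le le_rfl hyv cutB n fun i a b => Or.inr (h.2.2 i a b)).1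
  by_contra hcon
  refine S.not_mono_return hu hv hw hrec hper fun z z' n n' hz hz' hlt hn hn' => ?_
  rcases le_or_gt z' ym with h1 | h1
  · have hA := retA (hz.1.trans hlt.le) h1 hn'
    obtain rfl := (hA z hz.1 (hlt.le.trans h1)).unique hn
    exact (uncA (hA u le_rfl huym)).lt hz.1 hlt h1
  · have h1' : y ≤ z' := hcov.ge_of_gt h1
    rcases le_or_gt y z with h2 | h2
    · have hB := retB h1' hz'.2 hn'
      obtain rfl := (hB z h2 hz.2).unique hn
      exact (uncB (hB y le_rfl hyv)).lt h2 hlt hz'.2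
    · have h2' : z ≤ ym := hcov.le_of_lt h2
      have hA := retA hz.1 h2' hn
      have hB := retB h1' hz'.2 hn'
      have UA := uncA (hA u le_rfl huym)
      have UB := uncB (hB y le_rfl hyv)
      have hle : (S.T ^ n) u ≤ (S.T ^ n') v := by
        by_contra hc
        exact hcon ⟨n, n', hA, hB, UA, UB, not_le.1 hc⟩
      -- A common point of the two images would give an early return or a point in both pieces. The
      -- images are thus disjoint, and not being swapped they lie in the original order, which makes
      -- the first return increasing.
      have hdisj : (S.T ^ n) ym < (S.T ^ n') y := by
        by_contra hc
        push Not at hc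
        have ha := UA.monoLE le_rfl huym le_rfl
        have hb := UB.monoLE le_rfl hyv le_rfl
        obtain ⟨p, p1, p2, p3⟩ := UA.exists_eq huym (le_max_left ((S.T ^ n) u) ((S.T ^ n') y))
          (max_le ha hc)
        obtain ⟨q, q1, q2, q3⟩ := UB.exists_eq hyv (le_max_right ((S.T ^ n) u) ((S.T ^ n') y))
          (max_le hle hb)
        have hpq : (S.T ^ n) p = (S.T ^ n') q := p3.trans q3.symm
        rcases lt_trichotomy n n' with h | h | h
        · have e : (S.T ^ (n' - n)) q = p := by
            apply (S.T ^ n).injective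
            rw [S.pow_sub_apply h.le, hpq]
          exact (hB q q1 q2).2.2 (n' - n) (by omega) (by have := hn.1; omega)
            (e ▸ ⟨p1, p2.trans hymv⟩)
        · subst h
          have := (S.T ^ n).injective hpq
          subst this
          exact absurd hcov.lt (not_lt.2 (q1.trans p2))
        · have e : (S.T ^ (n - n')) p = q := by
            apply (S.T ^ n').injective
            rw [S.pow_sub_apply h.le, hpq]
          exact (hA p p1 p2).2.2 (n - n') (by omega) (by have := hn'.1; omega)
            (e ▸ ⟨huy.le.trans q1, q2⟩)
      exact ((UA.monoLE hz.1 h2' le_rfl).trans_lt hdisj).trans_le (UB.monoLE le_rfl h1' hz'.2)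

/-- The return structure of an interval whose endpoints lie on the backward orbit of a jump
`Q 0 ⋖ P 0`, when this jump is the only source of cuts. -/
theorem return_gap {P Q : ℤ → X} (hP : ∀ (n : ℕ) i, (S.T ^ n) (P i) = P (i + n))
    (hQ : ∀ (n : ℕ) i, (S.T ^ n) (Q i) = Q (i + n)) (injP : Function.Injective P)
    (injQ : Function.Injective Q) (hcov : ∀ i ≤ 0, Q i ⋖ P i) {n m k : ℕ} (hnk : n < k)
    (hmk : m < k) (hky : P (-n) < P (-k) ∧ P (-k) ≤ Q (-m))
    (hk : ∀ i : ℕ, i < k → ¬(P (-n) < P (-i) ∧ P (-i) ≤ Q (-m)))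
    (hl : ∀ j (i : ℕ), ((S.T⁻¹) ^ i) (S.l j) ∈ Icc (P (-n)) (Q (-m)) →
      ∃ h : ℕ, h ≤ i ∧ S.l j = P h)
    {w : X} (hw : w ∈ Icc (P (-n)) (Q (-m))) (hrec : Visits S.T w w)
    (hper : ∀ n, 0 < n → (S.T ^ n) w ≠ w) :
    ∃ t : ℕ, 0 < t ∧ Q t ∈ Icc (P (-n)) (Q (-m)) ∧ P t ∈ Icc (P (-n)) (Q (-m)) ∧ Q t < P t ∧
      (∀ h : ℕ, 0 < h → h < t → P h ∉ Icc (P (-n)) (Q (-m)) ∧ Q h ∉ Icc (P (-n)) (Q (-m))) ∧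
      (∀ x ∈ Icc (P (-n)) (Q (-m)), ∀ i : ℕ, 0 < i → (S.T ^ i) x ∈ Icc (P (-n)) (Q (-m)) →
        (S.T ^ i) x ≤ Q t ∨ P t ≤ (S.T ^ i) x) ∧
      ∃ h : ℕ, 0 < h ∧ h < t ∧ P h < Q h := by
  set u := P (-n) with hu_def
  set v := Q (-m) with hv_def
  have su : sg u = true := (S.split.sg_of_covBy (hcov (-n) (by omega))).2
  have sv : sg v = false := (S.split.sg_of_covBy (hcov (-m) (by omega))).1
  have hcy := hcov (-k) (by omega)
  -- Every marker that a cut reaches lies on the orbit `P`, so the cut is some `P (-k')`. Here `k' <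
  -- k` contradicts `hk`, and for `k' > k` the point returns too early, at `P (-k)`.
  have hcut : ∀ x, S.IsCut u v x → x = P (-k) := by
    rintro x ⟨h1, h2, i, hi⟩
    have key : ∀ k' : ℕ, x = P (-k') →
        (k < k' → (S.T ^ (k' - k)) x ∉ Icc u v) → x = P (-k) := by
      intro k' e hne
      rcases lt_trichotomy k' k with h | h | h
      · exact absurd ⟨e ▸ h1, e ▸ h2⟩ (hk k' h)
      · rw [e, h]
      · refine absurd ?_ (hne h)
        rw [e, hP]
        have : (-(k' : ℤ) + ((k' - k : ℕ) : ℤ)) = -k := by omega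
        rw [this]
        exact ⟨hky.1.le, hky.2⟩
    have eqP : ∀ i' : ℕ, ∀ q : ℤ, (S.T ^ i') x = P q → x = P (q - i') := by
      intro i' q h
      apply (S.T ^ i').injective
      rw [h, hP]
      congr 1
      omega
    rcases hi with ⟨⟨j, hj⟩, hno⟩ | ⟨hi0, hx, hno⟩
    · obtain ⟨h, hhi, hh⟩ := hl j i (by
        rw [← hj, S.inv_pow_apply_pow]; exact ⟨h1.le, h2⟩)
      refine key (i - h) ?_ fun hlt => hno _ (by omega) (by omega)
      rw [eqP i h (hj.trans hh)]
      congr 1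
      omega
    · rcases hx with hx | hx
      · refine key (n + i) ?_ fun hlt => hno _ (by omega) (by omega)
        rw [eqP i _ hx]
        congr 1
        omega
      · have := hx.unique_right (hcov (-m) (by omega))
        refine key (m + i) ?_ fun hlt => hno _ (by omega) (by omega)
        rw [eqP i _ this]
        congr 1
        omega
  obtain ⟨r₁, r₂, hA, hB, UA, UB, hlt⟩ := S.exists_flip su sv hcy hky.1 hky.2 hcut hw hrec hper
  have huym : u ≤ Q (-k) := hcy.le_of_lt hky.1
  have hA0 := hA _ le_rfl huym
  have hA1 := hA _ huym le_rfl
  have hB0 := hB _ le_rfl hky.2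
  have hB1 := hB _ hky.2 le_rfl
  have le_of_ret : ∀ {z : X} {r i : ℕ}, S.FirstReturn (Icc u v) z r → 0 < i →
      (S.T ^ i) z ∈ Icc u v → r ≤ i := fun h h0 h1 => by
    by_contra hc
    exact h.2.2 _ h0 (not_le.1 hc) h1
  -- `P (-k)` reaches `u` after `k - n` steps. A return lands at some `P (-i)` with `i < k`, and by
  -- `hk` the only such point in `[u, v]` is `u`. The value of `r₁` comes from `Q` and `v` in the
  -- same way.
  have er2 : r₂ = k - n := by
    have h1 : r₂ ≤ k - n := le_of_ret hB0 (by omega) (by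
      rw [hP]
      have : (-(k : ℤ) + ((k - n : ℕ) : ℤ)) = -n := by omega
      rw [this]
      exact ⟨le_rfl, hky.1.le.trans hky.2⟩)
    have h2 := hB0.2.1
    rw [hP] at h2
    have e : (-(k : ℤ) + (r₂ : ℤ)) = -((k - r₂ : ℕ) : ℤ) := by omega
    rw [e] at h2
    have h0 := hB0.1
    have h3 : ¬ (u < P (-((k - r₂ : ℕ) : ℤ))) := fun h => hk (k - r₂) (by omega) ⟨h, h2.2⟩
    have h4 := injP (le_antisymm (not_lt.1 h3) h2.1)
    omega
  have er1 : r₁ = k - m := by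
    have h1 : r₁ ≤ k - m := le_of_ret hA1 (by omega) (by
      rw [hQ]
      have : (-(k : ℤ) + ((k - m : ℕ) : ℤ)) = -m := by omega
      rw [this]
      exact ⟨hky.1.le.trans hky.2, le_rfl⟩)
    have h2 := hA1.2.1
    rw [hQ] at h2
    have e : (-(k : ℤ) + (r₁ : ℤ)) = -((k - r₁ : ℕ) : ℤ) := by omega
    rw [e] at h2
    have h0 := hA1.1
    have hc' := hcov (-((k - r₁ : ℕ) : ℤ)) (by omega)
    have h3 : ¬ (Q (-((k - r₁ : ℕ) : ℤ)) < v) := fun h =>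
      hk (k - r₁) (by omega) ⟨h2.1.trans_lt hc'.lt, hc'.ge_of_gt h⟩
    have h4 := injQ (le_antisymm h2.2 (not_lt.1 h3))
    omega
  have hTu : (S.T ^ r₁) u = P (k - m - n) := by
    rw [hu_def, hP]; congr 1; omega
  have hTv : (S.T ^ r₂) v = Q (k - m - n) := by
    rw [hv_def, hQ]; congr 1; omega
  have hA2 := hA0.2.1
  have hB2 := hB1.2.1
  rw [hTu] at hA2 hlt
  rw [hTv] at hB2 hlt
  -- Otherwise `P (k - m - n)` would be a backward iterate of index below `k` inside `(u, v]`,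
  -- against `hk`.
  have hkt : m + n < k := by
    by_contra hc
    have e : (k - m - n : ℤ) = -((m + n - k : ℕ) : ℤ) := by omega
    rw [e] at hlt hA2 hB2
    exact hk (m + n - k) (by omega) ⟨hB2.1.trans_lt hlt, hA2.2⟩
  obtain ⟨t, ht, rfl⟩ : ∃ t : ℕ, 0 < t ∧ k = m + n + t := ⟨k - (m + n), by omega, by omega⟩
  have et : (((m + n + t : ℕ) : ℤ) - m - n) = (t : ℤ) := by omega
  rw [et] at hTu hTv hA2 hB2 hlt
  refine ⟨t, ht, hB2, hA2, hlt, fun h h0 h1 => ⟨?_, ?_⟩, ?_, ?_⟩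
  · have := hA0.2.2 (h + n) (by omega) (by omega)
    have e : -(n : ℤ) + ((h + n : ℕ) : ℤ) = h := by omega
    rwa [hu_def, hP, e] at this
  · have := hB1.2.2 (h + m) (by omega) (by omega)
    have e : -(m : ℤ) + ((h + m : ℕ) : ℤ) = h := by omega
    rwa [hv_def, hQ, e] at this
  · intro x hx i
    induction i using Nat.strong_induction_on generalizing x with
    | _ i ih =>
      intro hi0 hi
      have first : ∀ r, S.FirstReturn (Icc u v) x r →
          ((S.T ^ r) x ≤ Q t ∨ P t ≤ (S.T ^ r) x) → (S.T ^ i) x ≤ Q t ∨ P t ≤ (S.T ^ i) x := by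
        intro r hr h
        have hri := le_of_ret hr hi0 hi
        rcases hri.eq_or_lt with e | e
        · rwa [← e]
        · have e2 : (S.T ^ i) x = (S.T ^ (i - r)) ((S.T ^ r) x) := by
            rw [← Equiv.Perm.mul_apply, ← pow_add, Nat.sub_add_cancel hri]
          rw [e2] at hi ⊢
          exact ih (i - r) (by have := hr.1; omega) _ hr.2.1 (by omega) hi
      rcases le_or_gt x (Q (-((m + n + t : ℕ) : ℤ))) with h | h
      · refine first r₁ (hA x hx.1 h) (Or.inr ?_)
        rw [← hTu]
        exact UA.monoLE le_rfl hx.1 h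
      · refine first r₂ (hB x (hcy.ge_of_gt h) hx.2) (Or.inl ?_)
        rw [← hTv]
        exact UB.monoLE (hcy.ge_of_gt h) hx.2 le_rfl
  · by_contra hcon
    push Not at hcon
    -- If `Q` stayed below `P` throughout, the lowest `P i₀` would not be lowest: `Q i₀ < P i₀`, and
    -- the uncut stretch ending at `Q i₀` starts at another `P i` with index in the same range.
    obtain ⟨i₀, hi₀, hmin⟩ := Finset.exists_min_image
      (Finset.Ico (-((m + n + t : ℕ) : ℤ)) (t : ℤ)) P ⟨0, Finset.mem_Ico.2 ⟨by omega, by omega⟩⟩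
    rw [Finset.mem_Ico] at hi₀
    have hQP : Q i₀ < P i₀ := by
      rcases le_or_gt i₀ 0 with h | h
      · exact (hcov i₀ h).lt
      · obtain ⟨h', rfl⟩ : ∃ h' : ℕ, i₀ = h' := ⟨i₀.toNat, by omega⟩
        refine (hcon h' (by omega) (by omega)).lt_of_ne ?_
        intro e
        have s0 := S.split.sg_of_covBy (hcov 0 le_rfl)
        have e1 := hP h' 0
        have e2 := hQ h' 0
        rw [zero_add] at e1 e2
        have s1 := S.sg_pow h' (P 0)
        have s2 := S.sg_pow h' (Q 0)
        rw [e1, s0.2] at s1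
        rw [e2, s0.1, e, s1] at s2
        exact absurd s2 (by decide)
    rcases lt_or_ge i₀ (-m) with h | h
    · obtain ⟨i, hi⟩ : ∃ i : ℕ, i₀ = i - ((m + n + t : ℕ) : ℤ) :=
        ⟨(i₀ + ((m + n + t : ℕ) : ℤ)).toNat, by omega⟩
      have h1 := (UA.le (m := i) (by omega)).monoLE le_rfl huym le_rfl
      rw [hu_def, hP, hQ] at h1
      have e : -((m + n + t : ℕ) : ℤ) + (i : ℤ) = i₀ := by omega
      rw [e] at h1
      exact absurd (h1.trans_lt hQP) (not_lt.2 (hmin _ (Finset.mem_Ico.2 ⟨by omega, by omega⟩)))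
    · obtain ⟨i, hi⟩ : ∃ i : ℕ, i₀ = i - (m : ℤ) := ⟨(i₀ + m).toNat, by omega⟩
      have h1 := (UB.le (m := i) (by omega)).monoLE le_rfl hky.2 le_rfl
      rw [hv_def, hP, hQ] at h1
      have e : -(m : ℤ) + (i : ℤ) = i₀ := by omega
      rw [e] at h1
      exact absurd (h1.trans_lt hQP) (not_lt.2 (hmin _ (Finset.mem_Ico.2 ⟨by omega, by omega⟩)))

end Exchange

end GIET

/-! ### Choosing the interval near a recurrent germ -/

namespace GIET

theorem exists_last {p : ℕ → Prop} {t : ℕ} (ht : 0 < t) (h0 : p 0) :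
    ∃ h < t, p h ∧ ∀ h', h < h' → h' < t → ¬ p h' := by
  classical
  refine ⟨Nat.findGreatest p (t - 1), ?_, Nat.findGreatest_spec (Nat.zero_le _) h0, ?_⟩
  · have := Nat.findGreatest_le (P := p) (t - 1)
    omega
  · intro h' h1 h2
    exact Nat.findGreatest_is_greatest h1 (by omega)

theorem injective_zpow_apply {X : Type*} {f : Equiv.Perm X} {y : X}
    (h : ∀ n : ℕ, 0 < n → (f ^ n) y ≠ y) : Function.Injective fun i : ℤ => (f ^ i) y := by
  have aux : ∀ i j : ℤ, i < j → (f ^ i) y ≠ (f ^ j) y := by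
    intro i j hij e
    obtain ⟨n, rfl⟩ : ∃ n : ℕ, j = i + n := ⟨(j - i).toNat, by omega⟩
    rw [zpow_add, Equiv.Perm.mul_apply] at e
    exact h n (by omega) ((f ^ i).injective e).symm
  intro i j e
  rcases lt_trichotomy i j with hl | hl | hl
  · exact absurd e (aux i j hl)
  · exact hl
  · exact absurd e.symm (aux j i hl)

theorem Visits.exists_ne {X : Type*} [TopologicalSpace X] {f : Equiv.Perm X} {x g : X}
    (h : Visits f x g) (hg : ∀ n : ℕ, 0 < n → (f ^ n) g ≠ g) {s : Set X} (hs : s ∈ 𝓝 x) (p : X) :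
    ∃ n : ℕ, (f ^ n) g ∈ s ∧ (f ^ n) g ≠ p := by
  obtain ⟨n, -, hn⟩ := h.exists_mem hs 0
  obtain ⟨m, hm, hm'⟩ := h.exists_mem hs (n + 1)
  by_cases e : (f ^ n) g = p
  · refine ⟨m, hm', fun e' => ?_⟩
    have := injective_zpow_apply hg (a₁ := (n : ℤ)) (a₂ := (m : ℤ))
      (by simpa using e.trans e'.symm)
    omega
  · exact ⟨n, hn, e⟩

namespace Exchange

variable {X : Type*} [LinearOrder X] {sg : X → Bool} {d : ℕ} (S : Exchange X sg d)

theorem inv_pow_eq_zpow (n : ℕ) : (S.T⁻¹) ^ n = S.T ^ (-(n : ℤ)) := by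
  rw [inv_pow, zpow_neg, zpow_natCast]

theorem ne_of_inv_pow_ne {y : X} (h : ∀ n : ℕ, 0 < n → ((S.T⁻¹) ^ n) y ≠ y) (n : ℕ) (hn : 0 < n) :
    (S.T ^ n) y ≠ y := fun e => h n hn (by
  nth_rewrite 1 [← e]
  exact S.inv_pow_apply_pow n y)

theorem inv_ne_of_pow_ne {y : X} (h : ∀ n : ℕ, 0 < n → (S.T ^ n) y ≠ y) (n : ℕ) (hn : 0 < n) :
    ((S.T⁻¹) ^ n) y ≠ y := fun e => h n hn (by
  nth_rewrite 1 [← e]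
  exact S.pow_apply_inv_pow n y)

/-- A jump that is not preceded by left endpoints travels backward forever. -/
theorem covBy_inv_pow {am ap : X} (hcov : am ⋖ ap)
    (hpast : ∀ i : ℕ, 0 < i → ∀ j, ((S.T⁻¹) ^ i) ap ≠ S.l j) (i : ℕ) :
    ((S.T⁻¹) ^ i) am ⋖ ((S.T⁻¹) ^ i) ap := by
  induction i with
  | zero => exact hcov
  | succ i ih =>
    rw [pow_succ', Equiv.Perm.mul_apply, Equiv.Perm.mul_apply]
    refine S.inv.covBy_T ih fun j hj => hpast (i + 1) (by omega) j ?_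
    rw [pow_succ', Equiv.Perm.mul_apply, hj]
    simp

variable [TopologicalSpace X] [OrderTopology X]

/-- Near a recurrent point visited by the backward orbit of a jump there is an interval with the
return structure of `return_gap`. -/
theorem exists_return_gap {x am ap : X} (hx : Visits S.T x x)
    (hper : ∀ n : ℕ, 0 < n → (S.T ^ n) x ≠ x) (sx : sg x = true) (hcov : am ⋖ ap)
    (hpast : ∀ i : ℕ, 0 < i → ∀ j, ((S.T⁻¹) ^ i) ap ≠ S.l j) (hvis : Visits S.T⁻¹ x ap)
    {U : Set X} (hU : U ∈ 𝓝 x)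
    (hl : ∀ j (i : ℕ), ((S.T⁻¹) ^ i) (S.l j) ∈ U → ∃ h : ℕ, h ≤ i ∧ S.l j = (S.T ^ h) ap) :
    ∃ u v, Icc u v ⊆ U ∧ (∃ n : ℕ, ((S.T⁻¹) ^ n) ap = u) ∧ (∃ m : ℕ, ((S.T⁻¹) ^ m) am = v) ∧
      (∀ h : ℕ, 0 < h → (S.T ^ h) ap ≠ ap ∧ (S.T ^ h) am ≠ am) ∧
      (∀ h : ℕ, 0 < h → ¬ (S.T ^ h) am ⋖ u ∧ ¬ v ⋖ (S.T ^ h) ap) ∧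
      ∃ t : ℕ, 0 < t ∧ (S.T ^ t) am ∈ Icc u v ∧ (S.T ^ t) ap ∈ Icc u v ∧
        (S.T ^ t) am < (S.T ^ t) ap ∧
        (∀ h : ℕ, 0 < h → h < t → (S.T ^ h) ap ∉ Icc u v ∧ (S.T ^ h) am ∉ Icc u v) ∧
        (∀ x ∈ Icc u v, ∀ i : ℕ, 0 < i → (S.T ^ i) x ∈ Icc u v →
          (S.T ^ i) x ≤ (S.T ^ t) am ∨ (S.T ^ t) ap ≤ (S.T ^ i) x) ∧
        ∃ h : ℕ, 0 < h ∧ h < t ∧ (S.T ^ h) ap < (S.T ^ h) am := by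
  have hap' : ∀ n : ℕ, 0 < n → ((S.T⁻¹) ^ n) ap ≠ ap := by
    intro n hn e
    obtain ⟨m, rfl⟩ := mem_orbit_of_visits_periodic hn e hvis
    refine S.inv_ne_of_pow_ne hper n hn ?_
    rw [← Equiv.Perm.mul_apply, ← pow_add, add_comm, pow_add, Equiv.Perm.mul_apply, e]
  have hcovi := S.covBy_inv_pow hcov hpast
  have ham' : ∀ n : ℕ, 0 < n → ((S.T⁻¹) ^ n) am ≠ am := by
    intro n hn e
    have h1 := hcovi n
    rw [e] at h1
    exact hap' n hn (h1.unique_right hcov)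
  have hap := S.ne_of_inv_pow_ne hap'
  have ham := S.ne_of_inv_pow_ne ham'
  obtain ⟨u₀, v₀, su₀, sv₀, hu₀, hv₀, hUsub⟩ := S.exists_Icc_subset hU
  -- The right germ `x` is approached only from above. The construction therefore runs around a
  -- forward iterate `w > x` that lies strictly between two backward iterates of `ap`.
  obtain ⟨i₁, hi₁, hi₁'⟩ := hvis.exists_ne hap' (S.Icc_mem_nhds sx sv₀ le_rfl hv₀) x
  have hx1 : x < ((S.T⁻¹) ^ i₁) ap := hi₁.1.lt_of_ne (Ne.symm hi₁')
  have hx1' : x ≤ ((S.T⁻¹) ^ i₁) am := (hcovi i₁).le_of_lt hx1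
  obtain ⟨i₃, hi₃, hi₃'⟩ := hx.exists_ne hper (S.Icc_mem_nhds sx
    (S.split.sg_of_covBy (hcovi i₁)).1 le_rfl hx1') x
  set w := (S.T ^ i₃) x with hw_def
  have hxw : x < w := hi₃.1.lt_of_ne (Ne.symm hi₃')
  obtain ⟨v₂, u₂, s1, s2, s3, s4, s5⟩ := S.split.sep hxw
  obtain ⟨i₂, hi₂, -⟩ := hvis.exists_ne hap' (S.Icc_mem_nhds sx s4 le_rfl s1) x
  have hw2 : ((S.T⁻¹) ^ i₂) ap < w := hi₂.2.trans_lt (s2.lt.trans_le s3)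
  have hw1 : w < ((S.T⁻¹) ^ i₁) ap := hi₃.2.trans_lt (hcovi i₁).lt
  -- The interval is bounded by the backward iterates nearest to `w` among those of index at most
  -- `N`. No iterate of such an index falls inside, so the first one that does, of index `k`, has `k
  -- > n` and `k > m`.
  let N := max i₁ i₂
  obtain ⟨n, hn, hnmax⟩ := Finset.exists_max_image
    ((Finset.range (N + 1)).filter fun i => ((S.T⁻¹) ^ i) ap ≤ w) (fun i => ((S.T⁻¹) ^ i) ap)
    ⟨i₂, by simp only [Finset.mem_filter, Finset.mem_range]; exact ⟨by omega, hw2.le⟩⟩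
  obtain ⟨m, hm, hmmin⟩ := Finset.exists_min_image
    ((Finset.range (N + 1)).filter fun i => w < ((S.T⁻¹) ^ i) ap) (fun i => ((S.T⁻¹) ^ i) ap)
    ⟨i₁, by simp only [Finset.mem_filter, Finset.mem_range]; exact ⟨by omega, hw1⟩⟩
  simp only [Finset.mem_filter, Finset.mem_range] at hn hm hnmax hmmin
  have hwJ : w ∈ Icc (((S.T⁻¹) ^ n) ap) (((S.T⁻¹) ^ m) am) := ⟨hn.2, (hcovi m).le_of_lt hm.2⟩
  have hJU : Icc (((S.T⁻¹) ^ n) ap) (((S.T⁻¹) ^ m) am) ⊆ U := by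
    refine fun y hy => hUsub ⟨?_, ?_⟩
    · exact hu₀.trans (hi₂.1.trans ((hnmax i₂ ⟨by omega, hw2.le⟩).trans hy.1))
    · exact ((hy.2.trans (hcovi m).le).trans (hmmin i₁ ⟨by omega, hw1⟩)).trans hi₁.2
  have hbetween : ∀ i ≤ N, ¬(((S.T⁻¹) ^ n) ap < ((S.T⁻¹) ^ i) ap ∧
      ((S.T⁻¹) ^ i) ap ≤ ((S.T⁻¹) ^ m) am) := by
    rintro i hi ⟨h1, h2⟩
    rcases le_or_gt (((S.T⁻¹) ^ i) ap) w with h | h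
    · exact absurd (hnmax i ⟨by omega, h⟩) (not_le.2 h1)
    · exact absurd (h2.trans_lt (hcovi m).lt) (not_lt.2 (hmmin i ⟨by omega, h⟩))
  have hvisw : Visits S.T⁻¹ w ap := (visits_pow_left (Or.inr rfl) _).2 hvis
  obtain ⟨k₀, hk₀, hk₀'⟩ := hvisw.exists_ne hap' (S.Icc_mem_nhds
    (S.split.sg_of_covBy (hcovi n)).2 (S.split.sg_of_covBy (hcovi m)).1 hwJ.1 hwJ.2)
    (((S.T⁻¹) ^ n) ap)
  classical
  have hex : ∃ i : ℕ, ((S.T⁻¹) ^ n) ap < ((S.T⁻¹) ^ i) ap ∧ ((S.T⁻¹) ^ i) ap ≤ ((S.T⁻¹) ^ m) am :=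
    ⟨k₀, hk₀.1.lt_of_ne (Ne.symm hk₀'), hk₀.2⟩
  have hk := Nat.find_spec hex
  have hkmin : ∀ i < Nat.find hex, ¬ _ := fun i hi => Nat.find_min hex hi
  set k := Nat.find hex
  have hkN : N < k := by
    by_contra hc
    exact hbetween k (by omega) hk
  have gap := S.return_gap (P := fun i => (S.T ^ i) ap) (Q := fun i => (S.T ^ i) am)
    (n := n) (m := m) (k := k)
    (fun n i => by rw [← zpow_natCast, ← Equiv.Perm.mul_apply, ← zpow_add, add_comm])
    (fun n i => by rw [← zpow_natCast, ← Equiv.Perm.mul_apply, ← zpow_add, add_comm])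
    (injective_zpow_apply hap) (injective_zpow_apply ham)
    (fun i hi => by
      obtain ⟨n, rfl⟩ : ∃ n : ℕ, i = -n := ⟨(-i).toNat, by omega⟩
      rw [← S.inv_pow_eq_zpow]
      exact hcovi n)
    (by omega) (by omega)
  simp only [← S.inv_pow_eq_zpow, zpow_natCast] at gap
  refine ⟨((S.T⁻¹) ^ n) ap, ((S.T⁻¹) ^ m) am, hJU, ⟨n, rfl⟩, ⟨m, rfl⟩,
    fun h h0 => ⟨hap h h0, ham h h0⟩, fun h h0 => ⟨fun hc => ?_, fun hc => ?_⟩,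
    gap hk hkmin (fun j i hj => hl j i (hJU hj)) hwJ ?_ ?_⟩
  · have e := hc.unique_left (hcovi n)
    rw [S.inv_pow_eq_zpow, ← zpow_natCast] at e
    have := injective_zpow_apply ham e
    omega
  · have e := hc.unique_right (hcovi m)
    rw [S.inv_pow_eq_zpow, ← zpow_natCast] at e
    have := injective_zpow_apply hap e
    omega
  · exact (visits_pow_left (Or.inl rfl) _).2 ((visits_pow_right (Or.inl rfl) _).2 hx)
  · intro n hn e
    rw [hw_def, ← Equiv.Perm.mul_apply, ← pow_add, add_comm, pow_add, Equiv.Perm.mul_apply] at e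
    exact hper n hn ((S.T ^ i₃).injective e)

end Exchange

end GIET

/-! ### Counting the ends that enter the chosen interval -/

namespace GIET

namespace Exchange

open Classical in
/-- The indices `j` for which the orbit of `e j` under `f` visits `x`. -/
noncomputable def visitors {X : Type*} [TopologicalSpace X] {d : ℕ} (f : Equiv.Perm X)
    (e : Fin d → X) (x : X) : Finset (Fin d) :=
  {j | Visits f x (e j)}

theorem mem_visitors {X : Type*} [TopologicalSpace X] {d : ℕ} {f : Equiv.Perm X}
    {e : Fin d → X} {x : X} {j : Fin d} :
    j ∈ visitors f e x ↔ Visits f x (e j) := by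
  simp [visitors]

variable {X : Type*} [LinearOrder X] {sg : X → Bool} {d : ℕ} (S : Exchange X sg d)

/-- The jump `π ⋖ succ π` next to the forward orbit of a left germ `am` up to time `t` was created at
the last right endpoint that this orbit meets. -/
theorem exists_left_endpoint_of_succ {am q : X} {t : ℕ} (ht : 0 < t) (h0 : ∃ j, am = S.r j)
    (sm : sg am = false) (hq : (S.T ^ t) am < q) :
    ∃ h < t, ∃ i, ∀ s, h + 1 + s ≤ t → (S.T ^ (h + 1 + s)) am ⋖ (S.T ^ (s + 1)) (S.l i) := by
  obtain ⟨h, hht, ⟨j, hj⟩, hlast⟩ := exists_last (p := fun h => ∃ j, (S.T ^ h) am = S.r j) ht h0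
  have e1 : (S.T ^ (h + 1)) am = S.inv.r j := by
    rw [pow_succ', Equiv.Perm.mul_apply, hj]; rfl
  have hsucc : ∃ y, (S.T ^ (h + 1)) am ⋖ y := by
    rcases S.split.exists_succ (v := (S.T ^ (h + 1)) am) (by rw [S.sg_pow, sm]) with hm | hm
    · exfalso
      rcases (show h + 1 ≤ t by omega).eq_or_lt with e | e
      · rw [e] at hm
        exact absurd hq (not_lt.2 (hm q))
      · exact hlast (h + 1) (by omega) e (S.r_of_isMax hm)
    · exact hm
  obtain ⟨y, hy⟩ := hsucc
  -- One step after a right endpoint the orbit is at the upper end of an image piece, so the next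
  -- germ starts another image piece.
  obtain ⟨i, rfl⟩ := S.inv.l_of_r_covBy (j := j) (x := y) (e1 ▸ hy)
  refine ⟨h, hht, i, fun s => ?_⟩
  induction s with
  | zero => intro _; simpa using hy
  | succ s ih =>
    intro hs
    have h1 := ih (by omega)
    have h2 := S.covBy_T h1 (fun j hj => by
      rw [hj] at h1
      exact hlast (h + 1 + s) (by omega) (by omega) (S.r_of_covBy_l h1))
    rwa [← Equiv.Perm.mul_apply, ← pow_succ', ← Equiv.Perm.mul_apply, ← pow_succ'] at h2

/-- Mirror image of `exists_left_endpoint_of_succ`: after the last left endpoint met by the orbit of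
`ap`, the jump below it is never broken. -/
theorem exists_right_endpoint_of_pred {ap q : X} {t : ℕ} (ht : 0 < t) (h0 : ∃ j, ap = S.l j)
    (sp : sg ap = true) (hq : q < (S.T ^ t) ap) :
    ∃ h < t, ∃ i, ∀ s, h + 1 + s ≤ t → (S.T ^ (s + 1)) (S.r i) ⋖ (S.T ^ (h + 1 + s)) ap := by
  obtain ⟨h, hht, ⟨j, hj⟩, hlast⟩ := exists_last (p := fun h => ∃ j, (S.T ^ h) ap = S.l j) ht h0
  have e1 : (S.T ^ (h + 1)) ap = S.inv.l j := by
    rw [pow_succ', Equiv.Perm.mul_apply, hj]; rfl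
  have hsucc : ∃ y, y ⋖ (S.T ^ (h + 1)) ap := by
    rcases S.split.exists_pred (u := (S.T ^ (h + 1)) ap) (by rw [S.sg_pow, sp]) with hm | hm
    · exfalso
      rcases (show h + 1 ≤ t by omega).eq_or_lt with e | e
      · rw [e] at hm
        exact absurd hq (not_lt.2 (hm q))
      · exact hlast (h + 1) (by omega) e (S.l_of_isMin hm)
    · exact hm
  obtain ⟨y, hy⟩ := hsucc
  obtain ⟨i, rfl⟩ := S.inv.r_of_covBy_l (j := j) (x := y) (e1 ▸ hy)
  refine ⟨h, hht, i, fun s => ?_⟩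
  induction s with
  | zero => intro _; simpa using hy
  | succ s ih =>
    intro hs
    have h1 := ih (by omega)
    have h2 := S.covBy_T h1 (fun j hj => hlast (h + 1 + s) (by omega) (by omega) ⟨j, hj⟩)
    rwa [← Equiv.Perm.mul_apply, ← pow_succ', ← Equiv.Perm.mul_apply, ← pow_succ'] at h2

theorem dual_pow (n : ℕ) (x : X) :
    (S.dual.T ^ n) (OrderDual.toDual x) = OrderDual.toDual ((S.T ^ n) x) := by
  induction n with
  | zero => rfl
  | succ n ih => rw [pow_succ', Equiv.Perm.mul_apply, ih, pow_succ', Equiv.Perm.mul_apply]; rfl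

theorem dual_inv_pow (n : ℕ) (x : X) :
    (S.dual.T⁻¹ ^ n) (OrderDual.toDual x) = OrderDual.toDual ((S.T⁻¹ ^ n) x) := by
  induction n with
  | zero => rfl
  | succ n ih => rw [pow_succ', Equiv.Perm.mul_apply, ih, pow_succ', Equiv.Perm.mul_apply]; rfl

section Topology

variable [TopologicalSpace X]

/-- The number of endpoint germs whose backward or forward orbit visits `x`. -/
noncomputable def cnt (x : X) : ℕ :=
  (visitors S.T⁻¹ S.l x).card + (visitors S.T⁻¹ S.r x).card +
    (visitors S.T S.l x).card + (visitors S.T S.r x).card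

theorem visitors_T {f : Equiv.Perm X} (hf : f = S.T ∨ f = S.T⁻¹) (e : Fin d → X) (x : X) :
    visitors f (fun i => S.T (e i)) x = visitors f e x := by
  ext j
  rw [mem_visitors, mem_visitors, visits_T_right hf]

theorem visitors_inv_l (x : X) : visitors S.inv.T⁻¹ S.inv.l x = visitors S.T S.l x := by
  rw [S.inv_T, inv_inv]
  exact S.visitors_T (Or.inl rfl) _ x

theorem visitors_inv_r (x : X) : visitors S.inv.T⁻¹ S.inv.r x = visitors S.T S.r x := by
  rw [S.inv_T, inv_inv]
  exact S.visitors_T (Or.inl rfl) _ x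

/-- Inversion exchanges forward and backward ends, and moving the endpoints by `T` does not change
what their orbits accumulate at. -/
theorem cnt_inv (x : X) : S.inv.cnt x = S.cnt x := by
  have h3 : visitors S.inv.T S.inv.l x = visitors S.T⁻¹ S.l x := S.visitors_T (Or.inr rfl) _ x
  have h4 : visitors S.inv.T S.inv.r x = visitors S.T⁻¹ S.r x := S.visitors_T (Or.inr rfl) _ x
  unfold cnt
  rw [S.visitors_inv_l, S.visitors_inv_r, h3, h4]
  omega

theorem visits_dual {x g : X} :
    Visits S.dual.T (OrderDual.toDual x) (OrderDual.toDual g) ↔ Visits S.T x g := by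
  unfold Visits
  simp only [S.dual_pow]
  exact Iff.rfl

theorem visits_dual_inv {x g : X} :
    Visits S.dual.T⁻¹ (OrderDual.toDual x) (OrderDual.toDual g) ↔ Visits S.T⁻¹ x g := by
  unfold Visits
  simp only [S.dual_inv_pow]
  exact Iff.rfl

theorem cnt_dual (x : X) : S.dual.cnt (OrderDual.toDual x) = S.cnt x := by
  have h1 : visitors S.dual.T S.dual.l (OrderDual.toDual x) = visitors S.T S.r x := by
    ext j; rw [mem_visitors, mem_visitors]; exact S.visits_dual
  have h2 : visitors S.dual.T S.dual.r (OrderDual.toDual x) = visitors S.T S.l x := by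
    ext j; rw [mem_visitors, mem_visitors]; exact S.visits_dual
  have h3 : visitors S.dual.T⁻¹ S.dual.l (OrderDual.toDual x) = visitors S.T⁻¹ S.r x := by
    ext j; rw [mem_visitors, mem_visitors]; exact S.visits_dual_inv
  have h4 : visitors S.dual.T⁻¹ S.dual.r (OrderDual.toDual x) = visitors S.T⁻¹ S.l x := by
    ext j; rw [mem_visitors, mem_visitors]; exact S.visits_dual_inv
  unfold cnt
  rw [h1, h2, h3, h4]
  omega

/-- Moving along the orbit does not change the count. -/
theorem cnt_pow [OrderTopology X] (n : ℕ) (x : X) : S.cnt ((S.T ^ n) x) = S.cnt x := by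
  have key : ∀ f : Equiv.Perm X, (f = S.T ∨ f = S.T⁻¹) → ∀ e : Fin d → X,
      visitors f e ((S.T ^ n) x) = visitors f e x := by
    intro f hf e
    ext j
    rw [mem_visitors, mem_visitors, visits_pow_left hf]
  unfold cnt
  rw [key _ (Or.inr rfl), key _ (Or.inr rfl), key _ (Or.inl rfl), key _ (Or.inl rfl)]

end Topology

/-- The combinatorial count behind `eight_le_cnt`: `BL`, `BR`, `FL`, `FR` are any sets of indices
that contain every endpoint whose backward, respectively forward, orbit meets `[u, v]`. -/
theorem eight_le_of_gap {u v am ap : X} {j₀ j₁ : Fin d} (hl₀ : ap = S.l j₀) (hr₁ : am = S.r j₁)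
    {BL BR FL FR : Finset (Fin d)}
    (hBL : ∀ j (i : ℕ), ((S.T⁻¹) ^ i) (S.l j) ∈ Icc u v → j ∈ BL)
    (hBR : ∀ j (i : ℕ), ((S.T⁻¹) ^ i) (S.r j) ∈ Icc u v → j ∈ BR)
    (hFL : ∀ j (i : ℕ), (S.T ^ i) (S.l j) ∈ Icc u v → j ∈ FL)
    (hFR : ∀ j (i : ℕ), (S.T ^ i) (S.r j) ∈ Icc u v → j ∈ FR)
    (hu : ∃ n : ℕ, ((S.T⁻¹) ^ n) ap = u) (hv : ∃ m : ℕ, ((S.T⁻¹) ^ m) am = v)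
    (hinj : ∀ h : ℕ, 0 < h → (S.T ^ h) ap ≠ ap ∧ (S.T ^ h) am ≠ am)
    (hadj : ∀ h : ℕ, 0 < h → ¬ (S.T ^ h) am ⋖ u ∧ ¬ v ⋖ (S.T ^ h) ap)
    {t : ℕ} (ht : 0 < t) (hb : (S.T ^ t) am ∈ Icc u v) (hc : (S.T ^ t) ap ∈ Icc u v)
    (hbc : (S.T ^ t) am < (S.T ^ t) ap)
    (hout : ∀ h : ℕ, 0 < h → h < t → (S.T ^ h) ap ∉ Icc u v ∧ (S.T ^ h) am ∉ Icc u v)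
    (hgap : ∀ x ∈ Icc u v, ∀ i : ℕ, 0 < i → (S.T ^ i) x ∈ Icc u v →
      (S.T ^ i) x ≤ (S.T ^ t) am ∨ (S.T ^ t) ap ≤ (S.T ^ i) x)
    (hflip : ∃ h : ℕ, 0 < h ∧ h < t ∧ (S.T ^ h) ap < (S.T ^ h) am) :
    8 ≤ BL.card + BR.card + FL.card + FR.card := by
  classical
  obtain ⟨n, hn⟩ := hu
  obtain ⟨m, hm⟩ := hv
  have huv : u ≤ v := hb.1.trans hb.2
  have sp : sg ap = true := hl₀ ▸ S.sg_l j₀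
  have sm : sg am = false := hr₁ ▸ S.sg_r j₁
  -- The endpoints lying on the two orbits before time `t`. Each counts twice: its backward orbit
  -- passes through `u` or `v`, and its forward orbit through the return at time `t`.
  let A : Finset (Fin d) := {j | ∃ h < t, S.l j = (S.T ^ h) ap}
  let B : Finset (Fin d) := {j | ∃ h < t, S.r j = (S.T ^ h) am}
  have memA : ∀ {j}, j ∈ A ↔ ∃ h < t, S.l j = (S.T ^ h) ap := by simp [A]
  have memB : ∀ {j}, j ∈ B ↔ ∃ h < t, S.r j = (S.T ^ h) am := by simp [B]
  have back : ∀ (h n : ℕ) (y : X), ((S.T⁻¹) ^ (n + h)) ((S.T ^ h) y) = ((S.T⁻¹) ^ n) y := by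
    intro h n y
    rw [pow_add, Equiv.Perm.mul_apply, S.inv_pow_apply_pow]
  have fwd : ∀ (h : ℕ) (y : X), h ≤ t → (S.T ^ (t - h)) ((S.T ^ h) y) = (S.T ^ t) y := by
    intro h y hh
    rw [← Equiv.Perm.mul_apply, ← pow_add, Nat.sub_add_cancel hh]
  have hABL : A ⊆ BL := fun j hj => by
    obtain ⟨h, -, e⟩ := memA.1 hj
    exact hBL j (n + h) (by rw [e, back, hn]; exact ⟨le_rfl, huv⟩)
  have hBBR : B ⊆ BR := fun j hj => by
    obtain ⟨h, -, e⟩ := memB.1 hj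
    exact hBR j (m + h) (by rw [e, back, hm]; exact ⟨huv, le_rfl⟩)
  have hAFL : A ⊆ FL := fun j hj => by
    obtain ⟨h, hh, e⟩ := memA.1 hj
    exact hFL j (t - h) (by rw [e, fwd h _ hh.le]; exact hc)
  have hBFR : B ⊆ FR := fun j hj => by
    obtain ⟨h, hh, e⟩ := memB.1 hj
    exact hFR j (t - h) (by rw [e, fwd h _ hh.le]; exact hb)
  have hj₀ : j₀ ∈ A := memA.2 ⟨0, ht, hl₀.symm⟩
  have hj₁ : j₁ ∈ B := memB.2 ⟨0, ht, hr₁.symm⟩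
  have retA : ∀ {j}, j ∈ A → ∃ s, S.FirstReturn (Icc u v) (S.l j) s ∧
      (S.T ^ s) (S.l j) = (S.T ^ t) ap := by
    intro j hj
    obtain ⟨h, hh, e⟩ := memA.1 hj
    refine ⟨t - h, ⟨by omega, ?_, fun i h0 h1 => ?_⟩, ?_⟩
    · rw [e, fwd h _ hh.le]; exact hc
    · rw [e, ← Equiv.Perm.mul_apply, ← pow_add]
      exact (hout (i + h) (by omega) (by omega)).1
    · rw [e, fwd h _ hh.le]
  have retB : ∀ {j}, j ∈ B → ∃ s, S.FirstReturn (Icc u v) (S.r j) s ∧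
      (S.T ^ s) (S.r j) = (S.T ^ t) am := by
    intro j hj
    obtain ⟨h, hh, e⟩ := memB.1 hj
    refine ⟨t - h, ⟨by omega, ?_, fun i h0 h1 => ?_⟩, ?_⟩
    · rw [e, fwd h _ hh.le]; exact hb
    · rw [e, ← Equiv.Perm.mul_apply, ← pow_add]
      exact (hout (i + h) (by omega) (by omega)).2
    · rw [e, fwd h _ hh.le]
  have cBL := Finset.card_le_card hABL
  have cBR := Finset.card_le_card hBBR
  by_cases hadjbc : (S.T ^ t) am ⋖ (S.T ^ t) ap
  · -- both orbits meet a second endpoint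
    have cFL := Finset.card_le_card hAFL
    have cFR := Finset.card_le_card hBFR
    suffices h2 : ∃ h, 0 < h ∧ h < t ∧ (∃ j, S.l j = (S.T ^ h) ap) ∧ ∃ j, S.r j = (S.T ^ h) am by
      obtain ⟨h, h0, h1, ⟨j, hj⟩, ⟨j', hj'⟩⟩ := h2
      have n1 : j₀ ≠ j := by
        rintro rfl
        exact (hinj h h0).1 (hj.symm.trans hl₀.symm)
      have n2 : j₁ ≠ j' := by
        rintro rfl
        exact (hinj h h0).2 (hj'.symm.trans hr₁.symm)
      have a2 : 1 < A.card := Finset.one_lt_card.2 ⟨j₀, hj₀, j, memA.2 ⟨h, h1, hj⟩, n1⟩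
      have b2 : 1 < B.card := Finset.one_lt_card.2 ⟨j₁, hj₁, j', memB.2 ⟨h, h1, hj'⟩, n2⟩
      omega
    by_contra hno
    push Not at hno
    -- Without a simultaneous second pair of endpoints, the jump at time `t` pulls back to jumps at
    -- all times in `(0, t)`, which contradicts the reversed order in `hflip`.
    have desc : ∀ s, s < t → (S.T ^ (t - s)) am ⋖ (S.T ^ (t - s)) ap := by
      intro s
      induction s with
      | zero => intro _; simpa using hadjbc
      | succ s ih =>
        intro hs
        have h1 := ih (by omega)
        obtain ⟨e, he, e0⟩ : ∃ e, t - s = e + 1 ∧ 0 < e := ⟨t - s - 1, by omega, by omega⟩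
        have he' : t - (s + 1) = e := by omega
        rw [he'] at *
        rw [he, pow_succ', Equiv.Perm.mul_apply, Equiv.Perm.mul_apply] at h1
        have h2 := S.inv.covBy_T h1 (fun j hj => by
          have e1 := S.T.injective hj
          rw [hj] at h1
          obtain ⟨i, hi⟩ := S.inv.r_of_covBy_l h1
          exact hno e e0 (by omega) ⟨j, e1.symm⟩ i (S.T.injective hi).symm)
        simpa using h2
    obtain ⟨h, h0, h1, h2⟩ := hflip
    have := desc (t - h) (by omega)
    rw [show t - (t - h) = h by omega] at this
    exact absurd this.lt (not_lt.2 h2.le)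
  · obtain ⟨h₁, hh₁, jl, hjl⟩ := S.exists_left_endpoint_of_succ ht ⟨j₁, hr₁⟩ sm hbc
    obtain ⟨h₂, hh₂, jr, hjr⟩ := S.exists_right_endpoint_of_pred ht ⟨j₀, hl₀⟩ sp hbc
    have retl : S.FirstReturn (Icc u v) (S.l jl) (t - h₁) := by
      refine ⟨by omega, ?_, fun i h0 h1 hmem => ?_⟩
      · have h3 := hjl (t - h₁ - 1) (by omega)
        rw [show h₁ + 1 + (t - h₁ - 1) = t by omega, show t - h₁ - 1 + 1 = t - h₁ by omega] at h3
        exact ⟨hb.1.trans h3.le, (h3.ge_of_gt hbc).trans hc.2⟩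
      · have h3 := hjl (i - 1) (by omega)
        rw [show h₁ + 1 + (i - 1) = h₁ + i by omega, show i - 1 + 1 = i by omega] at h3
        have h4 := (hout (h₁ + i) (by omega) (by omega)).2
        rcases hmem.1.eq_or_lt with e | e
        · rw [← e] at h3
          exact (hadj (h₁ + i) (by omega)).1 h3
        · exact h4 ⟨h3.le_of_lt e, h3.le.trans hmem.2⟩
    have covl : (S.T ^ t) am ⋖ (S.T ^ (t - h₁)) (S.l jl) := by
      have h3 := hjl (t - h₁ - 1) (by omega)
      rwa [show h₁ + 1 + (t - h₁ - 1) = t by omega, show t - h₁ - 1 + 1 = t - h₁ by omega] at h3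
    have retr : S.FirstReturn (Icc u v) (S.r jr) (t - h₂) := by
      refine ⟨by omega, ?_, fun i h0 h1 hmem => ?_⟩
      · have h3 := hjr (t - h₂ - 1) (by omega)
        rw [show h₂ + 1 + (t - h₂ - 1) = t by omega, show t - h₂ - 1 + 1 = t - h₂ by omega] at h3
        exact ⟨hb.1.trans (h3.le_of_lt hbc), h3.le.trans hc.2⟩
      · have h3 := hjr (i - 1) (by omega)
        rw [show h₂ + 1 + (i - 1) = h₂ + i by omega, show i - 1 + 1 = i by omega] at h3
        have h4 := (hout (h₂ + i) (by omega) (by omega)).1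
        rcases hmem.2.eq_or_lt with e | e
        · rw [e] at h3
          exact (hadj (h₂ + i) (by omega)).2 h3
        · exact h4 ⟨hmem.1.trans h3.le, h3.ge_of_gt e⟩
    have covr : (S.T ^ (t - h₂)) (S.r jr) ⋖ (S.T ^ t) ap := by
      have h3 := hjr (t - h₂ - 1) (by omega)
      rwa [show h₂ + 1 + (t - h₂ - 1) = t by omega, show t - h₂ - 1 + 1 = t - h₂ by omega] at h3
    have hjlA : jl ∉ A := fun hj => by
      obtain ⟨s, hs, e⟩ := retA hj
      rw [hs.unique retl] at e
      exact hadjbc (e ▸ covl)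
    have hjrB : jr ∉ B := fun hj => by
      obtain ⟨s, hs, e⟩ := retB hj
      rw [hs.unique retr] at e
      exact hadjbc (e ▸ covr)
    have hjlF : jl ∈ FL := hFL jl _ retl.2.1
    have hjrF : jr ∈ FR := hFR jr _ retr.2.1
    have cFL : A.card + 1 ≤ FL.card := by
      rw [← Finset.card_insert_of_notMem hjlA]
      exact Finset.card_le_card (Finset.insert_subset hjlF hAFL)
    have cFR : B.card + 1 ≤ FR.card := by
      rw [← Finset.card_insert_of_notMem hjrB]
      exact Finset.card_le_card (Finset.insert_subset hjrF hBFR)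
    have a1 : 0 < A.card := Finset.card_pos.2 ⟨j₀, hj₀⟩
    have b1 : 0 < B.card := Finset.card_pos.2 ⟨j₁, hj₁⟩
    -- The count so far is `2 (|A| + |B|) + 2`. It falls short of eight only when `|A| = |B| = 1`.
    by_cases hAB : 3 ≤ A.card + B.card
    · omega
    have hA1 : A = {j₀} := by
      obtain ⟨a, ha⟩ := Finset.card_eq_one.1 (show A.card = 1 by omega)
      rw [ha, Finset.mem_singleton] at hj₀
      rw [ha, hj₀]
    have hB1 : B = {j₁} := by
      obtain ⟨a, ha⟩ := Finset.card_eq_one.1 (show B.card = 1 by omega)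
      rw [ha, Finset.mem_singleton] at hj₁
      rw [ha, hj₁]
    have noL : ∀ h, 0 < h → h < t → ∀ j, S.l j ≠ (S.T ^ h) ap := by
      intro h h0 h1 j e
      have : j ∈ A := memA.2 ⟨h, h1, e⟩
      rw [hA1, Finset.mem_singleton] at this
      subst this
      exact (hinj h h0).1 (e.symm.trans hl₀.symm)
    have noR : ∀ h, 0 < h → h < t → ∀ j, S.r j ≠ (S.T ^ h) am := by
      intro h h0 h1 j e
      have : j ∈ B := memB.2 ⟨h, h1, e⟩
      rw [hB1, Finset.mem_singleton] at this
      subst this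
      exact (hinj h h0).2 (e.symm.trans hr₁.symm)
    by_contra hlt8
    -- an endpoint that enters `(b, c)` away from `succ b` and `pred c` would finish the count
    have strict : ∀ j i s, (S.T ^ t) am < (S.T ^ (s + 1)) (S.r i) →
        (S.T ^ (s + 1)) (S.r i) < (S.T ^ (s + 1)) (S.l j) →
        (S.T ^ (s + 1)) (S.l j) < (S.T ^ t) ap → False := by
      intro j i s g1 g2 g3
      -- By `hgap`, no point of `[u, v]` ever lands strictly between `T ^ t am` and `T ^ t ap`, so
      -- an orbit found there cannot have visited `[u, v]` at an earlier positive time.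
      have ret : ∀ y, (S.T ^ t) am < (S.T ^ (s + 1)) y → (S.T ^ (s + 1)) y < (S.T ^ t) ap →
          S.FirstReturn (Icc u v) y (s + 1) := by
        intro y y1 y2
        have hy : (S.T ^ (s + 1)) y ∈ Icc u v := ⟨hb.1.trans y1.le, y2.le.trans hc.2⟩
        refine ⟨by omega, hy, fun k k0 k1 hk => ?_⟩
        have e : (S.T ^ (s + 1 - k)) ((S.T ^ k) y) = (S.T ^ (s + 1)) y := by
          rw [← Equiv.Perm.mul_apply, ← pow_add, Nat.sub_add_cancel k1.le]
        rcases hgap _ hk (s + 1 - k) (by omega) (e ▸ hy) with h | h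
        · rw [e] at h
          exact absurd y1 (not_lt.2 h)
        · rw [e] at h
          exact absurd y2 (not_lt.2 h)
      have rj := ret _ (g1.trans g2) g3
      have ri := ret _ g1 (g2.trans g3)
      have jne : j ∉ insert jl A := by
        rw [Finset.mem_insert, not_or]
        refine ⟨?_, fun hj => ?_⟩
        · rintro rfl
          rw [← rj.unique retl] at covl
          exact covl.2 g1 g2
        · obtain ⟨k, hk, e⟩ := retA hj
          rw [hk.unique rj] at e
          exact absurd g3 (e ▸ lt_irrefl _)
      have ine : i ∉ insert jr B := by
        rw [Finset.mem_insert, not_or]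
        refine ⟨?_, fun hj => ?_⟩
        · rintro rfl
          rw [← ri.unique retr] at covr
          exact covr.2 g2 g3
        · obtain ⟨k, hk, e⟩ := retB hj
          rw [hk.unique ri] at e
          exact absurd g1 (e ▸ lt_irrefl _)
      have c1 := Finset.card_le_card (Finset.insert_subset (hFL j _ rj.2.1)
        (Finset.insert_subset hjlF hAFL))
      have c2 := Finset.card_le_card (Finset.insert_subset (hFR i _ ri.2.1)
        (Finset.insert_subset hjrF hBFR))
      rw [Finset.card_insert_of_notMem jne, Finset.card_insert_of_notMem hjlA] at c1
      rw [Finset.card_insert_of_notMem ine, Finset.card_insert_of_notMem hjrB] at c2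
      omega
    -- The interval between the two germs is pulled back from time `t`. A border between image
    -- pieces inside it would yield a pair of endpoints excluded by `strict`, so it is never cut and
    -- the order persists, against `hflip`.
    have desc : ∀ s, s < t → (S.T ^ (t - s)) am < (S.T ^ (t - s)) ap ∧
        S.Uncut s ((S.T ^ (t - s)) am) ((S.T ^ (t - s)) ap) := by
      intro s
      induction s with
      | zero =>
        intro _
        refine ⟨by simpa using hbc, fun i hi => absurd hi (by omega)⟩
      | succ s ih =>
        intro hs
        obtain ⟨h1, h2⟩ := ih (by omega)
        obtain ⟨e, he, e0⟩ : ∃ e, t - s = e + 1 ∧ 0 < e := ⟨t - s - 1, by omega, by omega⟩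
        have he' : t - (s + 1) = e := by omega
        have hst : s + (e + 1) = t := by omega
        rw [he']
        rw [he] at h1 h2
        have hsp : ∀ j, ¬ ((S.T ^ (e + 1)) am < S.inv.l j ∧ S.inv.l j ≤ (S.T ^ (e + 1)) ap) := by
          rintro j ⟨g1, g2⟩
          obtain ⟨p, hp, hp'⟩ := S.split.pred_of_lt (S.inv.sg_l j) g1
          obtain ⟨i, rfl⟩ := S.inv.r_of_covBy_l hp
          have g2' : S.inv.l j < (S.T ^ (e + 1)) ap := by
            refine g2.lt_of_ne fun h => ?_
            rw [pow_succ', Equiv.Perm.mul_apply] at h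
            exact noL e e0 (by omega) j (S.T.injective h)
          have g1' : (S.T ^ (e + 1)) am < S.inv.r i := by
            refine hp'.lt_of_ne fun h => ?_
            rw [pow_succ', Equiv.Perm.mul_apply] at h
            exact noR e e0 (by omega) i (S.T.injective h).symm
          have k1 := h2.lt le_rfl g1' (hp.le.trans g2)
          have k2 := h2.lt g1'.le hp.lt g2
          have k3 := h2.lt (g1'.le.trans hp.le) g2' le_rfl
          rw [← Equiv.Perm.mul_apply, ← pow_add, hst] at k1 k3
          simp only [inv_l, inv_r] at k1 k2 k3
          rw [← Equiv.Perm.mul_apply, ← pow_succ] at k1 k2 k3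
          rw [← Equiv.Perm.mul_apply, ← pow_succ] at k2
          exact strict j i s k1 k2 k3
        obtain ⟨i, i1, i2⟩ := S.inv.same_piece hsp
        have i1' : S.T (S.l i) ≤ S.T ((S.T ^ e) am) := by
          rw [← Equiv.Perm.mul_apply, ← pow_succ']; exact i1
        have i2' : S.T ((S.T ^ e) ap) ≤ S.T (S.r i) := by
          rw [← Equiv.Perm.mul_apply, ← pow_succ']; exact i2
        rw [pow_succ', Equiv.Perm.mul_apply, Equiv.Perm.mul_apply] at h1
        have hlt := S.inv.mono (i := i) i1' h1 i2'
        simp only [inv_T, Equiv.Perm.inv_def, Equiv.symm_apply_apply] at hlt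
        have m1 := S.img i1' (h1.le.trans i2')
        have m2 := S.img (i1'.trans h1.le) i2'
        refine ⟨hlt, fun k hk x x1 x2 j hj => ?_⟩
        have y1 : (S.T ^ (e + 1)) am < S.T x := by
          rw [pow_succ', Equiv.Perm.mul_apply]
          exact S.mono m1.1 x1 (x2.trans m2.2)
        have y2 : S.T x ≤ (S.T ^ (e + 1)) ap := by
          rw [pow_succ', Equiv.Perm.mul_apply]
          exact S.monoLE (m1.1.trans x1.le) x2 m2.2
        cases k with
        | zero =>
          have hj' : x = S.l j := hj
          exact hsp j ⟨by rw [inv_l, ← hj']; exact y1, by rw [inv_l, ← hj']; exact y2⟩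
        | succ k =>
          rw [pow_succ, Equiv.Perm.mul_apply] at hj
          exact h2 k (by omega) (S.T x) y1 y2 j hj
    obtain ⟨h, h0, h1, h2⟩ := hflip
    have := (desc (t - h) (by omega)).1
    rw [show t - (t - h) = h by omega] at this
    exact absurd this (not_lt.2 h2.le)

end Exchange

end GIET

/-! ### Eight ends for a non-periodic recurrent germ -/

namespace GIET

/-- A periodic orbit accumulates only at its own points, which are periodic. -/
theorem not_periodic_of_visits {X : Type*} [LinearOrder X] [TopologicalSpace X] [OrderTopology X]
    {f : Equiv.Perm X} {x g : X}
    (hx : ∀ n : ℕ, 0 < n → (f ^ n) x ≠ x) (h : Visits f x g) (n : ℕ) (hn : 0 < n) :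
    (f ^ n) g ≠ g := by
  intro e
  obtain ⟨m, rfl⟩ := Exchange.mem_orbit_of_visits_periodic hn e h
  refine hx n hn ?_
  rw [← Equiv.Perm.mul_apply, ← pow_add, add_comm, pow_add, Equiv.Perm.mul_apply, e]

/-- Near a recurrent point, every orbit that passes is one that accumulates. -/
theorem eventually_visits {X : Type*} [TopologicalSpace X] [T1Space X] {f : Equiv.Perm X} {x : X}
    (hx : Visits f x x) (g : X) : ∀ᶠ y in 𝓝 x, ∀ i : ℕ, (f ^ i) g = y → Visits f x g := by
  by_cases hv : Visits f x g
  · exact Eventually.of_forall fun _ _ _ => hv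
  have hv' := hv
  unfold Visits at hv'
  rw [mapClusterPt_iff_frequently] at hv'
  push Not at hv'
  obtain ⟨s, hs, hev⟩ := hv'
  obtain ⟨N, hN⟩ := eventually_atTop.1 hev
  have h2 : ∀ᶠ y in 𝓝 x, ∀ i ∈ Finset.range N, (f ^ i) g ≠ y := by
    rw [Filter.eventually_all_finset]
    intro i _
    have : (f ^ i) g ≠ x := fun e => hv ((visits_pow_iff i).1 (e.symm ▸ hx))
    exact (eventually_ne_nhds this.symm).mono fun y hy => Ne.symm hy
  filter_upwards [hs, h2] with y hy h2y i hi
  exfalso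
  rcases lt_or_ge i N with h | h
  · exact h2y i (Finset.mem_range.2 h) hi
  · exact hN i h (hi ▸ hy)

namespace Exchange

variable {X : Type*} [LinearOrder X] {sg : X → Bool} {d : ℕ} (S : Exchange X sg d)
theorem finite_times {f : Equiv.Perm X} {g : X} (hg : ∀ n : ℕ, 0 < n → (f ^ n) g ≠ g) :
    {h : ℕ | ∃ j, (f ^ h) g = S.l j}.Finite := by
  have hinj : Function.Injective fun h : ℕ => (f ^ h) g := fun a b e => by
    have := injective_zpow_apply hg (a₁ := (a : ℤ)) (a₂ := (b : ℤ)) (by simpa using e)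
    omega
  refine Finite.of_finite_image ((finite_range S.l).subset ?_) hinj.injOn
  rintro _ ⟨h, ⟨j, hj⟩, rfl⟩
  exact ⟨j, hj.symm⟩

variable [TopologicalSpace X]

/-- `l j` is the first left endpoint on its orbit, and its backward orbit visits `x`. -/
def IsFirst (x : X) (j : Fin d) : Prop :=
  Visits S.T⁻¹ x (S.l j) ∧ ∀ i : ℕ, 0 < i → ∀ j', ((S.T⁻¹) ^ i) (S.l j) ≠ S.l j'

/-- If `l j` were the minimum it would also be the image of a left endpoint, which would precede it
on its orbit. -/
theorem IsFirst.exists_pred {S : Exchange X sg d} {x : X} {j : Fin d} (h : S.IsFirst x j) :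
    ∃ i, S.r i ⋖ S.l j := by
  rcases S.split.exists_pred (S.sg_l j) with hm | ⟨v, hv⟩
  · obtain ⟨j', hj'⟩ := S.inv.l_of_isMin hm
    exact absurd (by rw [hj']; simp) (h.2 1 one_pos j')
  · obtain ⟨i, rfl⟩ := S.r_of_covBy_l hv
    exact ⟨i, hv⟩

variable [OrderTopology X]

theorem exists_isFirst {x : X} (hper : ∀ n : ℕ, 0 < n → (S.T ^ n) x ≠ x) {j : Fin d}
    (h : Visits S.T⁻¹ x (S.l j)) : ∃ j₀, S.IsFirst x j₀ ∧ ∃ h : ℕ, S.l j = (S.T ^ h) (S.l j₀) := by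
  have hnp := not_periodic_of_visits (S.inv_ne_of_pow_ne hper) h
  obtain ⟨h₀, ⟨j₀, hj₀⟩, hmax⟩ := Set.exists_max_image _ id (S.finite_times hnp) ⟨0, j, rfl⟩
  refine ⟨j₀, ⟨?_, fun i hi j' e => ?_⟩, h₀, ?_⟩
  · rw [← hj₀, visits_pow_iff]
    exact h
  · rw [← hj₀, ← Equiv.Perm.mul_apply, ← pow_add] at e
    have := hmax (i + h₀) ⟨j', e⟩
    simp only [id] at this
    omega
  · rw [← hj₀, S.pow_apply_inv_pow]

/-- All left endpoints with backward orbits accumulating at `x` lie on the forward orbit of the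
first one, so near `x` its jump is the only source of cuts. If there is no such endpoint, the jump
at `x`, moved past all left endpoints on its orbit, takes this role; it never breaks, which is
incompatible with the reversal found in `exists_return_gap`. -/
theorem eight_le_cnt_of_unique {x : X} (hx : Visits S.T x x)
    (hper : ∀ n : ℕ, 0 < n → (S.T ^ n) x ≠ x) (sx : sg x = true)
    (huniq : ∀ j j', S.IsFirst x j → S.IsFirst x j' → j = j') : 8 ≤ S.cnt x := by
  classical
  -- move `x` past all left endpoints on its orbit
  obtain ⟨N, hN⟩ := (S.finite_times hper).bddAbove
  rw [← S.cnt_pow (N + 1)]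
  have hfut : ∀ (h : ℕ) j, (S.T ^ h) ((S.T ^ (N + 1)) x) ≠ S.l j := by
    intro h j e
    rw [← Equiv.Perm.mul_apply, ← pow_add] at e
    have := hN ⟨j, e⟩
    omega
  have hx' : Visits S.T ((S.T ^ (N + 1)) x) ((S.T ^ (N + 1)) x) :=
    (visits_pow_left (Or.inl rfl) _).2 ((visits_pow_right (Or.inl rfl) _).2 hx)
  have hper' := not_periodic_of_visits hper ((visits_pow_right (Or.inl rfl) (N + 1)).2 hx)
  have sx' : sg ((S.T ^ (N + 1)) x) = true := by rw [S.sg_pow, sx]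
  have huniq' : ∀ j j', S.IsFirst ((S.T ^ (N + 1)) x) j → S.IsFirst ((S.T ^ (N + 1)) x) j' →
      j = j' := fun j j' h h' => huniq j j' ⟨(visits_pow_left (Or.inr rfl) _).1 h.1, h.2⟩
    ⟨(visits_pow_left (Or.inr rfl) _).1 h'.1, h'.2⟩
  generalize (S.T ^ (N + 1)) x = z at *
  have hzi := S.visits_inv_self hx'
  have ev : ∀ᶠ y in 𝓝 z, ∀ j, (∀ i : ℕ, ((S.T⁻¹) ^ i) (S.l j) = y → Visits S.T⁻¹ z (S.l j)) ∧
      (∀ i : ℕ, ((S.T⁻¹) ^ i) (S.r j) = y → Visits S.T⁻¹ z (S.r j)) ∧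
      (∀ i : ℕ, (S.T ^ i) (S.l j) = y → Visits S.T z (S.l j)) ∧
      (∀ i : ℕ, (S.T ^ i) (S.r j) = y → Visits S.T z (S.r j)) := by
    refine eventually_all.2 fun j => ?_
    filter_upwards [eventually_visits hzi (S.l j), eventually_visits hzi (S.r j),
      eventually_visits hx' (S.l j), eventually_visits hx' (S.r j)] with y h1 h2 h3 h4
    exact ⟨h1, h2, h3, h4⟩
  by_cases hex : ∃ j₀, S.IsFirst z j₀
  · obtain ⟨j₀, hj₀⟩ := hex
    obtain ⟨j₁, hj₁⟩ := hj₀.exists_pred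
    have hH : ∀ j, ∃ H : ℕ, Visits S.T⁻¹ z (S.l j) → S.l j = (S.T ^ H) (S.l j₀) := by
      intro j
      by_cases hv : Visits S.T⁻¹ z (S.l j)
      · obtain ⟨j', hj', h, hh⟩ := S.exists_isFirst hper' hv
        rw [huniq' j' j₀ hj' hj₀] at hh
        exact ⟨h, fun _ => hh⟩
      · exact ⟨0, fun h => absurd h hv⟩
    choose H hH using hH
    -- Keeps away from `z` the part of each backward orbit before it reaches `l j₀`; `hfut` makes
    -- this possible. This supplies the bound `h ≤ i` required by `exists_return_gap`.
    have ev2 : ∀ᶠ y in 𝓝 z, ∀ j, ∀ i ∈ Finset.range (H j), ((S.T⁻¹) ^ i) (S.l j) ≠ y := by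
      refine eventually_all.2 fun j => ?_
      rw [Filter.eventually_all_finset]
      intro i _
      have : ((S.T⁻¹) ^ i) (S.l j) ≠ z := fun e => hfut i j (by rw [← e, S.pow_apply_inv_pow])
      exact (eventually_ne_nhds this.symm).mono fun y hy => Ne.symm hy
    obtain ⟨u, v, hJU, hu, hv, hinj, hadj, t, ht, hb, hc, hbc, hout, hgap, hflip⟩ :=
      S.exists_return_gap hx' hper' sx' hj₁ hj₀.2 hj₀.1 (inter_mem ev ev2) (by
        rintro j i ⟨h1, h2⟩
        have h3 := hH j ((h1 j).1 i rfl)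
        refine ⟨H j, ?_, h3⟩
        by_contra hcon
        exact h2 j i (Finset.mem_range.2 (by omega)) rfl)
    exact S.eight_le_of_gap rfl rfl
      (fun j i h => mem_visitors.2 (((hJU h).1 j).1 i rfl))
      (fun j i h => mem_visitors.2 (((hJU h).1 j).2.1 i rfl))
      (fun j i h => mem_visitors.2 (((hJU h).1 j).2.2.1 i rfl))
      (fun j i h => mem_visitors.2 (((hJU h).1 j).2.2.2 i rfl))
      hu hv hinj hadj ht hb hc hbc hout hgap hflip
  · exfalso
    have hno : ∀ j, ¬ Visits S.T⁻¹ z (S.l j) := fun j hv => by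
      obtain ⟨j', hj', -⟩ := S.exists_isFirst hper' hv
      exact hex ⟨j', hj'⟩
    obtain ⟨zm, hzm⟩ : ∃ zm, zm ⋖ z := by
      rcases S.split.exists_pred sx' with hm | hm
      · obtain ⟨j, hj⟩ := S.l_of_isMin hm
        exact absurd (hj ▸ hzi) (hno j)
      · exact hm
    obtain ⟨u, v, -, -, -, -, -, t, -, -, -, -, -, -, h, -, -, hflip⟩ :=
      S.exists_return_gap hx' hper' sx' hzm (fun i _ j e => hno j (by
        rw [← e, visits_pow_iff]; exact hzi)) hzi ev (fun j i h => absurd ((h j).1 i rfl) (hno j))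
    have hcov : ∀ h : ℕ, (S.T ^ h) zm ⋖ (S.T ^ h) z := by
      intro h
      induction h with
      | zero => exact hzm
      | succ h ih =>
        rw [pow_succ', Equiv.Perm.mul_apply, Equiv.Perm.mul_apply]
        exact S.covBy_T ih fun j => hfut h j
    exact absurd (hcov h).lt (not_lt.2 hflip.le)

/-- Backward iterates of the jump stay jumps, so the lower germ enters `[u, v]` together with the
upper one, unless the latter is exactly `u`; non-periodicity allows that at most once. -/
theorem visits_pred {x am ap : X} (hper : ∀ n : ℕ, 0 < n → (S.T ^ n) x ≠ x) (hcov : am ⋖ ap)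
    (hpast : ∀ i : ℕ, 0 < i → ∀ j, ((S.T⁻¹) ^ i) ap ≠ S.l j) (h : Visits S.T⁻¹ x ap) :
    Visits S.T⁻¹ x am := by
  refine visits_of_exists fun s hs N => ?_
  obtain ⟨u, v, hu, hv, h1, h2, hsub⟩ := S.exists_Icc_subset hs
  have hN : Visits S.T⁻¹ x (((S.T⁻¹) ^ N) ap) := (visits_pow_iff N).2 h
  obtain ⟨n, hn, hne⟩ := hN.exists_ne (not_periodic_of_visits (S.inv_ne_of_pow_ne hper) hN)
    (S.Icc_mem_nhds hu hv h1 h2) u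
  rw [← Equiv.Perm.mul_apply, ← pow_add] at hn hne
  have hc := S.covBy_inv_pow hcov hpast (n + N)
  exact ⟨n + N, by omega, hsub ⟨hc.le_of_lt (hn.1.lt_of_ne hne.symm), hc.le.trans hn.2⟩⟩

theorem two_le_visitors {x : X} (hper : ∀ n : ℕ, 0 < n → (S.T ^ n) x ≠ x)
    (h : ¬ ∀ j j', S.IsFirst x j → S.IsFirst x j' → j = j') :
    2 ≤ (visitors S.T⁻¹ S.l x).card ∧ 2 ≤ (visitors S.T⁻¹ S.r x).card := by
  classical
  push Not at h
  obtain ⟨j, j', hj, hj', hne⟩ := h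
  obtain ⟨i, hi⟩ := hj.exists_pred
  obtain ⟨i', hi'⟩ := hj'.exists_pred
  refine ⟨Finset.one_lt_card.2 ⟨j, mem_visitors.2 hj.1, j', mem_visitors.2 hj'.1, hne⟩,
    Finset.one_lt_card.2 ⟨i, mem_visitors.2 (S.visits_pred hper hi hj.2 hj.1), i',
      mem_visitors.2 (S.visits_pred hper hi' hj'.2 hj'.1), ?_⟩⟩
  rintro rfl
  have e := hi.unique_right hi'
  exact hne (S.uniq le_rfl (S.le j) e.symm.le (e.le.trans (S.le j')))

/-- If the first left endpoint is unique neither for `S` nor for `S.inv`, two jumps in each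
direction of time give two ends of each of the four kinds. -/
theorem eight_le_cnt_of_sg {x : X} (hx : Visits S.T x x)
    (hper : ∀ n : ℕ, 0 < n → (S.T ^ n) x ≠ x) (sx : sg x = true) : 8 ≤ S.cnt x := by
  by_cases h1 : ∀ j j', S.IsFirst x j → S.IsFirst x j' → j = j'
  · exact S.eight_le_cnt_of_unique hx hper sx h1
  by_cases h2 : ∀ j j', S.inv.IsFirst x j → S.inv.IsFirst x j' → j = j'
  · rw [← S.cnt_inv]
    exact S.inv.eight_le_cnt_of_unique (S.visits_inv_self hx) (S.inv_ne_of_pow_ne hper) sx h2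
  have a := S.two_le_visitors hper h1
  have b := S.inv.two_le_visitors (S.inv_ne_of_pow_ne hper) h2
  rw [S.visitors_inv_l, S.visitors_inv_r] at b
  unfold cnt
  omega

/-- A non-periodic recurrent point is visited by at least eight ends of endpoint orbits. -/
theorem eight_le_cnt {x : X} (hx : Visits S.T x x) (hper : ∀ n : ℕ, 0 < n → (S.T ^ n) x ≠ x) :
    8 ≤ S.cnt x := by
  cases sx : sg x
  · rw [← S.cnt_dual]
    refine S.dual.eight_le_cnt_of_sg (S.visits_dual.2 hx) (fun n hn e => hper n hn ?_) (by simp [sx])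
    rw [S.dual_pow] at e
    exact e
  · exact S.eight_le_cnt_of_sg hx hper sx

end Exchange

end GIET

/-! ### Affine exchanges: ends attracted by periodic germs -/

namespace GIET

namespace Exchange

variable {X : Type*} [LinearOrder X] {sg : X → Bool} {d : ℕ} (S : Exchange X sg d)

/-- In the real coordinate `pos`, the exchange is affine on every piece, with slope `sl`. -/
structure IsAffine (pos sl : X → ℝ) : Prop where
  sl_pos : ∀ x, 0 < sl x
  sl_eq : ∀ ⦃i z z'⦄, S.l i ≤ z → z ≤ S.r i → S.l i ≤ z' → z' ≤ S.r i → sl z = sl z'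
  affine : ∀ ⦃i z z'⦄, S.l i ≤ z → z ≤ S.r i → S.l i ≤ z' → z' ≤ S.r i →
    pos (S.T z') - pos (S.T z) = sl z * (pos z' - pos z)
  mono : Monotone pos
  lt_of_left : ∀ ⦃x z⦄, x < z → sg x = true → pos x < pos z
  lt_of_right : ∀ ⦃x z⦄, x < z → sg z = false → pos x < pos z

/-- The multiplier of `T ^ n` at `p`. -/
noncomputable def mult (sl : X → ℝ) (n : ℕ) (p : X) : ℝ :=
  ∏ i ∈ Finset.range n, sl ((S.T ^ i) p)

variable {S} {pos sl : X → ℝ}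

theorem IsAffine.eq_of_pos_eq (hA : S.IsAffine pos sl) {x y : X} (h : pos x = pos y)
    (hs : sg x = sg y) : x = y := by
  have aux : ∀ x y, pos x = pos y → sg x = sg y → ¬ x < y := by
    intro x y h hs hlt
    cases hx : sg x
    · exact absurd h (hA.lt_of_right hlt (hs ▸ hx)).ne
    · exact absurd h (hA.lt_of_left hlt hx).ne
  exact le_antisymm (not_lt.1 (aux y x h.symm hs.symm)) (not_lt.1 (aux x y h hs))

theorem IsAffine.inv (hA : S.IsAffine pos sl) :
    S.inv.IsAffine pos (fun z => (sl (S.T⁻¹ z))⁻¹) where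
  sl_pos := fun x => inv_pos.2 (hA.sl_pos _)
  sl_eq := fun i z z' h1 h2 h3 h4 => by
    obtain ⟨z, rfl⟩ := S.T.surjective z
    obtain ⟨z', rfl⟩ := S.T.surjective z'
    have := hA.sl_eq (S.img h1 h2).1 (S.img h1 h2).2 (S.img h3 h4).1 (S.img h3 h4).2
    simp [this]
  affine := fun i z z' h1 h2 h3 h4 => by
    obtain ⟨z, rfl⟩ := S.T.surjective z
    obtain ⟨z', rfl⟩ := S.T.surjective z'
    have h := hA.affine (S.img h1 h2).1 (S.img h1 h2).2 (S.img h3 h4).1 (S.img h3 h4).2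
    have e : ∀ y, S.T⁻¹ (S.T y) = y := fun y => by simp
    simp only [inv_T, e]
    rw [h, inv_mul_cancel_left₀ (hA.sl_pos z).ne']
  mono := hA.mono
  lt_of_left := hA.lt_of_left
  lt_of_right := hA.lt_of_right

theorem IsAffine.dual (hA : S.IsAffine pos sl) :
    S.dual.IsAffine (fun z => -pos (OrderDual.ofDual z)) (fun z => sl (OrderDual.ofDual z)) where
  sl_pos := fun x => hA.sl_pos _
  sl_eq := fun i z z' h1 h2 h3 h4 => hA.sl_eq (i := i) (z := OrderDual.ofDual z) h2 h1 h4 h3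
  affine := fun i z z' h1 h2 h3 h4 => by
    have := hA.affine (i := i) (z := OrderDual.ofDual z) (z' := OrderDual.ofDual z') h2 h1 h4 h3
    have e : ∀ y, OrderDual.ofDual (S.dual.T y) = S.T (OrderDual.ofDual y) := fun y => rfl
    rw [e, e]
    linarith
  mono := fun x y h => neg_le_neg (hA.mono (show OrderDual.ofDual y ≤ OrderDual.ofDual x from h))
  lt_of_left := fun x z h hs => neg_lt_neg
    (hA.lt_of_right (show OrderDual.ofDual z < OrderDual.ofDual x from h) (by simpa using hs))
  lt_of_right := fun x z h hs => neg_lt_neg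
    (hA.lt_of_left (show OrderDual.ofDual z < OrderDual.ofDual x from h) (by simpa using hs))

theorem Uncut.same_piece {n : ℕ} {c z : X} (h : S.Uncut (n + 1) c z) (hcz : c ≤ z) :
    ∃ i, S.l i ≤ (S.T ^ n) c ∧ (S.T ^ n) z ≤ S.r i := by
  refine S.same_piece fun j hj => ?_
  obtain ⟨q, q1, q2, q3⟩ := (h.le n.le_succ).exists_eq hcz hj.1.le hj.2
  refine h n n.lt_succ_self q (q1.lt_of_ne ?_) q2 j q3
  rintro rfl
  exact hj.1.ne q3

theorem Uncut.pos_sub (hA : S.IsAffine pos sl) {n : ℕ} {c z : X} (h : S.Uncut n c z)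
    (hcz : c ≤ z) :
    pos ((S.T ^ n) z) - pos ((S.T ^ n) c) = S.mult sl n c * (pos z - pos c) := by
  induction n with
  | zero => simp [mult]
  | succ n ih =>
    obtain ⟨i, h1, h2⟩ := h.same_piece hcz
    have h3 := (h.le n.le_succ).monoLE le_rfl hcz le_rfl
    rw [pow_succ', Equiv.Perm.mul_apply, Equiv.Perm.mul_apply,
      hA.affine h1 (h3.trans h2) (h1.trans h3) h2, ih (h.le n.le_succ)]
    simp only [mult, Finset.prod_range_succ]
    ring

/-- Built by truncating, at each step, the image at the right end of the piece that contains `T ^ n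
p`. The bound is a left germ because it is a preimage of some `r i`. -/
theorem exists_max_uncut (p : X) {n : ℕ} (hn : 0 < n) :
    ∃ R, p ≤ R ∧ sg R = false ∧ S.Uncut n p R ∧ ∀ z, p ≤ z → S.Uncut n p z → z ≤ R := by
  have cut : ∀ {n : ℕ} {R : X} {i : Fin d}, p ≤ R → S.Uncut n p R → S.l i ≤ (S.T ^ n) p →
      (S.T ^ n) R ≤ S.r i → S.Uncut (n + 1) p R := by
    intro n R i hpR hU h1 h2 k hk x x1 x2 j hj
    rcases (Nat.lt_succ_iff.1 hk).eq_or_lt with e | e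
    · subst e
      have y1 := hU.lt le_rfl x1 x2
      have y2 := hU.monoLE x1.le x2 le_rfl
      rw [hj] at y1 y2
      have := S.uniq (h1.trans y1.le) (y2.trans h2) le_rfl (S.le j)
      subst this
      exact absurd y1 (not_lt.2 h1)
    · exact hU k e x x1 x2 j hj
  induction n, (show 1 ≤ n from hn) using Nat.le_induction with
  | base =>
    obtain ⟨i, h1, h2⟩ := S.cover p
    refine ⟨S.r i, h2, S.sg_r i, cut h2 (fun k hk => absurd hk (by omega)) h1 le_rfl, ?_⟩
    intro z hz hU
    obtain ⟨i', g1, g2⟩ := Uncut.same_piece (n := 0) hU hz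
    rw [S.uniq h1 h2 g1 (hz.trans g2)]
    exact g2
  | succ n hn' ih =>
    obtain ⟨R, hR1, hR2, hR3, hR4⟩ := ih (by omega)
    obtain ⟨i, h1, h2⟩ := S.cover ((S.T ^ n) p)
    obtain ⟨q, q1, q2, q3⟩ := hR3.exists_eq hR1
      (le_min (hR3.monoLE le_rfl hR1 le_rfl) h2) (min_le_left _ _)
    refine ⟨q, q1, ?_, cut q1 (hR3.right q2) h1 (q3 ▸ min_le_right _ _), fun z hz hU => ?_⟩
    · rw [← S.sg_pow n, q3]
      rcases min_choice ((S.T ^ n) R) (S.r i) with h | h <;> rw [h]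
      · rw [S.sg_pow, hR2]
      · exact S.sg_r i
    · obtain ⟨i', g1, g2⟩ := hU.same_piece hz
      have hzR := hR4 z hz (hU.le n.le_succ)
      have g3 := (hU.le n.le_succ).monoLE le_rfl hz le_rfl
      have e := S.uniq h1 h2 g1 (g3.trans g2)
      subst e
      by_contra hc
      refine absurd (hR3.lt q1 (not_le.1 hc) hzR) (not_lt.2 ?_)
      rw [q3]
      exact le_min (hR3.monoLE hz hzR le_rfl) g2

theorem pow_periodic {x : X} {n : ℕ} (h : (S.T ^ n) x = x) (k : ℕ) :
    (S.T ^ n) ((S.T ^ k) x) = (S.T ^ k) x := by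
  rw [← Equiv.Perm.mul_apply, ← pow_add, add_comm, pow_add, Equiv.Perm.mul_apply, h]

theorem pow_mul_periodic {x : X} {n : ℕ} (h : (S.T ^ n) x = x) (k : ℕ) :
    (S.T ^ (n * k)) x = x := by
  induction k with
  | zero => rfl
  | succ k ih => rw [Nat.mul_succ, pow_add, Equiv.Perm.mul_apply, h, ih]

theorem exists_inv_pow_eq {x : X} {n : ℕ} (hn : 0 < n) (h : (S.T ^ n) x = x) (k : ℕ) :
    ∃ m : ℕ, ((S.T⁻¹) ^ m) x = (S.T ^ k) x := by
  refine ⟨(n - 1) * k, ?_⟩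
  have e : (S.T ^ ((n - 1) * k)) ((S.T ^ k) x) = x := by
    rw [← Equiv.Perm.mul_apply, ← pow_add]
    have : (n - 1) * k + k = n * k := by
      obtain ⟨m, rfl⟩ : ∃ m, n = m + 1 := ⟨n - 1, by omega⟩
      simp only [Nat.add_sub_cancel]
      ring
    rw [this, pow_mul_periodic h]
  nth_rewrite 1 [← e]
  exact S.inv_pow_apply_pow _ _

theorem mult_T {y : X} {n : ℕ} (h : (S.T ^ n) y = y) : S.mult sl n (S.T y) = S.mult sl n y := by
  cases n with
  | zero => rfl
  | succ n =>
    simp only [mult]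
    rw [Finset.prod_range_succ, Finset.prod_range_succ' _ n]
    congr 1
    rw [← Equiv.Perm.mul_apply, ← pow_succ, h]
    rfl

theorem mult_pow {x : X} {n : ℕ} (h : (S.T ^ n) x = x) (k : ℕ) :
    S.mult sl n ((S.T ^ k) x) = S.mult sl n x := by
  induction k with
  | zero => rfl
  | succ k ih => rw [pow_succ', Equiv.Perm.mul_apply, mult_T (pow_periodic h k), ih]

theorem mult_inv {x : X} {n : ℕ} (h : (S.T ^ n) x = x) :
    S.inv.mult (fun z => (sl (S.T⁻¹ z))⁻¹) n x = (S.mult sl n x)⁻¹ := by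
  simp only [mult, Finset.prod_inv_distrib]
  congr 1
  rw [← Finset.prod_range_reflect]
  refine Finset.prod_congr rfl fun i hi => ?_
  rw [Finset.mem_range] at hi
  congr 1
  rw [inv_T, ← Equiv.Perm.mul_apply, ← pow_succ']
  have e : (S.T ^ (n - 1 - i + 1)) ((S.T ^ i) x) = x := by
    rw [← Equiv.Perm.mul_apply, ← pow_add, show n - 1 - i + 1 + i = n by omega, h]
  nth_rewrite 1 [← e]
  exact S.inv_pow_apply_pow _ _

theorem IsAffine.mult_pos (hA : S.IsAffine pos sl) (n : ℕ) (x : X) : 0 < S.mult sl n x :=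
  Finset.prod_pos fun _ _ => hA.sl_pos _

/-- Near a periodic point with multiplier one, all points are periodic. -/
theorem IsAffine.exists_fixed (hA : S.IsAffine pos sl) {x : X} {n : ℕ} (hn : 0 < n)
    (h : (S.T ^ n) x = x) (sx : sg x = true) (hm : S.mult sl n x = 1) :
    ∃ R, x < R ∧ ∀ z, x ≤ z → z ≤ R → (S.T ^ n) z = z := by
  obtain ⟨R, hR1, hR2, hR3, -⟩ := exists_max_uncut (S := S) x hn
  refine ⟨R, hR1.lt_of_ne fun e => ?_, fun z h1 h2 => ?_⟩
  · rw [e, hR2] at sx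
    exact absurd sx (by decide)
  · have := (hR3.right h2).pos_sub hA h1
    rw [hm, h, one_mul] at this
    exact hA.eq_of_pos_eq (by linarith) (S.sg_pow n z)

theorem IsAffine.contract (hA : S.IsAffine pos sl) {p z : X} {n : ℕ}
    (h : (S.T ^ n) p = p) (sp : sg p = true) (hm : S.mult sl n p < 1) (hz : p < z)
    (hU : S.Uncut n p z) : p < (S.T ^ n) z ∧ (S.T ^ n) z < z := by
  have h1 := hU.lt le_rfl hz le_rfl
  rw [h] at h1
  refine ⟨h1, ?_⟩
  have h2 := hU.pos_sub hA hz.le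
  rw [h] at h2
  have h3 := hA.lt_of_left hz sp
  by_contra hc
  have h4 := hA.mono (not_lt.1 hc)
  nlinarith

/-- If the orbit of a periodic right germ avoids the left endpoints, then the left germ next to it is
periodic with the same multiplier. -/
theorem IsAffine.pred_periodic (hA : S.IsAffine pos sl) {x y : X} {n : ℕ} (hc : y ⋖ x)
    (h : (S.T ^ n) x = x) (hno : ∀ k j, (S.T ^ k) x ≠ S.l j) :
    (∀ k, (S.T ^ k) y ⋖ (S.T ^ k) x) ∧ (S.T ^ n) y = y ∧ S.mult sl n y = S.mult sl n x := by
  have hk : ∀ k, (S.T ^ k) y ⋖ (S.T ^ k) x := by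
    intro k
    induction k with
    | zero => exact hc
    | succ k ih =>
      rw [pow_succ', Equiv.Perm.mul_apply, Equiv.Perm.mul_apply]
      exact S.covBy_T ih (hno k)
  refine ⟨hk, ?_, Finset.prod_congr rfl fun i _ => ?_⟩
  · have := hk n
    rw [h] at this
    exact this.unique_left hc
  · obtain ⟨j, h1, h2⟩ := S.same_piece (p := (S.T ^ i) y) (q := (S.T ^ i) x) fun j hj =>
      hno i j (le_antisymm ((hk i).ge_of_gt hj.1) hj.2)
    exact hA.sl_eq h1 ((hk i).le.trans h2) (h1.trans (hk i).le) h2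

section Topology

variable [TopologicalSpace X] [OrderTopology X]

/-- On an uncut stretch `T ^ n` scales distances to `p` by the multiplier, so positions converge
geometrically from above, which for a right germ is convergence of germs. -/
theorem IsAffine.visits_of_contract (hA : S.IsAffine pos sl) {p z : X} {n : ℕ} (hn : 0 < n)
    (h : (S.T ^ n) p = p) (sp : sg p = true) (hm : S.mult sl n p < 1) (hz : p < z)
    (hU : S.Uncut n p z) : Visits S.T p z := by
  have key : ∀ j : ℕ, p < (S.T ^ (n * j)) z ∧ (S.T ^ (n * j)) z ≤ z ∧
      pos ((S.T ^ (n * j)) z) - pos p = S.mult sl n p ^ j * (pos z - pos p) := by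
    intro j
    induction j with
    | zero => simpa using hz
    | succ j ih =>
      obtain ⟨a, b, c⟩ := ih
      have hU' := hU.right b
      obtain ⟨a1, a2⟩ := hA.contract h sp hm a hU'
      rw [Nat.mul_succ, add_comm, pow_add, Equiv.Perm.mul_apply]
      refine ⟨a1, a2.le.trans b, ?_⟩
      have := hU'.pos_sub hA a.le
      rw [h, c] at this
      rw [this]
      ring
  refine visits_of_exists fun s hs N => ?_
  obtain ⟨u, v, hu, hv, h1, h2, hsub⟩ := S.exists_Icc_subset hs
  have hpv : pos p < pos v := by
    refine hA.lt_of_left (h2.lt_of_ne fun e => ?_) sp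
    rw [e, hv] at sp
    exact absurd sp (by decide)
  have hlim : Tendsto (fun j : ℕ => S.mult sl n p ^ j * (pos z - pos p)) atTop (𝓝 0) := by
    simpa using (tendsto_pow_atTop_nhds_zero_of_lt_one (hA.mult_pos n p).le hm).mul_const
      (pos z - pos p)
  obtain ⟨j, hj, hjN⟩ := ((hlim.eventually (gt_mem_nhds (sub_pos.2 hpv))).and
    (eventually_ge_atTop N)).exists
  obtain ⟨a, b, c⟩ := key j
  refine ⟨n * j, hjN.trans (Nat.le_mul_of_pos_left _ hn), hsub ⟨h1.trans a.le, ?_⟩⟩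
  by_contra hc
  have := hA.mono (not_le.1 hc).le
  linarith

/-- An attracting periodic point attracts a right endpoint, and a left endpoint outside its orbit. -/
theorem IsAffine.exists_attracted (hA : S.IsAffine pos sl) {x : X} {n : ℕ} (hn : 0 < n)
    (h : (S.T ^ n) x = x) (sx : sg x = true) (hm : S.mult sl n x < 1) :
    ∃ j j', Visits S.T x (S.r j) ∧ Visits S.T x (S.l j') ∧ (S.T ^ n) (S.l j') ≠ S.l j' := by
  choose R hR1 hR2 hR3 hR4 using fun p => exists_max_uncut (S := S) p hn
  have hper := pow_periodic h
  have hsg : ∀ k, sg ((S.T ^ k) x) = true := fun k => by rw [S.sg_pow, sx]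
  have hmk : ∀ k, S.mult sl n ((S.T ^ k) x) < 1 := fun k => by rw [mult_pow h]; exact hm
  have hlt : ∀ k, (S.T ^ k) x < R ((S.T ^ k) x) := fun k => (hR1 _).lt_of_ne fun e => by
    have := hsg k
    rw [e, hR2] at this
    exact absurd this (by decide)
  have hT : ∀ y : X, (S.T ^ 1) y = S.T y := fun y => by rw [pow_one]
  -- The image of a maximal uncut stretch is uncut for `n` steps. Only the last step is new, and
  -- there contraction has brought the stretch back inside itself.
  have step : ∀ k, S.T (R ((S.T ^ k) x)) ≤ R (S.T ((S.T ^ k) x)) := by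
    intro k
    have U1 := (hR3 ((S.T ^ k) x)).le (m := 1) hn
    have e1 := U1.monoLE le_rfl (hR1 _) le_rfl
    rw [hT, hT] at e1
    refine hR4 _ _ e1 fun i hi q q1 q2 j hj => ?_
    obtain ⟨q', p1, p2, p3⟩ := U1.exists_eq (hR1 _) (q := q) (by rw [hT]; exact q1.le)
      (by rw [hT]; exact q2)
    rw [hT] at p3
    subst p3
    have p1' : (S.T ^ k) x < q' := p1.lt_of_ne fun e => by
      rw [e] at q1
      exact lt_irrefl _ q1
    rw [← Equiv.Perm.mul_apply, ← pow_succ] at hj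
    rcases (show i + 1 ≤ n from hi).eq_or_lt with e | e
    · rw [e] at hj
      obtain ⟨c1, c2⟩ := hA.contract (hper k) (hsg k) (hmk k) p1' ((hR3 _).right p2)
      exact hR3 _ 0 hn _ c1 (c2.le.trans p2) j hj
    · exact hR3 _ (i + 1) e q' p1' p2 j hj
  -- Equality all around the orbit would make `R x` fixed by `T ^ n`, against contraction.
  obtain ⟨k, hk⟩ : ∃ k, S.T (R ((S.T ^ k) x)) < R (S.T ((S.T ^ k) x)) := by
    by_contra hc
    push Not at hc
    have heq : ∀ k, (S.T ^ k) (R x) = R ((S.T ^ k) x) := by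
      intro k
      induction k with
      | zero => rfl
      | succ k ih =>
        rw [pow_succ', Equiv.Perm.mul_apply, Equiv.Perm.mul_apply, ih]
        exact le_antisymm (step k) (hc k)
    have h1 := heq n
    rw [h] at h1
    exact (hA.contract h sx hm (hlt 0) (hR3 x)).2.ne h1
  set p := (S.T ^ k) x with hp
  have hpT : (S.T ^ n) (S.T p) = S.T p := by
    have := hper (k + 1)
    rwa [pow_succ', Equiv.Perm.mul_apply, ← hp] at this
  have sT : sg (S.T p) = true := by rw [S.sg_T, hsg]
  have mT : S.mult sl n (S.T p) < 1 := by rw [mult_T (hper k)]; exact hmk k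
  -- Since there is room left after one step, the stretch at `p` is blocked at time zero: it stops
  -- at the right end of a piece.
  have hRr : ∃ j, R p = S.r j := by
    obtain ⟨j, j1, j2⟩ := S.cover (R p)
    refine ⟨j, ?_⟩
    by_contra hne
    obtain ⟨R', hc, hR'⟩ := S.split.succ_of_lt (hR2 p) (j2.lt_of_ne hne)
    have hnl : ∀ i, R' ≠ S.l i := fun i e => by
      have e' := S.uniq (j1.trans hc.le) hR' e.symm.le (e.le.trans (S.le i))
      subst e'
      exact absurd (e ▸ hc.lt) (not_lt.2 j1)
    have hcT := S.covBy_T hc hnl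
    refine absurd (hR4 p R' ((hlt k).le.trans hc.le) fun i hi q q1 q2 j' hj' => ?_)
      (not_le.2 hc.lt)
    rcases q2.eq_or_lt with e | e
    · subst e
      cases i with
      | zero => exact hnl j' hj'
      | succ i =>
        rw [pow_succ, Equiv.Perm.mul_apply] at hj'
        refine hR3 (S.T p) i (by omega) (S.T q) ?_ (hcT.ge_of_gt hk) j' hj'
        have U1 := (hR3 p).le (m := 1) hn
        have := U1.monoLE le_rfl (hR1 _) le_rfl
        rw [hT, hT] at this
        exact this.trans_lt hcT.lt
    · exact hR3 p i hi q q1 (hc.le_of_lt e) j' hj'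
  obtain ⟨j, hj⟩ := hRr
  have hrlt : S.T p < S.T (S.r j) := by
    have := ((hR3 p).le (m := 1) hn).lt le_rfl (hlt k) le_rfl
    rwa [hT, hT, hj] at this
  rw [hj] at hk
  obtain ⟨q, hq1, hq2⟩ := S.split.succ_of_lt (S.inv.sg_r j) hk
  -- The germ just above `T (r j)` starts another image piece and still lies in the stretch at `T
  -- p`, so a left endpoint is attracted as well.
  obtain ⟨j', rfl⟩ := S.inv.l_of_r_covBy (j := j) hq1
  have hllt : S.T p < S.T (S.l j') := hrlt.trans hq1.lt
  have V1 := hA.visits_of_contract hn hpT sT mT hrlt ((hR3 _).right hk.le)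
  have V2 := hA.visits_of_contract hn hpT sT mT hllt ((hR3 _).right hq2)
  rw [visits_T_right (Or.inl rfl), visits_T_left (Or.inl rfl), hp,
    visits_pow_left (Or.inl rfl)] at V1 V2
  refine ⟨j, j', V1, V2, fun e => ?_⟩
  have := (hA.contract hpT sT mT hllt ((hR3 _).right hq2)).2
  rw [← Equiv.Perm.mul_apply, ← pow_succ, pow_succ', Equiv.Perm.mul_apply, e] at this
  exact lt_irrefl _ this

/-- A left endpoint on the periodic orbit contributes its own two ends. It differs from the
attracted left endpoint, which `T ^ n` does not fix. -/
theorem IsAffine.cnt_of_mult_lt_one (hA : S.IsAffine pos sl) {x : X} {n : ℕ} (hn : 0 < n)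
    (h : (S.T ^ n) x = x) (sx : sg x = true) (hm : S.mult sl n x < 1) :
    2 ≤ S.cnt x ∧ ((∃ k j, (S.T ^ k) x = S.l j) → 4 ≤ S.cnt x) := by
  classical
  obtain ⟨j, j', h1, h2, h3⟩ := hA.exists_attracted hn h sx hm
  have c1 : 0 < (visitors S.T S.r x).card := Finset.card_pos.2 ⟨j, mem_visitors.2 h1⟩
  have c2 : 0 < (visitors S.T S.l x).card := Finset.card_pos.2 ⟨j', mem_visitors.2 h2⟩
  refine ⟨by unfold cnt; omega, ?_⟩
  rintro ⟨k, i, hi⟩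
  have v0 := visits_of_periodic hn h
  have v1 : Visits S.T x (S.l i) := by rw [← hi, visits_pow_right (Or.inl rfl)]; exact v0
  have v2 : Visits S.T⁻¹ x (S.l i) := by
    rw [← hi, visits_pow_right (Or.inr rfl)]; exact S.visits_inv_self v0
  have hne : i ≠ j' := by
    rintro rfl
    refine h3 ?_
    rw [← hi, pow_periodic h]
  have c3 : 1 < (visitors S.T S.l x).card :=
    Finset.one_lt_card.2 ⟨i, mem_visitors.2 v1, j', mem_visitors.2 h2, hne⟩
  have c4 : 0 < (visitors S.T⁻¹ S.l x).card := Finset.card_pos.2 ⟨i, mem_visitors.2 v2⟩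
  unfold cnt
  omega

/-- A repelling germ is attracting for `S.inv`, and `cnt` ignores the direction of time. -/
theorem IsAffine.cnt_of_mult_ne_one (hA : S.IsAffine pos sl) {x : X} {n : ℕ} (hn : 0 < n)
    (h : (S.T ^ n) x = x) (sx : sg x = true) (hm : S.mult sl n x ≠ 1) :
    2 ≤ S.cnt x ∧ ((∃ k j, (S.T ^ k) x = S.l j) → 4 ≤ S.cnt x) := by
  rcases lt_or_gt_of_ne hm with hlt | hgt
  · exact hA.cnt_of_mult_lt_one hn h sx hlt
  · have h' : (S.inv.T ^ n) x = x := by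
      nth_rewrite 1 [← h]
      exact S.inv_pow_apply_pow n x
    have hlt := inv_lt_one_of_one_lt₀ hgt
    rw [← mult_inv h] at hlt
    obtain ⟨a, b⟩ := hA.inv.cnt_of_mult_lt_one hn h' sx hlt
    rw [S.cnt_inv] at a b
    refine ⟨a, fun ⟨k, j, hk⟩ => b ?_⟩
    -- The exponent is `k + 1` because the left endpoints of `S.inv` are the germs `T (l j)`.
    obtain ⟨m, hm⟩ := exists_inv_pow_eq hn h (k + 1)
    exact ⟨m, j, by rw [inv_T, hm, pow_succ', Equiv.Perm.mul_apply, hk]; rfl⟩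

theorem IsAffine.two_le_cnt (hA : S.IsAffine pos sl) {x : X} {n : ℕ} (hn : 0 < n)
    (h : (S.T ^ n) x = x) (hm : S.mult sl n x ≠ 1) : 2 ≤ S.cnt x := by
  cases sx : sg x
  · rw [← S.cnt_dual]
    refine (hA.dual.cnt_of_mult_ne_one hn (x := OrderDual.toDual x) ?_ (by simp [sx]) ?_).1
    · rw [S.dual_pow, h]
    · intro e
      refine hm (e ▸ ?_)
      simp only [mult, S.dual_pow]
      rfl
  · exact (hA.cnt_of_mult_ne_one hn h sx hm).1

end Topology

end Exchange

end GIET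

/-! ### The split unit interval and the induced exchange -/

namespace GIET

/-- The one-sided germs of the unit interval: `x⁺ = (x, true)` for `0 ≤ x < 1` and
`x⁻ = (x, false)` for `0 < x ≤ 1`, ordered lexicographically. -/
def Germ : Type := Set.Icc (toLex ((0 : ℝ), true)) (toLex ((1 : ℝ), false))

namespace Germ

noncomputable instance : LinearOrder Germ :=
  inferInstanceAs (LinearOrder (Set.Icc (toLex ((0 : ℝ), true)) (toLex ((1 : ℝ), false))))

noncomputable instance : TopologicalSpace Germ := Preorder.topology Germ

instance : OrderTopology Germ := ⟨rfl⟩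

/-- The point of a germ. -/
def pos (g : Germ) : ℝ := (ofLex g.1).1

/-- The side of a germ. -/
def sgn (g : Germ) : Bool := (ofLex g.1).2

theorem lt_iff {g h : Germ} :
    g < h ↔ pos g < pos h ∨ pos g = pos h ∧ sgn g = false ∧ sgn h = true := by
  change g.1 < h.1 ↔ _
  rw [Prod.Lex.lt_iff, Bool.lt_iff]
  rfl

theorem ext {g h : Germ} (h1 : pos g = pos h) (h2 : sgn g = sgn h) : g = h :=
  Subtype.ext (ofLex.injective (Prod.ext h1 h2))

theorem le_iff {g h : Germ} :
    g ≤ h ↔ pos g < pos h ∨ pos g = pos h ∧ (sgn g = true → sgn h = true) := by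
  rw [← not_lt, lt_iff]
  constructor
  · intro H
    push Not at H
    rcases H.1.eq_or_lt with e | e
    · refine Or.inr ⟨e, fun hg => ?_⟩
      cases hh : sgn h
      · exact absurd hg (H.2 e.symm hh)
      · rfl
    · exact Or.inl e
  · rintro (H | ⟨H, H'⟩) (K | ⟨K, K1, K2⟩)
    · exact lt_asymm H K
    · exact H.ne K.symm
    · exact K.ne H.symm
    · rw [H' K2] at K1
      exact absurd K1 (by simp)

theorem monotone_pos : Monotone pos := fun x y hxy => by
  rcases le_iff.1 hxy with h | h
  · exact h.le
  · exact h.1.le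

/-- The germ `g` is a germ of the interval `[a, b)`. -/
def In (a b : ℝ) (g : Germ) : Prop :=
  (sgn g = true ∧ a ≤ pos g ∧ pos g < b) ∨ (sgn g = false ∧ a < pos g ∧ pos g ≤ b)

theorem in_unit (g : Germ) : In 0 1 g := by
  have h1 := g.2.1
  have h2 := g.2.2
  rw [Prod.Lex.le_iff] at h1 h2
  change (0 < pos g) ∨ (0 = pos g ∧ true ≤ sgn g) at h1
  change (pos g < 1) ∨ (pos g = 1 ∧ sgn g ≤ false) at h2
  cases hs : sgn g
  · right
    refine ⟨hs, ?_, ?_⟩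
    · rcases h1 with h | h
      · exact h
      · rw [hs] at h; exact absurd h.2 (by decide)
    · rcases h2 with h | h
      · exact h.le
      · exact h.1.le
  · left
    refine ⟨hs, ?_, ?_⟩
    · rcases h1 with h | h
      · exact h.le
      · exact h.1.le
    · rcases h2 with h | h
      · exact h
      · rw [hs] at h; exact absurd h.2 (by decide)

/-- The germ at the point `x` on the side `s`. -/
def mk (x : ℝ) (s : Bool) (h : (s = true ∧ 0 ≤ x ∧ x < 1) ∨ (s = false ∧ 0 < x ∧ x ≤ 1)) : Germ :=
  ⟨toLex (x, s), by
    constructor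
    · rw [Prod.Lex.le_iff]
      rcases h with ⟨rfl, h1, h2⟩ | ⟨rfl, h1, h2⟩
      · rcases h1.eq_or_lt with h | h
        · exact Or.inr ⟨h, le_rfl⟩
        · exact Or.inl h
      · exact Or.inl h1
    · rw [Prod.Lex.le_iff]
      rcases h with ⟨rfl, h1, h2⟩ | ⟨rfl, h1, h2⟩
      · exact Or.inl h2
      · rcases h2.eq_or_lt with h | h
        · exact Or.inr ⟨h, le_rfl⟩
        · exact Or.inl h⟩

@[simp] theorem pos_mk (x : ℝ) (s : Bool) (h) : pos (mk x s h) = x := rfl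
@[simp] theorem sgn_mk (x : ℝ) (s : Bool) (h) : sgn (mk x s h) = s := rfl

/-- The right germ `x⁺`. -/
def plus (x : ℝ) (h1 : 0 ≤ x) (h2 : x < 1) : Germ := mk x true (Or.inl ⟨rfl, h1, h2⟩)

/-- The left germ `x⁻`. -/
def minus (x : ℝ) (h1 : 0 < x) (h2 : x ≤ 1) : Germ := mk x false (Or.inr ⟨rfl, h1, h2⟩)

@[simp] theorem pos_plus (x : ℝ) (h1 h2) : pos (plus x h1 h2) = x := rfl
@[simp] theorem sgn_plus (x : ℝ) (h1 h2) : sgn (plus x h1 h2) = true := rfl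
@[simp] theorem pos_minus (x : ℝ) (h1 h2) : pos (minus x h1 h2) = x := rfl
@[simp] theorem sgn_minus (x : ℝ) (h1 h2) : sgn (minus x h1 h2) = false := rfl

theorem in_iff {a b : ℝ} (ha : 0 ≤ a) (ha' : a < 1) (hb : 0 < b) (hb' : b ≤ 1) (g : Germ) :
    In a b g ↔ plus a ha ha' ≤ g ∧ g ≤ minus b hb hb' := by
  simp only [le_iff, pos_plus, sgn_plus, pos_minus, sgn_minus, In]
  cases hs : sgn g <;> simp [le_iff_lt_or_eq]

theorem covBy_of_pos_eq {g h : Germ} (h1 : pos g = pos h) (hg : sgn g = false)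
    (hh : sgn h = true) : g ⋖ h := by
  refine ⟨lt_iff.2 (Or.inr ⟨h1, hg, hh⟩), fun k hk hk' => ?_⟩
  rw [lt_iff] at hk hk'
  rcases hk with hk | ⟨hk, hk1, hk2⟩ <;> rcases hk' with hk' | ⟨hk', hk1', hk2'⟩
  · linarith
  · linarith
  · linarith
  · rw [hk2] at hk1'
    exact absurd hk1' (by simp)

theorem isSplitOrder : IsSplitOrder Germ sgn where
  sep := fun x y hxy => by
    rcases lt_iff.1 hxy with h | ⟨h1, h2, h3⟩
    · obtain ⟨c, hc1, hc2⟩ := exists_between h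
      have p1 : 0 ≤ pos x := by rcases in_unit x with h | h <;> linarith [h.2.1]
      have p2 : pos y ≤ 1 := by rcases in_unit y with h | h <;> linarith [h.2.2]
      exact ⟨minus c (by linarith) (by linarith), plus c (by linarith) (by linarith),
        (lt_iff.2 (Or.inl hc1)).le, covBy_of_pos_eq rfl rfl rfl, le_iff.2 (Or.inl hc2),
        rfl, rfl⟩
    · exact ⟨x, y, le_rfl, covBy_of_pos_eq h1 h2 h3, le_rfl, h2, h3⟩
  exists_pred := fun u hu => by
    rcases in_unit u with h | h
    · rcases h.2.1.eq_or_lt with e | e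
      · left
        intro x
        rw [le_iff, ← e]
        rcases in_unit x with k | k
        · rcases k.2.1.eq_or_lt with e' | e'
          · exact Or.inr ⟨e', fun _ => k.1⟩
          · exact Or.inl e'
        · exact Or.inl k.2.1
      · exact Or.inr ⟨minus (pos u) e h.2.2.le, covBy_of_pos_eq rfl rfl hu⟩
    · rw [hu] at h
      exact absurd h.1 (by simp)
  exists_succ := fun u hu => by
    rcases in_unit u with h | h
    · rw [hu] at h
      exact absurd h.1 (by simp)
    · rcases h.2.2.eq_or_lt with e | e
      · left
        intro x
        rw [le_iff, e]
        rcases in_unit x with k | k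
        · exact Or.inl k.2.2
        · rcases k.2.2.eq_or_lt with e' | e'
          · exact Or.inr ⟨e', fun hx => absurd hx (by simp [k.1])⟩
          · exact Or.inl e'
      · exact Or.inr ⟨plus (pos u) h.2.1.le e, covBy_of_pos_eq rfl hu rfl⟩

end Germ

/-- The intervals `[a i, b i)` form a partition of `[0, 1)`. -/
structure IsPartition {d : ℕ} (a b : Fin d → ℝ) : Prop where
  lt : ∀ i, a i < b i
  uniq : ∀ ⦃i j x⦄, x ∈ Ico (a i) (b i) → x ∈ Ico (a j) (b j) → i = j
  mem_iff : ∀ x, (∃ i, x ∈ Ico (a i) (b i)) ↔ x ∈ Ico (0 : ℝ) 1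

namespace IsPartition

variable {d : ℕ} {a b : Fin d → ℝ}

theorem left_mem (h : IsPartition a b) (i : Fin d) : a i ∈ Ico (0 : ℝ) 1 :=
  (h.mem_iff _).1 ⟨i, le_rfl, h.lt i⟩

theorem right_mem (h : IsPartition a b) (i : Fin d) : b i ∈ Ioc (0 : ℝ) 1 := by
  refine ⟨(h.left_mem i).1.trans_lt (h.lt i), ?_⟩
  by_contra hc
  push Not at hc
  exact lt_irrefl _ ((h.mem_iff 1).1 ⟨i, (h.left_mem i).2.le, hc⟩).2

theorem germ_uniq (h : IsPartition a b) {i j : Fin d} {g : Germ} (hi : Germ.In (a i) (b i) g)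
    (hj : Germ.In (a j) (b j) g) : i = j := by
  rcases hi with ⟨s, h1, h2⟩ | ⟨s, h1, h2⟩ <;> rcases hj with ⟨s', h1', h2'⟩ | ⟨s', h1', h2'⟩
  · exact h.uniq ⟨h1, h2⟩ ⟨h1', h2'⟩
  · rw [s] at s'; exact absurd s' (by simp)
  · rw [s] at s'; exact absurd s' (by simp)
  · have hm : max (a i) (a j) < g.pos := max_lt h1 h1'
    exact h.uniq (x := max (a i) (a j)) ⟨le_max_left _ _, hm.trans_le h2⟩
      ⟨le_max_right _ _, hm.trans_le h2'⟩

/-- For a left germ, take the interval with the largest left end below its position. If it stopped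
short of the germ, the interval containing its right end would violate maximality or disjointness.
-/
theorem germ_cover (h : IsPartition a b) (g : Germ) : ∃ i, Germ.In (a i) (b i) g := by
  rcases g.in_unit with ⟨s, h1, h2⟩ | ⟨s, h1, h2⟩
  · obtain ⟨i, hi⟩ := (h.mem_iff g.pos).2 ⟨h1, h2⟩
    exact ⟨i, Or.inl ⟨s, hi.1, hi.2⟩⟩
  · obtain ⟨i₀, hi₀⟩ := (h.mem_iff 0).2 ⟨le_rfl, one_pos⟩
    obtain ⟨i, hi, hmax⟩ := (Finset.univ.filter fun i => a i < g.pos).exists_max_image a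
      ⟨i₀, by simpa using hi₀.1.trans_lt h1⟩
    simp only [Finset.mem_filter, Finset.mem_univ, true_and] at hi hmax
    refine ⟨i, Or.inr ⟨s, hi, ?_⟩⟩
    by_contra hc
    push Not at hc
    obtain ⟨j, hj⟩ := (h.mem_iff (b i)).2 ⟨(h.right_mem i).1.le, hc.trans_le h2⟩
    have e := hmax j (hj.1.trans_lt hc)
    have := h.uniq (x := a i) ⟨le_rfl, h.lt i⟩ ⟨e, (h.lt i).trans hj.2⟩
    subst this
    exact lt_irrefl _ hj.2

/-- The index of the interval to which a germ belongs. -/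
noncomputable def idx (h : IsPartition a b) (g : Germ) : Fin d := (h.germ_cover g).choose

theorem in_idx (h : IsPartition a b) (g : Germ) : Germ.In (a (h.idx g)) (b (h.idx g)) g :=
  (h.germ_cover g).choose_spec

theorem idx_eq (h : IsPartition a b) {g : Germ} {i : Fin d} (hi : Germ.In (a i) (b i) g) :
    h.idx g = i :=
  h.germ_uniq (h.in_idx g) hi

theorem in_unit_of_in (h : IsPartition a b) {i : Fin d} {x : ℝ} {s : Bool}
    (hx : (s = true ∧ a i ≤ x ∧ x < b i) ∨ (s = false ∧ a i < x ∧ x ≤ b i)) :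
    (s = true ∧ 0 ≤ x ∧ x < 1) ∨ (s = false ∧ 0 < x ∧ x ≤ 1) := by
  have h1 := (h.left_mem i).1
  have h2 := (h.right_mem i).2
  rcases hx with ⟨e, k1, k2⟩ | ⟨e, k1, k2⟩
  · exact Or.inl ⟨e, by linarith, by linarith⟩
  · exact Or.inr ⟨e, by linarith, by linarith⟩

end IsPartition

section OfPartition

variable {d : ℕ} {a b s t : Fin d → ℝ} (h : IsPartition a b)
  (h' : IsPartition (fun i => s i * a i + t i) (fun i => s i * b i + t i)) (hs : ∀ i, 0 < s i)

/-- The map induced on germs by a piecewise affine bijection. -/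
noncomputable def germMap (g : Germ) : Germ :=
  Germ.mk (s (h.idx g) * g.pos + t (h.idx g)) g.sgn <| by
    refine h'.in_unit_of_in (i := h.idx g) ?_
    simpa [hs, Germ.In] using h.in_idx g

theorem sgn_germMap (g : Germ) : (germMap h h' hs g).sgn = g.sgn := rfl

theorem pos_germMap {g : Germ} {i : Fin d} (hi : Germ.In (a i) (b i) g) :
    (germMap h h' hs g).pos = s i * g.pos + t i := by
  rw [← h.idx_eq hi]; rfl

theorem in_germMap {g : Germ} {i : Fin d} (hi : Germ.In (a i) (b i) g) :
    Germ.In (s i * a i + t i) (s i * b i + t i) (germMap h h' hs g) := by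
  rw [Germ.In, pos_germMap h h' hs hi, sgn_germMap]
  simpa [hs, Germ.In] using hi

theorem bijective_germMap : Function.Bijective (germMap h h' hs) := by
  constructor
  · intro g k hgk
    have h1 := in_germMap h h' hs (h.in_idx g)
    have h2 := in_germMap h h' hs (h.in_idx k)
    rw [hgk] at h1
    have e := h'.germ_uniq h1 h2
    have h3 := pos_germMap h h' hs (h.in_idx g)
    have h4 := pos_germMap h h' hs (h.in_idx k)
    rw [hgk, e] at h3
    refine Germ.ext ?_ ?_
    · have := hs (h.idx k)
      have h5 : s (h.idx k) * g.pos = s (h.idx k) * k.pos := by linarith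
      exact mul_left_cancel₀ this.ne' h5
    · rw [← sgn_germMap h h' hs g, hgk]; rfl
  · intro k
    obtain ⟨i, hi⟩ := h'.germ_cover k
    have e : k.pos = s i * ((k.pos - t i) / s i) + t i := by
      rw [mul_div_cancel₀ _ (hs i).ne']; ring
    have hin : (k.sgn = true ∧ a i ≤ (k.pos - t i) / s i ∧ (k.pos - t i) / s i < b i) ∨
        (k.sgn = false ∧ a i < (k.pos - t i) / s i ∧ (k.pos - t i) / s i ≤ b i) := by
      rw [Germ.In, e] at hi
      simpa [hs] using hi
    let g : Germ := Germ.mk _ _ (h.in_unit_of_in hin)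
    refine ⟨g, Germ.ext ?_ rfl⟩
    rw [pos_germMap h h' hs (g := g) (i := i) hin]
    exact e.symm

/-- The exchange of germs induced by a piecewise affine bijection. -/
noncomputable def germExchange : Exchange Germ Germ.sgn d where
  T := Equiv.ofBijective _ (bijective_germMap h h' hs)
  l := fun i => Germ.plus (a i) (h.left_mem i).1 (h.left_mem i).2
  r := fun i => Germ.minus (b i) (h.right_mem i).1 (h.right_mem i).2
  le := fun i => Germ.le_iff.2 (Or.inl (h.lt i))
  cover := fun x => by
    obtain ⟨i, hi⟩ := h.germ_cover x
    exact ⟨i, (Germ.in_iff _ _ _ _ _).1 hi⟩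
  uniq := fun i j x h1 h2 h3 h4 =>
    h.germ_uniq ((Germ.in_iff _ _ _ _ _).2 ⟨h1, h2⟩) ((Germ.in_iff _ _ _ _ _).2 ⟨h3, h4⟩)
  mono := fun i x y h1 h2 h3 => by
    have hx := (Germ.in_iff _ _ _ _ _).2 ⟨h1, h2.le.trans h3⟩
    have hy := (Germ.in_iff _ _ _ _ _).2 ⟨h1.trans h2.le, h3⟩
    change germMap h h' hs x < germMap h h' hs y
    rw [Germ.lt_iff, pos_germMap h h' hs hx, pos_germMap h h' hs hy, sgn_germMap, sgn_germMap]
    have := hs i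
    rw [Germ.lt_iff] at h2
    rcases h2 with h2 | ⟨h2, h2'⟩
    · left
      gcongr
    · exact Or.inr ⟨by rw [h2], h2'⟩
  img := fun i x h1 h2 => by
    rw [← Germ.in_iff]
    have hl : Germ.In (a i) (b i) (Germ.plus (a i) (h.left_mem i).1 (h.left_mem i).2) :=
      Or.inl ⟨rfl, le_rfl, h.lt i⟩
    have hr : Germ.In (a i) (b i) (Germ.minus (b i) (h.right_mem i).1 (h.right_mem i).2) :=
      Or.inr ⟨rfl, h.lt i, le_rfl⟩
    have el : germMap h h' hs (Germ.plus (a i) (h.left_mem i).1 (h.left_mem i).2) =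
        Germ.plus _ (h'.left_mem i).1 (h'.left_mem i).2 :=
      Germ.ext (pos_germMap h h' hs hl) rfl
    have er : germMap h h' hs (Germ.minus (b i) (h.right_mem i).1 (h.right_mem i).2) =
        Germ.minus _ (h'.right_mem i).1 (h'.right_mem i).2 :=
      Germ.ext (pos_germMap h h' hs hr) rfl
    change germMap h h' hs _ ≤ germMap h h' hs _ at h1
    change germMap h h' hs _ ≤ germMap h h' hs _ at h2
    rw [el] at h1
    rw [er] at h2
    have h3 := (Germ.in_iff _ _ _ _ _).2 ⟨h1, h2⟩
    have := h'.germ_uniq h3 (in_germMap h h' hs (h.in_idx x))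
    rw [this]
    exact h.in_idx x
  sg_l := fun i => rfl
  sg_r := fun i => rfl
  sg_T := fun x => rfl
  split := Germ.isSplitOrder

theorem in_of_mem {i : Fin d} {g : Germ} (h1 : (germExchange h h' hs).l i ≤ g)
    (h2 : g ≤ (germExchange h h' hs).r i) : Germ.In (a i) (b i) g :=
  (Germ.in_iff (h.left_mem i).1 (h.left_mem i).2 (h.right_mem i).1 (h.right_mem i).2 g).2 ⟨h1, h2⟩

theorem germExchange_T_apply (g : Germ) : (germExchange h h' hs).T g = germMap h h' hs g := rfl

theorem isAffine_germExchange :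
    (germExchange h h' hs).IsAffine Germ.pos (fun g => s (h.idx g)) where
  sl_pos := fun x => hs _
  sl_eq := fun i z z' h1 h2 h3 h4 => by
    rw [h.idx_eq (in_of_mem h h' hs h1 h2), h.idx_eq (in_of_mem h h' hs h3 h4)]
  affine := fun i z z' h1 h2 h3 h4 => by
    have hz := in_of_mem h h' hs h1 h2
    have hz' := in_of_mem h h' hs h3 h4
    rw [germExchange_T_apply, germExchange_T_apply, pos_germMap h h' hs hz,
      pos_germMap h h' hs hz', h.idx_eq hz]
    ring
  mono := Germ.monotone_pos
  lt_of_left := fun x z hxz hx => by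
    rcases Germ.lt_iff.1 hxz with h | h
    · exact h
    · rw [hx] at h
      exact absurd h.2.1 (by simp)
  lt_of_right := fun x z hxz hz => by
    rcases Germ.lt_iff.1 hxz with h | h
    · exact h
    · rw [hz] at h
      exact absurd h.2.2 (by simp)

end OfPartition

/-- The right germ of a point of `[0, 1)`. -/
def right (x : I01) : Germ := Germ.plus x x.2.1 x.2.2

@[simp] theorem pos_right (x : I01) : (right x).pos = x := rfl
@[simp] theorem sgn_right (x : I01) : (right x).sgn = true := rfl

theorem right_injective : Function.Injective right := fun x y h => by
  have := congrArg Germ.pos h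
  exact Subtype.ext this

/-- An affine interval exchange transformation acts on germs as an affine exchange. -/
theorem IsAIET.exists_exchange {d : ℕ} {T : Equiv.Perm I01} (hT : IsAIET d T) :
    ∃ (S : Exchange Germ Germ.sgn d) (sl : Germ → ℝ), S.IsAffine Germ.pos sl ∧
      ∀ x, S.T (right x) = right (T x) := by
  obtain ⟨a, b, s, t, hlt, hdis, hun, hs, haff⟩ := hT
  have h : IsPartition a b := by
    refine ⟨hlt, fun i j x hi hj => ?_, fun x => ?_⟩
    · by_contra hne
      exact Set.disjoint_left.1 (hdis i j hne) hi hj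
    · rw [← hun]; simp
  have key : ∀ i y, y ∈ Ico (s i * a i + t i) (s i * b i + t i) →
      ∃ x : I01, (x : ℝ) ∈ Ico (a i) (b i) ∧ (T x : ℝ) = y := by
    intro i y hy
    have e : y = s i * ((y - t i) / s i) + t i := by
      rw [mul_div_cancel₀ _ (hs i).ne']; ring
    have hx : (y - t i) / s i ∈ Ico (a i) (b i) := by
      rw [e] at hy
      simpa [hs] using hy
    refine ⟨⟨_, (h.mem_iff _).1 ⟨i, hx⟩⟩, hx, ?_⟩
    rw [haff i _ hx]
    exact e.symm
  have h' : IsPartition (fun i => s i * a i + t i) (fun i => s i * b i + t i) := by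
    refine ⟨fun i => ?_, fun i j y hi hj => ?_, fun y => ⟨?_, fun hy => ?_⟩⟩
    · have := hs i
      have := hlt i
      gcongr
    · obtain ⟨x, hx, ex⟩ := key i y hi
      obtain ⟨x', hx', ex'⟩ := key j y hj
      have : x = x' := T.injective (Subtype.ext (ex.trans ex'.symm))
      subst this
      exact h.uniq hx hx'
    · rintro ⟨i, hi⟩
      obtain ⟨x, hx, rfl⟩ := key i y hi
      exact (T x).2
    · obtain ⟨i, hi⟩ := (h.mem_iff (T⁻¹ ⟨y, hy⟩ : I01)).2 (T⁻¹ ⟨y, hy⟩ : I01).2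
      refine ⟨i, ?_⟩
      have e := haff i _ hi
      have e' : T (T⁻¹ ⟨y, hy⟩) = ⟨y, hy⟩ := by simp
      rw [e'] at e
      simp only at e
      rw [e]
      simpa [hs] using hi
  refine ⟨germExchange h h' hs, _, isAffine_germExchange h h' hs, fun x => ?_⟩
  obtain ⟨i, hi⟩ := (h.mem_iff x).2 x.2
  refine Germ.ext ?_ rfl
  rw [germExchange_T_apply, pos_germMap h h' hs (g := right x) (i := i) (Or.inl ⟨rfl, hi⟩), pos_right,
    pos_right, haff i x hi]

end GIET

/-! ### From germs back to points, and the final count -/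

namespace GIET

namespace Exchange

section General

variable {X : Type*} [LinearOrder X] {sg : X → Bool} {d : ℕ} (S : Exchange X sg d)
  [TopologicalSpace X] [OrderTopology X]

/-- Two non-periodic orbits that stay adjacent have the same limit set. -/
theorem visits_iff_of_covBy {y w z : X} (hw : ∀ n : ℕ, 0 < n → (S.T ^ n) w ≠ w)
    (h : ∀ k : ℕ, (S.T ^ k) y ⋖ (S.T ^ k) w) : Visits S.T z y ↔ Visits S.T z w := by
  have hy : ∀ n : ℕ, 0 < n → (S.T ^ n) y ≠ y := fun n hn e => by
    have h1 := h n
    rw [e] at h1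
    exact hw n hn (h1.unique_right (h 0))
  have shift : ∀ (x : X) (_ : ∀ n : ℕ, 0 < n → (S.T ^ n) x ≠ x) (N n : ℕ), 0 < n →
      (S.T ^ n) ((S.T ^ N) x) ≠ (S.T ^ N) x := fun x hx N n hn e => by
    refine hx n hn ((S.T ^ N).injective ?_)
    rwa [← Equiv.Perm.mul_apply, ← pow_add, add_comm, pow_add, Equiv.Perm.mul_apply] at e
  constructor
  · intro hv
    refine visits_of_exists fun s hs N => ?_
    obtain ⟨u, v, hu, hv', h1, h2, h3⟩ := S.exists_Icc_subset hs
    obtain ⟨n, hn, hne⟩ := ((visits_pow_iff N).2 hv).exists_ne (shift y hy N)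
      (S.Icc_mem_nhds hu hv' h1 h2) v
    rw [← Equiv.Perm.mul_apply, ← pow_add] at hn hne
    refine ⟨n + N, by omega, h3 ⟨hn.1.trans (h _).le, (h _).ge_of_gt (hn.2.lt_of_ne hne)⟩⟩
  · intro hv
    refine visits_of_exists fun s hs N => ?_
    obtain ⟨u, v, hu, hv', h1, h2, h3⟩ := S.exists_Icc_subset hs
    obtain ⟨n, hn, hne⟩ := ((visits_pow_iff N).2 hv).exists_ne (shift w hw N)
      (S.Icc_mem_nhds hu hv' h1 h2) u
    rw [← Equiv.Perm.mul_apply, ← pow_add] at hn hne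
    refine ⟨n + N, by omega, h3 ⟨(h _).le_of_lt (hn.1.lt_of_ne hne.symm), (h _).le.trans hn.2⟩⟩

/-- Visitor sets of distinct classes are disjoint subsets of `Fin d`, by `limitSet_eq_of_visits`. -/
theorem sum_card_visitors_le {f : Equiv.Perm X} (hf : f = S.T ∨ f = S.T⁻¹) (e : Fin d → X)
    {G : Finset X} (hrec : ∀ g ∈ G, Visits S.T g g) (hinj : Set.InjOn S.limitSet G) :
    ∑ g ∈ G, (visitors f e g).card ≤ d := by
  classical
  rw [← Finset.card_biUnion]
  · exact (Finset.card_le_univ _).trans (by simp)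
  · intro g hg g' hg' hne
    refine Finset.disjoint_left.2 fun j hj hj' => hne ?_
    exact hinj hg hg' (S.limitSet_eq_of_visits hf (hrec g hg) (hrec g' hg') (mem_visitors.1 hj)
      (mem_visitors.1 hj'))

/-- Every end of an endpoint orbit visits at most one class of recurrent points. -/
theorem sum_cnt_le {G : Finset X} (hrec : ∀ g ∈ G, Visits S.T g g)
    (hinj : Set.InjOn S.limitSet G) : ∑ g ∈ G, S.cnt g ≤ 4 * d := by
  simp only [cnt, Finset.sum_add_distrib]
  have h1 := S.sum_card_visitors_le (Or.inr rfl) S.l hrec hinj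
  have h2 := S.sum_card_visitors_le (Or.inr rfl) S.r hrec hinj
  have h3 := S.sum_card_visitors_le (Or.inl rfl) S.l hrec hinj
  have h4 := S.sum_card_visitors_le (Or.inl rfl) S.r hrec hinj
  omega

theorem limitSet_of_periodic {x : X} {n : ℕ} (hn : 0 < n) (h : (S.T ^ n) x = x) :
    S.limitSet x = Set.range fun m : ℕ => (S.T ^ m) x := by
  ext z
  constructor
  · exact fun hz => mem_orbit_of_visits_periodic hn h hz
  · rintro ⟨m, rfl⟩
    exact (visits_pow_left (Or.inl rfl) m).2 (visits_of_periodic hn h)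

end General

end Exchange

namespace Germ

theorem pos_eq_of_covBy {g h : Germ} (hc : g ⋖ h) : pos g = pos h := by
  obtain ⟨hg, hh⟩ := isSplitOrder.sg_of_covBy hc
  rcases lt_iff.1 hc.lt with hlt | hlt
  · obtain ⟨c, hc1, hc2⟩ := exists_between hlt
    have p1 : 0 ≤ pos g := by rcases in_unit g with h | h <;> linarith [h.2.1]
    have p2 : pos h ≤ 1 := by rcases in_unit h with h | h <;> linarith [h.2.2]
    exact absurd (lt_iff.2 (Or.inl hc2) : plus c (by linarith) (by linarith) < h)
      (hc.2 (lt_iff.2 (Or.inl hc1)))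
  · exact hlt.1

theorem continuous_pos : Continuous pos := by
  let p : Germ → Set.Icc (0 : ℝ) 1 := fun g => ⟨pos g, by
    rcases in_unit g with h | h
    · exact ⟨h.2.1, h.2.2.le⟩
    · exact ⟨h.2.1.le, h.2.2⟩⟩
  have hp : Continuous p := by
    refine Monotone.continuous_of_surjective (fun x y hxy => monotone_pos hxy) fun x => ?_
    rcases x.2.2.eq_or_lt with h | h
    · exact ⟨minus x (by linarith) h.le, rfl⟩
    · exact ⟨plus x x.2.1 h, rfl⟩
  exact continuous_subtype_val.comp hp

end Germ

/-- The points of `[0, 1)` with a germ in `A`. -/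
def shadow (A : Set Germ) : Set I01 := {z | ∃ g ∈ A, g.pos = z}

section Orbits

variable {T : Equiv.Perm I01} {x : I01}

theorem forwardOrbit_finite {n : ℕ} (hn : 0 < n) (h : (T ^ n) x = x) :
    (forwardOrbit T x).Finite := by
  refine (Set.finite_range fun k : Fin n => (T ^ (k : ℕ)) x).subset ?_
  rintro _ ⟨m, rfl⟩
  refine ⟨⟨m % n, Nat.mod_lt _ hn⟩, ?_⟩
  have hp : ∀ N, (T ^ (n * N)) x = x := fun N => by
    induction N with
    | zero => rfl
    | succ N ih => rw [Nat.mul_succ, pow_add, Equiv.Perm.mul_apply, h, ih]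
  have e : (T ^ (m % n + n * (m / n))) x = (T ^ (m % n)) x := by
    rw [pow_add, Equiv.Perm.mul_apply, hp]
  rw [Nat.mod_add_div] at e
  exact e.symm

theorem fullOrbit_finite {n : ℕ} (hn : 0 < n) (h : (T ^ n) x = x) : (fullOrbit T x).Finite := by
  refine (forwardOrbit_finite hn h).union (forwardOrbit_finite (T := T⁻¹) hn ?_)
  nth_rewrite 1 [← h]
  rw [← Equiv.Perm.mul_apply]
  simp

theorem exists_period (h : (fullOrbit T x).Finite) : ∃ n : ℕ, 0 < n ∧ (T ^ n) x = x := by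
  by_contra hc
  push Not at hc
  refine Set.infinite_of_injective_forall_mem (f := fun n : ℕ => (T ^ n) x) (fun i j e => ?_)
    (fun n => Or.inl ⟨n, rfl⟩) h
  have := injective_zpow_apply hc (a₁ := (i : ℤ)) (a₂ := (j : ℤ)) (by simpa using e)
  exact_mod_cast this

theorem fullOrbit_eq_range {n : ℕ} (hn : 0 < n) (h : (T ^ n) x = x) :
    fullOrbit T x = Set.range fun m : ℕ => (T ^ m) x := by
  refine Set.union_eq_left.2 ?_
  rintro _ ⟨k, rfl⟩
  refine ⟨(n - 1) * k, ((T ^ k).injective ?_)⟩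
  have e : (T ^ (n * k)) x = x := by
    rw [pow_mul]
    have : ∀ m : ℕ, ((T ^ n) ^ m) x = x := fun m => by
      induction m with
      | zero => rfl
      | succ m ih => rw [pow_succ, Equiv.Perm.mul_apply, h, ih]
    exact this k
  have e' : (T ^ k) ((T⁻¹ ^ k) x) = x := by rw [← Equiv.Perm.mul_apply]; simp
  simp only
  rw [e', ← Equiv.Perm.mul_apply, ← pow_add]
  convert e using 3
  obtain ⟨m, rfl⟩ : ∃ m, n = m + 1 := ⟨n - 1, by omega⟩
  simp only [Nat.add_sub_cancel]
  ring

theorem closure_fullOrbit (h : fullOrbit T x ⊆ omegaLim T x) :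
    closure (fullOrbit T x) = omegaLim T x := by
  refine (closure_minimal h (isClosed_derivedSet _)).antisymm fun z hz => ?_
  have : z ∈ closure (forwardOrbit T x) := mem_closure_iff_clusterPt.2 (AccPt.clusterPt hz)
  exact closure_mono Set.subset_union_left this

end Orbits

section Translation

variable {d : ℕ} {T : Equiv.Perm I01} {S : Exchange Germ Germ.sgn d}
  (hST : ∀ x, S.T (right x) = right (T x)) {x : I01}

include hST

theorem pow_right (n : ℕ) (x : I01) : (S.T ^ n) (right x) = right ((T ^ n) x) := by
  induction n with
  | zero => rfl
  | succ n ih => rw [pow_succ', Equiv.Perm.mul_apply, ih, hST, pow_succ', Equiv.Perm.mul_apply]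

theorem right_not_periodic (hx : ∀ n : ℕ, 0 < n → (T ^ n) x ≠ x) (n : ℕ) (hn : 0 < n) :
    (S.T ^ n) (right x) ≠ right x := fun e =>
  hx n hn (right_injective (by rw [← pow_right hST, e]))

/-- The `ω`-limit set of a non-periodic point is read off from its right germ. -/
theorem omegaLim_eq_shadow (hx : ∀ n : ℕ, 0 < n → (T ^ n) x ≠ x) :
    omegaLim T x = shadow (S.limitSet (right x)) := by
  ext z
  constructor
  · intro hz
    by_contra hc
    -- If no germ at `z` is visited, each has a clopen neighbourhood that the orbit eventually
    -- avoids. The right germ controls one side of `z` and the left germ the other; `0` has no left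
    -- germ and needs none.
    have main : ∀ g : Germ, g.pos = z → ∃ (u v : Germ) (N : ℕ), u.sgn = true ∧ v.sgn = false ∧
        u ≤ g ∧ g ≤ v ∧ ∀ n, N ≤ n → right ((T ^ n) x) ∉ Icc u v := by
      intro g hg
      have hg' : ¬ Visits S.T g (right x) := fun h => hc ⟨g, h, hg⟩
      by_contra hcon
      push Not at hcon
      refine hg' (visits_of_exists fun s hs N => ?_)
      obtain ⟨u, v, hu, hv, h1, h2, h3⟩ := S.exists_Icc_subset hs
      obtain ⟨n, hn, hn'⟩ := hcon u v N hu hv h1 h2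
      exact ⟨n, hn, h3 (by rwa [pow_right hST])⟩
    obtain ⟨_, v, N, -, hv, h1, h2, h3⟩ := main (right z) rfl
    have hzv : (z : ℝ) < v.pos := by
      rcases Germ.le_iff.1 h2 with h | h
      · exact h
      · exact absurd (h.2 rfl) (by simp [hv])
    have hl : ∃ (c : ℝ) (N' : ℕ), c < z ∧ ∀ n, N' ≤ n → ((T ^ n) x : ℝ) ∉ Ioo c z := by
      rcases z.2.1.eq_or_lt with h0 | h0
      · exact ⟨-1, 0, by linarith, fun n _ hn => absurd ((T ^ n) x).2.1 (by linarith [hn.2])⟩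
      · obtain ⟨u, v', N', hu, -, k1, k2, k3⟩ := main (Germ.minus z h0 z.2.2.le) rfl
        refine ⟨u.pos, N', ?_, fun n hn hmem => k3 n hn ⟨?_, le_trans ?_ k2⟩⟩
        · rcases Germ.le_iff.1 k1 with h | h
          · exact h
          · exact absurd (h.2 hu) (by simp)
        · exact Germ.le_iff.2 (Or.inl hmem.1)
        · exact Germ.le_iff.2 (Or.inl hmem.2)
    obtain ⟨c, N', hcz, hl⟩ := hl
    let F : Set I01 := (fun n : ℕ => (T ^ n) x) '' {n | n < max N N'}
    have hF : F.Finite := (Set.finite_lt_nat _).image _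
    have hU : (Subtype.val ⁻¹' Ioo c v.pos : Set I01) ∩ (F \ {z})ᶜ ∈ 𝓝 z := by
      refine inter_mem ?_ ?_
      · exact continuous_subtype_val.continuousAt.preimage_mem_nhds (Ioo_mem_nhds hcz hzv)
      · exact hF.sdiff.isClosed.isOpen_compl.mem_nhds (by simp)
    obtain ⟨y, ⟨⟨hy1, hy2⟩, n, rfl⟩, hne⟩ := accPt_iff_nhds.1 hz _ hU
    have hn : max N N' ≤ n := by
      by_contra hlt
      exact hy2 ⟨⟨n, not_le.1 hlt, rfl⟩, hne⟩
    simp only at hne hy1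
    rcases lt_or_gt_of_ne (show ((T ^ n) x : ℝ) ≠ z from fun e => hne (Subtype.ext e)) with h | h
    · exact hl n ((le_max_right _ _).trans hn) ⟨hy1.1, h⟩
    · refine h3 n ((le_max_left _ _).trans hn) ⟨h1.trans ?_, Germ.le_iff.2 (Or.inl hy1.2)⟩
      exact Germ.le_iff.2 (Or.inl h)
  · rintro ⟨g, hg, hgz⟩
    refine accPt_iff_nhds.2 fun U hU => ?_
    obtain ⟨V, hV, hVU⟩ := mem_nhds_induced _ z U |>.1 hU
    have hW : Germ.pos ⁻¹' V ∈ 𝓝 g :=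
      Germ.continuous_pos.continuousAt.preimage_mem_nhds (by rwa [hgz])
    obtain ⟨n, hn, hne⟩ := Visits.exists_ne hg (right_not_periodic hST hx) hW (right z)
    rw [pow_right hST] at hn hne
    exact ⟨(T ^ n) x, ⟨hVU hn, n, rfl⟩, fun e => hne (by rw [e])⟩

/-- Every quasiminimal is the set of points of the limit set of a recurrent germ. -/
theorem exists_germ_of_mem_quasiminimals {Ω : Set I01} (hΩ : Ω ∈ quasiminimals T) :
    ∃ g, Visits S.T g g ∧ (∀ n : ℕ, 0 < n → (S.T ^ n) g ≠ g) ∧ shadow (S.limitSet g) = Ω := by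
  obtain ⟨x, ⟨hinf, hω, -⟩, rfl⟩ := hΩ
  have hx : ∀ n : ℕ, 0 < n → (T ^ n) x ≠ x := fun n hn h => hinf (fullOrbit_finite hn h)
  have hx' := right_not_periodic hST hx
  rw [closure_fullOrbit hω, omegaLim_eq_shadow hST hx]
  by_cases hrec : Visits S.T (right x) (right x)
  · exact ⟨right x, hrec, hx', rfl⟩
  -- If `right x` is not recurrent, the points of the orbit can be approached only from the left.
  have hleft : ∀ n : ℕ, ∃ g, Visits S.T g (right x) ∧ g ⋖ right ((T ^ n) x) := by
    intro n
    have h1 : (T ^ n) x ∈ omegaLim T x := hω (Or.inl ⟨n, rfl⟩)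
    rw [omegaLim_eq_shadow hST hx] at h1
    obtain ⟨g, hg, hgp⟩ := h1
    refine ⟨g, hg, Germ.covBy_of_pos_eq hgp ?_ rfl⟩
    cases hs : g.sgn
    · rfl
    · have : g = right ((T ^ n) x) := Germ.ext hgp hs
      rw [this, ← pow_right hST] at hg
      exact absurd ((Exchange.visits_pow_left (Or.inl rfl) n).1 hg) hrec
  -- Past the last left endpoint on the orbit, the left and right germs stay adjacent forever. They
  -- then have the same limit set, and the left germ is recurrent.
  obtain ⟨N, hN⟩ := (S.finite_times hx').bddAbove
  obtain ⟨y, hy, hyc⟩ := hleft (N + 1)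
  have hcov : ∀ k : ℕ, (S.T ^ k) y ⋖ (S.T ^ k) (right ((T ^ (N + 1)) x)) := by
    intro k
    induction k with
    | zero => exact hyc
    | succ k ih =>
      rw [pow_succ', Equiv.Perm.mul_apply, Equiv.Perm.mul_apply]
      refine S.covBy_T ih fun j e => ?_
      rw [← pow_right hST, ← Equiv.Perm.mul_apply, ← pow_add] at e
      have := hN ⟨j, e⟩
      omega
  have hper : ∀ n : ℕ, 0 < n → (S.T ^ n) (right ((T ^ (N + 1)) x)) ≠ right ((T ^ (N + 1)) x) := by
    refine right_not_periodic hST fun n hn e => hx n hn ((T ^ (N + 1)).injective ?_)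
    rwa [← Equiv.Perm.mul_apply, ← pow_add, add_comm, pow_add, Equiv.Perm.mul_apply] at e
  have hlim : ∀ z, Visits S.T z y ↔ Visits S.T z (right x) := fun z => by
    rw [S.visits_iff_of_covBy hper hcov, ← pow_right hST, visits_pow_iff]
  refine ⟨y, (hlim y).2 hy, fun n hn e => ?_, ?_⟩
  · have h1 := hcov n
    rw [e] at h1
    exact hper n hn (h1.unique_right hyc)
  · congr 1
    ext z
    exact hlim z

theorem shadow_limitSet_right {n : ℕ} (hn : 0 < n) (h : (T ^ n) x = x) :
    shadow (S.limitSet (right x)) = fullOrbit T x := by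
  rw [S.limitSet_of_periodic hn (by rw [pow_right hST, h]), fullOrbit_eq_range hn h]
  ext z
  constructor
  · rintro ⟨_, ⟨m, rfl⟩, hz⟩
    simp only [pow_right hST] at hz
    exact ⟨m, Subtype.ext hz⟩
  · rintro ⟨m, rfl⟩
    exact ⟨_, ⟨m, rfl⟩, by simp only [pow_right hST]; rfl⟩

variable {sl : Germ → ℝ} (hA : S.IsAffine Germ.pos sl)

include hA

/-- With multiplier one, `T ^ n` fixes a whole right neighbourhood of `x`, which finitely many
finite orbits cannot cover. -/
theorem infinite_periodicOrbits {n : ℕ} (hn : 0 < n) (h : (T ^ n) x = x)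
    (hm : S.mult sl n (right x) = 1) : (periodicOrbits T).Infinite := by
  intro hfin
  obtain ⟨R, hR, hfix⟩ := hA.exists_fixed hn (x := right x) (by rw [pow_right hST, h]) rfl hm
  have hxR : (x : ℝ) < R.pos := hA.lt_of_left hR rfl
  obtain ⟨c, hc1, hc2⟩ := exists_between (lt_min hxR x.2.2)
  have hc : c ∈ Ico (0 : ℝ) 1 := ⟨x.2.1.trans hc1.le, hc2.trans_le (min_le_right _ _)⟩
  have hinf : (Ico x ⟨c, hc⟩).Infinite := Set.Ico_infinite (show x < ⟨c, hc⟩ from hc1)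
  refine hinf ((hfin.sUnion ?_).subset ?_)
  · rintro O ⟨y, rfl, hO⟩
    exact hO
  · intro y hy
    have hy2 : (y : ℝ) < R.pos := lt_trans hy.2 (hc2.trans_le (min_le_left _ _))
    have e : (T ^ n) y = y := by
      refine right_injective ?_
      rw [← pow_right hST]
      refine hfix _ (Germ.le_iff.2 ?_) (Germ.le_iff.2 (Or.inl hy2))
      rcases (show (x : ℝ) ≤ y from hy.1).eq_or_lt with h | h
      · exact Or.inr ⟨h, fun _ => rfl⟩
      · exact Or.inl h
    exact ⟨fullOrbit T y, ⟨y, rfl, fullOrbit_finite hn e⟩, Or.inl ⟨0, rfl⟩⟩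

/-- If there are finitely many periodic orbits, each of them is visited by at least four ends of
endpoint orbits. -/
theorem exists_germs_of_mem_periodicOrbits (hfin : (periodicOrbits T).Finite) {O : Set I01}
    (hO : O ∈ periodicOrbits T) :
    ∃ A : Finset Germ, (∀ g ∈ A, Visits S.T g g) ∧ (∀ g ∈ A, shadow (S.limitSet g) = O) ∧
      Set.InjOn S.limitSet A ∧ 4 ≤ ∑ g ∈ A, S.cnt g := by
  obtain ⟨x, rfl, hO⟩ := hO
  obtain ⟨n, hn, h⟩ := exists_period hO
  have h' : (S.T ^ n) (right x) = right x := by rw [pow_right hST, h]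
  have hm : S.mult sl n (right x) ≠ 1 := fun e => infinite_periodicOrbits hST hA hn h e hfin
  -- If the orbit of the right germ meets a left endpoint, it has four ends by itself. Otherwise the
  -- left germs form a second periodic orbit, distinguished by sign, and each of the two has two
  -- ends.
  by_cases hmeet : ∃ k j, (S.T ^ k) (right x) = S.l j
  · refine ⟨{right x}, by simpa using visits_of_periodic hn h',
      by simpa using shadow_limitSet_right hST hn h, by simp, ?_⟩
    simpa using (hA.cnt_of_mult_ne_one hn h' rfl hm).2 hmeet
  push Not at hmeet
  obtain ⟨y, hy⟩ : ∃ y, y ⋖ right x := by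
    rcases S.split.exists_pred (u := right x) rfl with hmin | hy
    · obtain ⟨j, hj⟩ := S.l_of_isMin hmin
      exact absurd hj (hmeet 0 j)
    · exact hy
  obtain ⟨hcov, hyn, hmy⟩ := hA.pred_periodic hy h' hmeet
  have hsy : y.sgn = false := (S.split.sg_of_covBy hy).1
  have hpos : ∀ m : ℕ, ((S.T ^ m) y).pos = ((S.T ^ m) (right x)).pos := fun m =>
    Germ.pos_eq_of_covBy (hcov m)
  have hlim : S.limitSet (right x) ≠ S.limitSet y := by
    intro e
    have h1 : y ∈ S.limitSet (right x) := by rw [e]; exact visits_of_periodic hn hyn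
    rw [S.limitSet_of_periodic hn h'] at h1
    obtain ⟨m, hm⟩ := h1
    have h2 := S.sg_pow m (right x)
    simp only at hm
    rw [hm, hsy] at h2
    exact absurd h2 (by simp)
  refine ⟨{right x, y}, ?_, ?_, ?_, ?_⟩
  · simp only [Finset.mem_insert, Finset.mem_singleton, forall_eq_or_imp, forall_eq]
    exact ⟨visits_of_periodic hn h', visits_of_periodic hn hyn⟩
  · simp only [Finset.mem_insert, Finset.mem_singleton, forall_eq_or_imp, forall_eq]
    refine ⟨shadow_limitSet_right hST hn h, ?_⟩
    rw [← shadow_limitSet_right hST hn h, S.limitSet_of_periodic hn h',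
      S.limitSet_of_periodic hn hyn]
    ext z
    simp [shadow, hpos]
  · rw [Finset.coe_pair, Set.injOn_pair]
    exact fun e => absurd e hlim
  · rw [Finset.sum_pair (fun e => hlim (by rw [← e]))]
    have h1 := hA.two_le_cnt hn h' hm
    have h2 := hA.two_le_cnt hn hyn (by rwa [hmy])
    omega

end Translation

/-- The counting bound for finite families of quasiminimals and periodic orbits. -/
theorem card_quasiminimals_periodicOrbits_le {d : ℕ} {T : Equiv.Perm I01} (hT : IsAIET d T)
    {Q P : Finset (Set I01)} (hQ : ↑Q ⊆ quasiminimals T) (hP : ↑P ⊆ periodicOrbits T)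
    (hfin : P.Nonempty → (periodicOrbits T).Finite) : 8 * Q.card + 4 * P.card ≤ 4 * d := by
  classical
  obtain ⟨S, sl, hA, hST⟩ := hT.exists_exchange
  have hdis : Disjoint Q P := by
    refine Finset.disjoint_left.2 fun Ω h1 h2 => ?_
    obtain ⟨x, hx, rfl⟩ := hQ h1
    obtain ⟨y, -, hy⟩ := hP h2
    exact hx.1 (hy.subset subset_closure)
  have hq : ∀ Ω, ∃ A : Finset Germ, Ω ∈ Q → (∀ g ∈ A, Visits S.T g g) ∧
      (∀ g ∈ A, shadow (S.limitSet g) = Ω) ∧ Set.InjOn S.limitSet A ∧ 8 ≤ ∑ g ∈ A, S.cnt g := by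
    intro Ω
    by_cases hΩ : Ω ∈ Q
    · obtain ⟨g, h1, h2, h3⟩ := exists_germ_of_mem_quasiminimals hST (hQ hΩ)
      exact ⟨{g}, fun _ => ⟨by simpa using h1, by simpa using h3, by simp,
        by simpa using S.eight_le_cnt h1 h2⟩⟩
    · exact ⟨∅, fun h => absurd h hΩ⟩
  have hp : ∀ O, ∃ A : Finset Germ, O ∈ P → (∀ g ∈ A, Visits S.T g g) ∧
      (∀ g ∈ A, shadow (S.limitSet g) = O) ∧ Set.InjOn S.limitSet A ∧ 4 ≤ ∑ g ∈ A, S.cnt g := by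
    intro O
    by_cases hO : O ∈ P
    · obtain ⟨A, hA'⟩ := exists_germs_of_mem_periodicOrbits hST hA (hfin ⟨O, hO⟩) (hP hO)
      exact ⟨A, fun _ => hA'⟩
    · exact ⟨∅, fun h => absurd h hO⟩
  choose A hA1 using hq
  choose B hB1 using hp
  let C : Set I01 → Finset Germ := fun o => if o ∈ Q then A o else B o
  have hC : ∀ o ∈ Q ∪ P, (∀ g ∈ C o, Visits S.T g g) ∧ (∀ g ∈ C o, shadow (S.limitSet g) = o) ∧
      Set.InjOn S.limitSet (C o) := by
    intro o ho
    by_cases hoQ : o ∈ Q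
    · simp only [C, if_pos hoQ]
      exact ⟨(hA1 o hoQ).1, (hA1 o hoQ).2.1, (hA1 o hoQ).2.2.1⟩
    · have hoP : o ∈ P := (Finset.mem_union.1 ho).resolve_left hoQ
      simp only [C, if_neg hoQ]
      exact ⟨(hB1 o hoP).1, (hB1 o hoP).2.1, (hB1 o hoP).2.2.1⟩
  have hpd : ∀ o ∈ Q ∪ P, ∀ o' ∈ Q ∪ P, o ≠ o' → Disjoint (C o) (C o') := by
    intro o ho o' ho' hne
    refine Finset.disjoint_left.2 fun g hg hg' => hne ?_
    rw [← (hC o ho).2.1 g hg, (hC o' ho').2.1 g hg']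
  -- Germs chosen for different sets have different limit sets, because the shadow of the limit set
  -- recovers the set.
  have key := S.sum_cnt_le (G := (Q ∪ P).biUnion C) (fun g hg => by
      obtain ⟨o, ho, hgo⟩ := Finset.mem_biUnion.1 hg
      exact (hC o ho).1 g hgo) (fun g hg g' hg' e => by
      obtain ⟨o, ho, hgo⟩ := Finset.mem_biUnion.1 (Finset.mem_coe.1 hg)
      obtain ⟨o', ho', hgo'⟩ := Finset.mem_biUnion.1 (Finset.mem_coe.1 hg')
      have : o = o' := by rw [← (hC o ho).2.1 g hgo, e, (hC o' ho').2.1 g' hgo']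
      subst this
      exact (hC o ho).2.2 hgo hgo' e)
  rw [Finset.sum_biUnion hpd, Finset.sum_union hdis] at key
  have k1 : Q.card • 8 ≤ ∑ o ∈ Q, ∑ g ∈ C o, S.cnt g :=
    Finset.card_nsmul_le_sum _ _ _ fun o ho => by
      simp only [C, if_pos ho]
      exact (hA1 o ho).2.2.2
  have k2 : P.card • 4 ≤ ∑ o ∈ P, ∑ g ∈ C o, S.cnt g :=
    Finset.card_nsmul_le_sum _ _ _ fun o ho => by
      simp only [C, if_neg fun h => Finset.disjoint_left.1 hdis h ho]
      exact (hB1 o ho).2.2.2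
  simp only [smul_eq_mul] at k1 k2
  omega

end GIET

end

theorem corollary1p4 (d : ℕ) (T : Equiv.Perm (Set.Ico (0 : ℝ) 1)) (hT : GIET.IsAIET d T) :
    (GIET.quasiminimals T).Finite ∧
      ((GIET.periodicOrbits T).Infinite ∨
        ((GIET.periodicOrbits T).ncard : ℤ) ≤ (d : ℤ) - 2 * ((GIET.quasiminimals T).ncard : ℤ)) := by
  have hfin : (GIET.quasiminimals T).Finite := by
    by_contra hinf
    -- Any `d + 1` quasiminimals would give `8 (d + 1) ≤ 4 d`. With `P = ∅` the finiteness of the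
    -- periodic orbits is not needed.
    obtain ⟨Q, hQ, hcard⟩ := Set.Infinite.exists_subset_card_eq hinf (d + 1)
    have := GIET.card_quasiminimals_periodicOrbits_le hT (P := ∅) hQ (by simp) (by simp)
    simp only [Finset.card_empty] at this
    omega
  refine ⟨hfin, ?_⟩
  by_cases hP : (GIET.periodicOrbits T).Finite
  · right
    have := GIET.card_quasiminimals_periodicOrbits_le hT (Q := hfin.toFinset) (P := hP.toFinset)
      (by simp) (by simp) (fun _ => hP)
    rw [Set.ncard_eq_toFinset_card _ hfin, Set.ncard_eq_toFinset_card _ hP]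
    omega
  · exact Or.inl hP
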